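/- **Notation.** For $\beta\in\{2,4\}$, an integer $n\ge 1$ and a weight $w$ on an interval $I$, let $\langle f(x_1)+\dots+f(x_n)\rangle$ denote the average with respect to the probability density $\frac1C\prod_{j=1}^n w(x_j)\prod_{1\le i<j\le n}|x_j-x_i|^\beta$ on $I^n$. Let $M^{(\beta)}_{\mathrm J_{a,b}}(k,n)=\langle x_1^k+\dots+x_n^k\rangle$ for $I=[0,1]$, $w(x)=x^{\frac\beta2(b+1)-1}(1-x)^{\frac\beta2(a+1)-1}$, and $M^{(\beta)}_{\mathrm L_b}(k,n)=\langle x_1^k+\dots+x_n^k\rangle$ for $I=[0,\infty)$, $w(x)=x^{\frac\beta2(b+1)-1}e^{-\beta x/2}$. The moments of the transmission eigenvalues are $$\langle\mathcal T^{(\beta,\delta)}_{k,n,m}\rangle=M^{(\beta)}_{\mathrm J_{a,b}}(k,n),\qquad a=\tfrac2\beta\left(1+\tfrac\delta2\right)-1,\quad b=m-n .$$ The moments of the proper delay times are $\langle\mathcal D^{(\beta)}_{k,n}\rangle=\frac1n\langle\gamma_1^{-k}+\dots+\gamma_n^{-k}\rangle$, where $I=[0,\infty)$ and $w(\gamma)=\gamma^{n\beta/2}e^{-\beta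 n\gamma/2}$. Finally $(x)_{(s)}=\Gamma(x+s)/\Gamma(x)$ and $\binom ki=\frac{k(k-1)\cdots(k-i+1)}{i!}$ for complex $k$; rational expressions are read by continuity at removable singularities. **Theorem.** Let $n\ge1$ be an integer. (1) *Transmission eigenvalues.* Let $m\ge n$ and $k\ge1$ be integers. For every real $\delta>-2$, $$\langle\mathcal T^{(4,\delta)}_{k,n,m}\rangle=\tfrac12\langle\mathcal T^{(2,\delta-2)}_{k,2n,2m}\rangle-\sum_{j=1}^{\min(n,\lfloor k/2\rfloor)}\ \sum_{i=0}^{\min(k-2j,\,2n-2j)}\binom ki\binom k{i+2j}\,\mathcal S^\delta_{i,j}(k,m,n),$$ where $$\begin{aligned}\mathcal S^\delta_{i,j}(k,m,n)=2^{4j-3}\,&\frac{(\frac\delta2+2n-i-2j)_{(i)}\,(2m)_{(k-i-2j+1)}\,(\frac\delta2+2m-1)_{(k-i-2j+1)}}{(\frac\delta4+n+\frac12)_{(-j)}\,(m)_{(1-j)}\,(\frac\delta4+m-\frac12)_{(1-j)}\,(2n-2j+1)_{(-i)}\,(n+1)_{(-j)}}\\ &\times\frac{(\frac\delta2+2m+2n-4j)\,(\frac\delta2+2m+2n-2i-4j+k)}{(\frac\delta2+2m+2n-i-2j)_{(1+k)}\,(\frac\delta2+2m+2n-i-4j)_{(1+k)}}.\end{aligned}$$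 If $\delta>0$, both moments are given by convergent integrals. If $-2<\delta\le0$, the integrals defining $\langle\mathcal T^{(2,\delta-2)}_{k,2n,2m}\rangle$ diverge, and this symbol denotes the value at $\delta-2$ of the analytic continuation of $\delta'\mapsto\langle\mathcal T^{(2,\delta')}_{k,2n,2m}\rangle$ from $(-2,\infty)$ to $(-4,\infty)$, which exists. (2) *Laguerre symplectic ensemble.* Let $b>-1$ be real and let $k$ be complex with $2b+\operatorname{Re}k>-2$ and $2b+k\ne-1$. Then $$M^{(4)}_{\mathrm L_b}(k,n)=2^{-k-1}M^{(2)}_{\mathrm L_{2b}}(k,2n)-\sum_{j=1}^{n}\sum_{i=0}^{2n-2j}\binom ki\binom k{i+2j}\frac{(2b+2n)_{(k-i-2j+1)}\,(2n-i-2j+1)_{(i)}}{2^{k-2j+2}\,(n+1)_{(-j)}\,(b+n)_{(1-j)}} .$$ If $2b>-1$ and $2b+\operatorname{Re}k>-1$, both moments are given by convergent integrals. In the remaining cases $M^{(2)}_{\mathrm L_{2b}}(k,2n)$ denotes the value at $(2b,k)$ of the analytic continuation of $(B,k)\mapsto M^{(2)}_{\mathrm L_B}(k,2n)$ to $\{(B,k)\in\mathbb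 C^2:\operatorname{Re}B>-2,\ \operatorname{Re}(B+k)>-2,\ B+k\neq-1\}$, which exists. If $b>-1$ and $2b+k=-1$, then $M^{(4)}_{\mathrm L_b}(k,n)$ is the limit of the right-hand side at $s$ as $s\to k$, $s\neq k$. (3) *Proper delay times.* For every integer $k$ with $1\le k<2n+1$, $$\langle\mathcal D^{(4)}_{k,n}\rangle=n^{k-1}M^{(4)}_{\mathrm L_{n-1/2}}(-k,n).$$ -/

import Mathlib

open MeasureTheory Filter Topology

noncomputable section

/-! ## Averages over beta-ensembles of eigenvalues -/

/-- The unnormalized joint density `∏ⱼ w(xⱼ) ∏_{i<j} |xⱼ - xᵢ|^β` of `n` eigenvalues. -/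
def jointDensity (β : ℕ) (w : ℝ → ℝ) {n : ℕ} (x : Fin n → ℝ) : ℝ :=
  (∏ j, w (x j)) * ∏ i, ∏ j ∈ Finset.Ioi i, |x j - x i| ^ β

/-- The average of the linear statistic `f(x₁) + ⋯ + f(xₙ)` when `x₁, …, xₙ ∈ I` have joint
probability density `C⁻¹ ∏ⱼ w(xⱼ) ∏_{i<j} |xⱼ - xᵢ|^β`; here `C` is the normalization constant. -/
def linearStatisticAverage {E : Type*} [NormedAddCommGroup E] [NormedSpace ℝ E]
    (β : ℕ) (I : Set ℝ) (w : ℝ → ℝ) (n : ℕ) (f : ℝ → E) : E :=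
  (∫ x in Set.univ.pi (fun _ : Fin n => I), jointDensity β w x)⁻¹ •
    ∫ x in Set.univ.pi (fun _ : Fin n => I), jointDensity β w x • ∑ j, f (x j)

/-- The weight of the Jacobi ensemble `J_{a,b}` on `[0,1]`. -/
def jacobiWeight (β : ℕ) (a b x : ℝ) : ℝ :=
  x ^ ((β : ℝ) / 2 * (b + 1) - 1) * (1 - x) ^ ((β : ℝ) / 2 * (a + 1) - 1)

/-- The weight of the Laguerre ensemble `L_b` on `[0,∞)`. -/
def laguerreWeight (β : ℕ) (b x : ℝ) : ℝ :=
  x ^ ((β : ℝ) / 2 * (b + 1) - 1) * Real.exp (-(β : ℝ) * x / 2)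

/-- The moment `M^{(β)}_{J_{a,b}}(k,n)` of the Jacobi ensemble. -/
def jacobiMoment (β : ℕ) (a b : ℝ) (k n : ℕ) : ℝ :=
  linearStatisticAverage β (Set.Icc 0 1) (jacobiWeight β a b) n (fun x => x ^ k)

/-- The moment `M^{(β)}_{L_b}(k,n)` of the Laguerre ensemble, of complex order `k`. -/
def laguerreMoment (β : ℕ) (b : ℝ) (k : ℂ) (n : ℕ) : ℂ :=
  linearStatisticAverage β (Set.Ici 0) (laguerreWeight β b) n (fun x => (x : ℂ) ^ k)

/-- The moment `⟨T_{k,n,m}^{(β,δ)}⟩` of the `n` transmission eigenvalues of a cavity whose leads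
support `n` and `m` channels. -/
def transmissionMoment (β : ℕ) (δ : ℝ) (k n m : ℕ) : ℝ :=
  jacobiMoment β (2 / (β : ℝ) * (1 + δ / 2) - 1) ((m : ℝ) - n) k n

/-- With these parameters the Jacobi weight is `T^α (1-T)^{δ/2}`, `α = (β/2)(m-n+1) - 1`. -/
theorem jacobiWeight_transmission (β : ℕ) (hβ : β ≠ 0) (δ b x : ℝ) :
    jacobiWeight β (2 / (β : ℝ) * (1 + δ / 2) - 1) b x =
      x ^ ((β : ℝ) / 2 * (b + 1) - 1) * (1 - x) ^ (δ / 2) := by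
  have h : (β : ℝ) ≠ 0 := Nat.cast_ne_zero.mpr hβ
  have e : (β : ℝ) / 2 * (2 / (β : ℝ) * (1 + δ / 2) - 1 + 1) - 1 = δ / 2 := by
    field_simp
    ring
  rw [jacobiWeight, e]

/-- The moment `⟨D_{k,n}^{(β)}⟩ = n⁻¹ ⟨τ₁^k + ⋯ + τₙ^k⟩` of the proper delay times. The inverse
delay times `γⱼ = τⱼ⁻¹` have joint density proportional to
`∏ⱼ γⱼ^{nβ/2} e^{-β n γⱼ/2} ∏_{i<j} |γⱼ - γᵢ|^β` (Heisenberg time equal to `n`). -/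
def delayMoment (β : ℕ) (k n : ℕ) : ℝ :=
  (n : ℝ)⁻¹ * linearStatisticAverage β (Set.Ici 0)
    (fun γ => γ ^ ((n : ℝ) * β / 2) * Real.exp (-(β : ℝ) * n * γ / 2)) n (fun γ => (γ⁻¹) ^ k)

/-! ## Pochhammer symbols -/

/-- The Pochhammer symbol `(x)_{(s)} = Γ(x+s)/Γ(x)` with complex entries. -/
def pochC (x s : ℂ) : ℂ := Complex.Gamma (x + s) / Complex.Gamma x

/-- The Pochhammer symbol `(x)_{(s)} = Γ(x+s)/Γ(x)` for an integer `s`, as the rational function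
`x(x+1)⋯(x+s-1)` for `s ≥ 0`, and `1/((x-1)(x-2)⋯(x-|s|))` for `s < 0`. -/
def pochZ (x : ℝ) : ℤ → ℝ
  | Int.ofNat s => ∏ l ∈ Finset.range s, (x + l)
  | Int.negSucc s => (∏ l ∈ Finset.range (s + 1), (x - (l + 1)))⁻¹

theorem pochZ_ofNat_eq (x : ℝ) (hx : ∀ l : ℕ, x ≠ -l) (s : ℕ) :
    pochZ x (s : ℤ) = Real.Gamma (x + s) / Real.Gamma x := by
  have hG : Real.Gamma x ≠ 0 := Real.Gamma_ne_zero hx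
  rw [eq_div_iff hG]
  change (∏ l ∈ Finset.range s, (x + l)) * _ = _
  induction s with
  | zero => simp
  | succ s ih =>
    have h0 : x + s ≠ 0 := fun h => hx s (by linarith)
    rw [Finset.prod_range_succ, mul_right_comm, ih, Nat.cast_succ, ← add_assoc,
      Real.Gamma_add_one h0, mul_comm]

theorem pochZ_neg_eq (x : ℝ) (s : ℕ) (hx : ∀ l : ℕ, x - s ≠ -l) :
    pochZ x (-(s : ℤ)) = Real.Gamma (x - s) / Real.Gamma x := by
  have hp : ∀ y : ℝ, pochZ y (-(s : ℤ)) = (∏ l ∈ Finset.range s, (y - (l + 1)))⁻¹ := by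
    intro y
    cases s with
    | zero => simp [pochZ]
    | succ s => rfl
  have h1 : ∏ l ∈ Finset.range s, (x - s + l) = ∏ l ∈ Finset.range s, (x - (l + 1)) := by
    rw [← Finset.prod_range_reflect]
    refine Finset.prod_congr rfl fun l hl => ?_
    have hl' := Finset.mem_range.mp hl
    have : ((s - 1 - l : ℕ) : ℝ) = s - 1 - l := by
      rw [Nat.cast_sub (by omega), Nat.cast_sub (by omega), Nat.cast_one]
    rw [this]
    ring
  have h2 := pochZ_ofNat_eq (x - s) hx s
  rw [sub_add_cancel] at h2
  change (∏ l ∈ Finset.range s, (x - s + l)) = _ at h2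
  rw [hp, ← h1, h2, inv_div]

/-! ## The coefficients of the double sums -/

/-- The quotient `X / (X-i)_{(1+k)}`. For `i = 0` the common factor `X` is cancelled, so that the
removable singularity at `X = 0` has its limiting value. -/
def cancelledQuotient (X : ℝ) (i k : ℕ) : ℝ :=
  if i = 0 then (pochZ (X + 1) k)⁻¹ else X / pochZ (X - i) (1 + k)

theorem cancelledQuotient_eq (X : ℝ) (hX : X ≠ 0) (i k : ℕ) :
    cancelledQuotient X i k = X / pochZ (X - i) (1 + k) := by
  unfold cancelledQuotient
  split_ifs with h
  · subst h
    have e : ((1 : ℤ) + (k : ℤ)) = Int.ofNat (k + 1) := by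
      simp [add_comm]
    have h1 : pochZ (X - ((0 : ℕ) : ℝ)) (1 + k) = X * pochZ (X + 1) k := by
      rw [e]
      change ∏ l ∈ Finset.range (k + 1), (X - ((0 : ℕ) : ℝ) + l) =
        X * ∏ l ∈ Finset.range k, (X + 1 + l)
      rw [Finset.prod_range_succ', mul_comm]
      congr 1
      · simp
      · refine Finset.prod_congr rfl fun l _ => ?_
        push_cast
        ring
    rw [h1, ← div_div, div_self hX, one_div]
  · rfl

/-- The coefficient `S_{i,j}^δ(k,m,n)`. -/
def jacobiCoeff (δ : ℝ) (i j k m n : ℕ) : ℝ :=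
  (2 : ℝ) ^ (4 * (j : ℤ) - 3) *
    (pochZ (δ / 2 + 2 * n - i - 2 * j) i * pochZ (2 * m) ((k : ℤ) - i - 2 * j + 1) *
      pochZ (δ / 2 + 2 * m - 1) ((k : ℤ) - i - 2 * j + 1)) /
    (pochZ (δ / 4 + n + 1 / 2) (-j) * pochZ m (1 - j) * pochZ (δ / 4 + m - 1 / 2) (1 - j) *
      pochZ (2 * n - 2 * j + 1) (-i) * pochZ (n + 1) (-j)) *
    (cancelledQuotient (δ / 2 + 2 * m + 2 * n - 4 * j) i k *
      (δ / 2 + 2 * m + 2 * n - 2 * i - 4 * j + k) /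
      pochZ (δ / 2 + 2 * m + 2 * n - i - 2 * j) (1 + k))

/-- The double sum in the symplectic transmission moments. -/
def jacobiCorrection (δ : ℝ) (k m n : ℕ) : ℝ :=
  ∑ j ∈ Finset.Icc 1 (min n (k / 2)), ∑ i ∈ Finset.Icc 0 (min (k - 2 * j) (2 * n - 2 * j)),
    (k.choose i : ℝ) * (k.choose (i + 2 * j) : ℝ) * jacobiCoeff δ i j k m n

/-- The double sum in the symplectic Laguerre moments. `Ring.choose k i` is the generalized
binomial coefficient `k(k-1)⋯(k-i+1)/i!`. -/
def laguerreCorrection (b : ℝ) (k : ℂ) (n : ℕ) : ℂ :=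
  ∑ j ∈ Finset.Icc 1 n, ∑ i ∈ Finset.Icc 0 (2 * n - 2 * j),
    Ring.choose k i * Ring.choose k (i + 2 * j) *
      (pochC (2 * b + 2 * n) (k - i - 2 * j + 1) * pochC (2 * n - i - 2 * j + 1) i) /
      ((2 : ℂ) ^ (k - 2 * j + 2) * pochC (n + 1) (-j) * pochC (b + n) (1 - j))

end

/-! Both ensembles are treated by one mechanism. The interaction ∏|x_j - x_i|^4 is a confluent
Vandermonde determinant, so expanding it and integrating (de Bruijn) gives the normalization, up to
a constant, as the Pfaffian of A_{pq} = Λ(φ_p φ_q' - φ_p' φ_q). Here Λ is integration against the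
weight and φ_0, φ_1, ... are any polynomials with deg φ_j = j. The average of f(x_1) + ... + f(x_n)
is the first variation of the logarithm of this Pfaffian when w becomes w(1 + εf), that is, when A
is perturbed by the matrix B of the same pairings for the weight wf. If B = XA + AXᵀ, the
perturbation is an infinitesimal congruence, and Pf(gAgᵀ) = det g · Pf A shows that the average is
tr X (`linearStatisticAverage_four`, `pfaffianSum.sum_update_eq_trace_mul`).

Take for φ_j the polynomials orthogonal for the unitary weight, which is the symplectic weight
divided by x (Laguerre) or by x(1-x) (Jacobi). Integration by parts turns A into the matrix of a
skew first order operator D; as Dφ_j involves only the neighbours φ_{j-1} and φ_{j+1}, A is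
tridiagonal. With an additional factor x^k the same computation gives B = SgA + E, where S_{il} is
the integral of φ_i φ_l x^k against the unitary weight, g_l are inverse squared norms and E is
symmetric. Antisymmetrizing removes E and yields X = Sg/2 plus a term of rank one: the index l = 2n
lies outside the matrix, and its contribution is brought back through the last column of the inverse
of A (`rankOne_decomposition`, `linearStatisticAverage_four_eq`).

The trace of Sg/2 is half a unitary moment (`linearStatisticAverage_two`). The rank one term is the
double sum: j runs over the nonzero entries of the last column of the inverse
(`tridiagonalKernel_laguerre`, `tridiagonalKernel_jacobi`), and i comes from expanding the integral
of φ_{2j} φ_{2n} x^k in the polynomials orthogonal for the weight multiplied by x^k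
(`gammaFunctional_mul_laguerrePoly`, `betaFunctional_mul_jacobiPoly`).

Continuation: the Laguerre computation uses only the functional with moments Γ(s + p + 1), which
makes sense where the integrals diverge; at 2b + k = -1 the left-hand side is continuous and the
limit is taken. In the Jacobi case the identity is proved for δ > 0. The symplectic moment and the
double sum are analytic for δ > -2, so solving the identity for the unitary moment defines its
continuation (`exists_transmissionContinuation`). The delay times are a rescaled Laguerre ensemble.
-/

noncomputable section

/-! ### Pfaffians as sums over permutations, and their first variation -/

/-- The sum over permutations which arises when a product of `2 × 2` minors is integrated; for
`A i = A₀` antisymmetric it is a multiple of the Pfaffian of `A₀`. -/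
def pfaffianSum {R : Type*} [CommRing R] {n : ℕ}
    (A : Fin n → Matrix (Fin (n * 2)) (Fin (n * 2)) R) : R :=
  ∑ σ : Equiv.Perm (Fin (n * 2)), ((Equiv.Perm.sign σ : ℤ) : R) *
    ∏ i, A i (σ (finProdFinEquiv (i, 0))) (σ (finProdFinEquiv (i, 1)))

namespace pfaffianSum

variable {R : Type*} [CommRing R] {n : ℕ}

theorem prod_update (A : Fin n → Matrix (Fin (n * 2)) (Fin (n * 2)) R) (i₀ : Fin n)
    (B : Matrix (Fin (n * 2)) (Fin (n * 2)) R) (τ : Fin (n * 2) → Fin (n * 2)) :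
    ∏ i, Function.update A i₀ B i (τ (finProdFinEquiv (i, 0))) (τ (finProdFinEquiv (i, 1))) =
      B (τ (finProdFinEquiv (i₀, 0))) (τ (finProdFinEquiv (i₀, 1))) *
        ∏ i ∈ Finset.univ.erase i₀,
          A i (τ (finProdFinEquiv (i, 0))) (τ (finProdFinEquiv (i, 1))) := by
  rw [← Finset.mul_prod_erase _ _ (Finset.mem_univ i₀), Function.update_self]
  congr 1
  refine Finset.prod_congr rfl fun i hi => ?_
  rw [Function.update_of_ne (Finset.ne_of_mem_erase hi)]

theorem update_add (A : Fin n → Matrix (Fin (n * 2)) (Fin (n * 2)) R) (i₀ : Fin n)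
    (B C : Matrix (Fin (n * 2)) (Fin (n * 2)) R) :
    pfaffianSum (Function.update A i₀ (B + C)) =
      pfaffianSum (Function.update A i₀ B) + pfaffianSum (Function.update A i₀ C) := by
  simp only [pfaffianSum, ← Finset.sum_add_distrib]
  refine Finset.sum_congr rfl fun σ _ => ?_
  have h := fun B => prod_update A i₀ B σ
  simp only [h, Matrix.add_apply]
  ring

/-- Interchanging the two positions of the slot i₀ is an odd permutation that transposes the matrix
in this slot and leaves the others alone. -/
theorem update_transpose (A : Fin n → Matrix (Fin (n * 2)) (Fin (n * 2)) R) (i₀ : Fin n)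
    (B : Matrix (Fin (n * 2)) (Fin (n * 2)) R) :
    pfaffianSum (Function.update A i₀ B.transpose) = -pfaffianSum (Function.update A i₀ B) := by
  have hne : (finProdFinEquiv (i₀, (0 : Fin 2)) : Fin (n * 2)) ≠ finProdFinEquiv (i₀, 1) := by
    simp
  rw [pfaffianSum, pfaffianSum, ← Finset.sum_neg_distrib]
  refine Fintype.sum_equiv (Equiv.mulRight (Equiv.swap (finProdFinEquiv (i₀, (0 : Fin 2)))
    (finProdFinEquiv (i₀, (1 : Fin 2))))) _ _ fun σ => ?_
  rw [prod_update A i₀ _ σ]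
  have h := prod_update A i₀ B (σ * Equiv.swap (finProdFinEquiv (i₀, (0 : Fin 2)))
    (finProdFinEquiv (i₀, (1 : Fin 2))) : Equiv.Perm (Fin (n * 2)))
  rw [Equiv.coe_mulRight, h, Equiv.Perm.sign_mul, Equiv.Perm.sign_swap hne]
  have h2 : ∀ i ∈ Finset.univ.erase i₀, ∀ a : Fin 2,
      (σ * Equiv.swap (finProdFinEquiv (i₀, (0 : Fin 2)))
        (finProdFinEquiv (i₀, (1 : Fin 2))) : Equiv.Perm (Fin (n * 2))) (finProdFinEquiv (i, a)) =
      σ (finProdFinEquiv (i, a)) := by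
    intro i hi a
    have hi' := Finset.ne_of_mem_erase hi
    rw [Equiv.Perm.mul_apply, Equiv.swap_apply_of_ne_of_ne]
    · exact fun h => hi' (Prod.ext_iff.mp (finProdFinEquiv.injective h)).1
    · exact fun h => hi' (Prod.ext_iff.mp (finProdFinEquiv.injective h)).1
  rw [Finset.prod_congr rfl fun i hi => congrArg₂ (A i) (h2 i hi 0) (h2 i hi 1)]
  simp [Matrix.transpose_apply]

/-- Linearity in a slot together with oddness under transposition: only the antisymmetric part of
the matrix in the slot contributes. -/
theorem update_congr [IsDomain R] [CharZero R]
    (A : Fin n → Matrix (Fin (n * 2)) (Fin (n * 2)) R) (i₀ : Fin n)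
    {B C : Matrix (Fin (n * 2)) (Fin (n * 2)) R}
    (h : B - B.transpose = C - C.transpose) :
    pfaffianSum (Function.update A i₀ B) = pfaffianSum (Function.update A i₀ C) := by
  have h1 : B + C.transpose = C + B.transpose := by
    rw [sub_eq_sub_iff_add_eq_add] at h
    exact h
  have h2 := congrArg (fun D => pfaffianSum (Function.update A i₀ D)) h1
  simp only [update_add, update_transpose] at h2
  have h3 : (2 : R) * (pfaffianSum (Function.update A i₀ B) -
    pfaffianSum (Function.update A i₀ C)) = 0 := by linear_combination h2
  rcases mul_eq_zero.mp h3 with h4 | h4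
  · exact absurd h4 two_ne_zero
  · exact sub_eq_zero.mp h4

/-- The derivative at the identity of Pf(gTgᵀ) = det g · Pf T. Each term acts with X on the index at
one position p; rewriting the summation index as the value at a position p' gives a double sum over
positions whose diagonal is the trace term. -/
theorem sum_update_derivation [IsDomain R] [CharZero R]
    (T X : Matrix (Fin (n * 2)) (Fin (n * 2)) R) :
    ∑ i₀, pfaffianSum (Function.update (fun _ : Fin n => T) i₀ (X * T + T * X.transpose)) =
      X.trace * pfaffianSum (fun _ : Fin n => T) := by
  set Q : (Fin (n * 2) → Fin (n * 2)) → R := fun τ =>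
    ∏ i, T (τ (finProdFinEquiv (i, 0))) (τ (finProdFinEquiv (i, 1))) with hQ
  have hQ' : ∀ (τ : Fin (n * 2) → Fin (n * 2)) (i₀ : Fin n), Q τ =
      T (τ (finProdFinEquiv (i₀, 0))) (τ (finProdFinEquiv (i₀, 1))) *
        ∏ i ∈ Finset.univ.erase i₀,
          T (τ (finProdFinEquiv (i, 0))) (τ (finProdFinEquiv (i, 1))) := fun τ i₀ =>
    (Finset.mul_prod_erase _ _ (Finset.mem_univ i₀)).symm
  have hupd : ∀ (τ : Fin (n * 2) → Fin (n * 2)) (i₀ : Fin n) (a : Fin 2) (l : Fin (n * 2)),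
      ∏ i ∈ Finset.univ.erase i₀, T (Function.update τ (finProdFinEquiv (i₀, a)) l
        (finProdFinEquiv (i, 0))) (Function.update τ (finProdFinEquiv (i₀, a)) l
        (finProdFinEquiv (i, 1))) = ∏ i ∈ Finset.univ.erase i₀,
          T (τ (finProdFinEquiv (i, 0))) (τ (finProdFinEquiv (i, 1))) := by
    intro τ i₀ a l
    refine Finset.prod_congr rfl fun i hi => ?_
    have hi' := Finset.ne_of_mem_erase hi
    rw [Function.update_of_ne, Function.update_of_ne]
    · exact fun h => hi' (Prod.ext_iff.mp (finProdFinEquiv.injective h)).1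
    · exact fun h => hi' (Prod.ext_iff.mp (finProdFinEquiv.injective h)).1
  -- The two indices of the n slots are exactly the 2n positions p: X * T acts on the first index of
  -- a slot, T * Xᵀ on the second.
  have key : ∀ σ : Equiv.Perm (Fin (n * 2)), ∑ i₀ : Fin n,
      ∏ i, Function.update (fun _ : Fin n => T) i₀ (X * T + T * X.transpose) i
        (σ (finProdFinEquiv (i, 0))) (σ (finProdFinEquiv (i, 1))) =
      ∑ p, ∑ p', X (σ p) (σ p') * Q (Function.update σ p (σ p')) := by
    intro σ
    rw [← Equiv.sum_comp (finProdFinEquiv (m := n) (n := 2)), Fintype.sum_prod_type]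
    refine Finset.sum_congr rfl fun i₀ _ => ?_
    have hp := prod_update (fun _ : Fin n => T) i₀ (X * T + T * X.transpose) σ
    rw [hp, Fin.sum_univ_two,
      Equiv.sum_comp σ (fun l => X (σ (finProdFinEquiv (i₀, 0))) l *
        Q (Function.update σ (finProdFinEquiv (i₀, 0)) l)),
      Equiv.sum_comp σ (fun l => X (σ (finProdFinEquiv (i₀, 1))) l *
        Q (Function.update σ (finProdFinEquiv (i₀, 1)) l))]
    simp only [hQ' _ i₀, hupd, Matrix.add_apply, Matrix.mul_apply, add_mul, Finset.sum_mul,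
      Matrix.transpose_apply]
    congr 1
    · refine Finset.sum_congr rfl fun l _ => ?_
      rw [Function.update_self, Function.update_of_ne (by simp), mul_assoc]
    · refine Finset.sum_congr rfl fun l _ => ?_
      rw [Function.update_self, Function.update_of_ne (by simp)]
      ring
  set S : Fin (n * 2) → Fin (n * 2) → R := fun p p' => ∑ σ : Equiv.Perm (Fin (n * 2)),
    ((Equiv.Perm.sign σ : ℤ) : R) * (X (σ p) (σ p') * Q (Function.update σ p (σ p'))) with hS
  have hanti : ∀ p p', p ≠ p' → S p p' = -S p' p := by
    intro p p' hpp
    rw [hS]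
    simp only
    rw [← Finset.sum_neg_distrib]
    refine Fintype.sum_equiv (Equiv.mulRight (Equiv.swap p p')) _ _ fun σ => ?_
    -- Both assignments take the value σ p' at p and at p', so the terms for σ and for σ composed
    -- with the transposition differ only by sign.
    have hu : Function.update (⇑(σ * Equiv.swap p p')) p' ((σ * Equiv.swap p p') p) =
        Function.update σ p (σ p') := by
      funext q
      by_cases h1 : q = p'
      · subst h1
        rw [Function.update_self, Function.update_of_ne (Ne.symm hpp)]
        simp
      · rw [Function.update_of_ne h1]
        by_cases h2 : q = p
        · subst h2; simp
        · rw [Function.update_of_ne h2, Equiv.Perm.mul_apply, Equiv.swap_apply_of_ne_of_ne h2 h1]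
    rw [Equiv.coe_mulRight, hu, Equiv.Perm.sign_mul, Equiv.Perm.sign_swap hpp]
    simp
  have hoff : ∑ p, ∑ p' ∈ Finset.univ.erase p, S p p' = 0 := by
    have e1 : ∀ p, ∑ p' ∈ Finset.univ.erase p, S p p' =
        ∑ p', if p' = p then 0 else S p p' := by
      intro p
      rw [← Finset.add_sum_erase _ _ (Finset.mem_univ p), if_pos rfl, zero_add]
      exact Finset.sum_congr rfl fun p' h => by rw [if_neg (Finset.ne_of_mem_erase h)]
    simp only [e1]
    set s := ∑ p, ∑ p', if p' = p then 0 else S p p' with hs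
    have hneg : s = -s := by
      conv_lhs => rw [hs, Finset.sum_comm]
      rw [hs, ← Finset.sum_neg_distrib]
      refine Finset.sum_congr rfl fun p _ => ?_
      rw [← Finset.sum_neg_distrib]
      refine Finset.sum_congr rfl fun p' _ => ?_
      by_cases h : p = p'
      · simp [h]
      · rw [if_neg h, if_neg (Ne.symm h), hanti p' p (Ne.symm h)]
    have h3 : (2 : R) * s = 0 := by linear_combination hneg
    rcases mul_eq_zero.mp h3 with h4 | h4
    · exact absurd h4 two_ne_zero
    · exact h4
  have hdiag : ∑ p, S p p = X.trace * pfaffianSum (fun _ : Fin n => T) := by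
    rw [hS]
    simp only [Function.update_eq_self]
    rw [Finset.sum_comm, pfaffianSum, Finset.mul_sum]
    refine Finset.sum_congr rfl fun σ _ => ?_
    rw [← Finset.mul_sum, ← Finset.sum_mul, Equiv.sum_comp σ (fun l => X l l), Matrix.trace]
    simp only [Matrix.diag_apply]
    ring
  calc _ = ∑ σ : Equiv.Perm (Fin (n * 2)), ((Equiv.Perm.sign σ : ℤ) : R) *
        ∑ p, ∑ p', X (σ p) (σ p') * Q (Function.update σ p (σ p')) := by
        simp only [pfaffianSum]
        rw [Finset.sum_comm]
        refine Finset.sum_congr rfl fun σ _ => ?_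
        rw [← Finset.mul_sum, key]
    _ = ∑ p, ∑ p', S p p' := by
        simp only [hS, Finset.mul_sum]
        rw [Finset.sum_comm]
        refine Finset.sum_congr rfl fun p _ => ?_
        rw [Finset.sum_comm]
    _ = ∑ p, S p p + ∑ p, ∑ p' ∈ Finset.univ.erase p, S p p' := by
        rw [← Finset.sum_add_distrib]
        exact Finset.sum_congr rfl fun p _ =>
          (Finset.add_sum_erase _ _ (Finset.mem_univ p)).symm
    _ = _ := by rw [hoff, hdiag, add_zero]

/-- First variation of the Pfaffian sum along a perturbation whose antisymmetric part is an
infinitesimal congruence. -/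
theorem sum_update_eq_trace_mul [IsDomain R] [CharZero R]
    (T U X : Matrix (Fin (n * 2)) (Fin (n * 2)) R)
    (h : U - U.transpose = X * (T - T.transpose) + (T - T.transpose) * X.transpose) :
    ∑ i₀, pfaffianSum (Function.update (fun _ : Fin n => T) i₀ U) =
      X.trace * pfaffianSum (fun _ : Fin n => T) := by
  rw [← sum_update_derivation]
  refine Finset.sum_congr rfl fun i₀ _ => update_congr _ _ ?_
  rw [h]
  simp only [Matrix.transpose_add, Matrix.transpose_mul, Matrix.transpose_transpose, mul_sub,
    sub_mul]
  abel

end pfaffianSum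

/-! ### Vandermonde determinants with simple and with doubled nodes -/

open Polynomial

/-- The square matrix whose columns are grouped into pairs, the `i`-th pair being `f · i`, `g · i`. -/
def columnPairMatrix {R : Type*} {n : ℕ} (f g : Fin (n * 2) → Fin n → R) :
    Matrix (Fin (n * 2)) (Fin (n * 2)) R :=
  Matrix.of fun q p => if (finProdFinEquiv.symm p).2 = 0 then f q (finProdFinEquiv.symm p).1
    else g q (finProdFinEquiv.symm p).1

namespace columnPairMatrix

variable {R : Type*} {n : ℕ}

theorem apply_zero (f g : Fin (n * 2) → Fin n → R) (q : Fin (n * 2)) (i : Fin n) :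
    columnPairMatrix f g q (finProdFinEquiv (i, 0)) = f q i := by
  simp only [columnPairMatrix, Matrix.of_apply, Equiv.symm_apply_apply, if_true]

theorem apply_one (f g : Fin (n * 2) → Fin n → R) (q : Fin (n * 2)) (i : Fin n) :
    columnPairMatrix f g q (finProdFinEquiv (i, 1)) = g q i := by
  simp only [columnPairMatrix, Matrix.of_apply, Equiv.symm_apply_apply, one_ne_zero, if_false]

theorem ext_columns {A B : Matrix (Fin (n * 2)) (Fin (n * 2)) R}
    (h : ∀ q i (a : Fin 2), A q (finProdFinEquiv (i, a)) = B q (finProdFinEquiv (i, a))) :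
    A = B := by
  ext q p
  obtain ⟨⟨i, a⟩, rfl⟩ := finProdFinEquiv.surjective p
  exact h q i a

variable [CommRing R]

theorem det_eq (f g : Fin (n * 2) → Fin n → R) :
    (columnPairMatrix f g).det = ∑ σ : Equiv.Perm (Fin (n * 2)),
      ((Equiv.Perm.sign σ : ℤ) : R) *
        ∏ i, (f (σ (finProdFinEquiv (i, 0))) i * g (σ (finProdFinEquiv (i, 1))) i) := by
  rw [Matrix.det_apply']
  refine Finset.sum_congr rfl fun σ _ => ?_
  rw [← Equiv.prod_comp (finProdFinEquiv (m := n) (n := 2)), Fintype.prod_prod_type]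
  simp only [Fin.prod_univ_two, apply_zero, apply_one]

theorem map_ringHom {S : Type*} [CommRing S] (φ : R →+* S) (f g : Fin (n * 2) → Fin n → R) :
    φ.mapMatrix (columnPairMatrix f g) =
      columnPairMatrix (fun q i => φ (f q i)) (fun q i => φ (g q i)) := by
  refine ext_columns fun q i a => ?_
  fin_cases a
  · simp only [Fin.zero_eta, apply_zero, RingHom.mapMatrix_apply, Matrix.map_apply]
  · simp only [Fin.mk_one, apply_one, RingHom.mapMatrix_apply, Matrix.map_apply]

theorem left_mul (C : Matrix (Fin (n * 2)) (Fin (n * 2)) R) (f g : Fin (n * 2) → Fin n → R) :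
    C * columnPairMatrix f g =
      columnPairMatrix (fun q i => ∑ l, C q l * f l i) (fun q i => ∑ l, C q l * g l i) := by
  refine ext_columns fun q i a => ?_
  fin_cases a
  · simp only [Fin.zero_eta, apply_zero, Matrix.mul_apply]
  · simp only [Fin.mk_one, apply_one, Matrix.mul_apply]

theorem det_add_mul (f g : Fin (n * 2) → Fin n → R) (c : R) :
    (columnPairMatrix f (fun q i => f q i + g q i * c)).det =
      (columnPairMatrix f g).det * c ^ n := by
  -- This ordering of the column indices is the one used by `Matrix.blockDiagonal`; each pair of
  -- columns undergoes the same 2 × 2 operation, of determinant c.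
  set e : Fin 2 × Fin n ≃ Fin (n * 2) := (Equiv.prodComm _ _).trans finProdFinEquiv
  have he : ∀ a i, e (a, i) = finProdFinEquiv (i, a) := fun _ _ => rfl
  have h : (columnPairMatrix f (fun q i => f q i + g q i * c)).submatrix e e =
      (columnPairMatrix f g).submatrix e e *
        Matrix.blockDiagonal (fun _ : Fin n => !![(1 : R), 1; 0, c]) := by
    ext r ⟨a, i⟩
    simp only [Matrix.mul_apply, Matrix.submatrix_apply, Matrix.blockDiagonal_apply,
      Fintype.sum_prod_type, mul_ite, mul_zero, Finset.sum_ite_eq', Finset.mem_univ, if_true,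
      Fin.sum_univ_two, he, apply_zero, apply_one]
    fin_cases a
    · simp only [Fin.zero_eta, apply_zero]
      simp
    · simp only [Fin.mk_one, apply_one]
      simp
  have hdet := congrArg Matrix.det h
  rw [Matrix.det_submatrix_equiv_self, Matrix.det_mul, Matrix.det_submatrix_equiv_self,
    Matrix.det_blockDiagonal] at hdet
  rw [hdet]
  simp [Matrix.det_fin_two]

/-- The confluent Vandermonde determinant with every node doubled. -/
theorem det_confluent (x : Fin n → R) :
    (columnPairMatrix (fun q i => x i ^ (q : ℕ))
      (fun q i => ((q : ℕ) : R) * x i ^ ((q : ℕ) - 1))).det =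
    ∏ i, ∏ j ∈ Finset.Ioi i, (x j - x i) ^ 4 := by
  set f : Fin (n * 2) → Fin n → R[X] := fun q i => C (x i) ^ (q : ℕ)
  -- The divided difference ((x_i + X)^q - x_i^q) / X, which becomes the derivative of the power at
  -- X = 0.
  set g : Fin (n * 2) → Fin n → R[X] := fun q i =>
    ((q : ℕ) : R[X]) * C (x i) ^ ((q : ℕ) - 1) +
      (Polynomial.powAddExpansion (C (x i)) X (q : ℕ)).1 * X with hg
  -- Each node x_i is split into the two nodes x_i and x_i + X, so that the ordinary Vandermonde
  -- formula over R[X] applies.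
  set v : Fin (n * 2) → R[X] := fun p =>
    if (finProdFinEquiv.symm p).2 = 0 then C (x (finProdFinEquiv.symm p).1)
    else C (x (finProdFinEquiv.symm p).1) + X with hv
  have hv0 : ∀ i, v (finProdFinEquiv (i, 0)) = C (x i) := fun i => by
    simp only [hv, Equiv.symm_apply_apply, if_true]
  have hv1 : ∀ i, v (finProdFinEquiv (i, 1)) = C (x i) + X := fun i => by
    simp only [hv, Equiv.symm_apply_apply, one_ne_zero, if_false]
  have hV : (Matrix.vandermonde v).transpose =
      columnPairMatrix f (fun q i => f q i + g q i * X) := by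
    refine ext_columns fun q i a => ?_
    fin_cases a
    · simp only [Fin.zero_eta, apply_zero, Matrix.transpose_apply, Matrix.vandermonde_apply, hv0]
      rfl
    · simp only [Fin.mk_one, apply_one, Matrix.transpose_apply, Matrix.vandermonde_apply, hv1]
      rw [(Polynomial.powAddExpansion (C (x i)) X (q : ℕ)).2, hg]
      ring
  have hdet := congrArg Matrix.det hV
  rw [det_add_mul, Matrix.det_transpose, Matrix.det_vandermonde] at hdet
  -- The two nodes of one pair differ by X. Two pairs i < j contribute four differences, namely x_j
  -- - x_i twice and x_j - x_i ± X.
  have hprod : ∏ p, ∏ q ∈ Finset.Ioi p, (v q - v p) = X ^ n *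
      ∏ i, ∏ j ∈ Finset.Ioi i, (C (x j - x i) * (C (x j - x i) + X) * ((C (x j - x i) - X) *
        C (x j - x i))) := by
    have h0 : ∀ (m : ℕ) (p : Fin m) (g : Fin m → R[X]),
        ∏ q ∈ Finset.Ioi p, g q = ∏ q, if p < q then g q else 1 := by
      intro m p g
      rw [← Finset.prod_filter]
      congr 1
      ext q
      simp
    simp only [h0]
    rw [← Equiv.prod_comp (finProdFinEquiv (m := n) (n := 2)), Fintype.prod_prod_type]
    have h1 : ∀ i : Fin n, ∏ a : Fin 2, ∏ q, (if finProdFinEquiv (i, a) < q then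
        v q - v (finProdFinEquiv (i, a)) else 1) = X * ∏ j, if i < j then
        (C (x j - x i) * (C (x j - x i) + X) * ((C (x j - x i) - X) * C (x j - x i))) else 1 := by
      intro i
      rw [Fin.prod_univ_two, ← Finset.prod_mul_distrib,
        ← Equiv.prod_comp (finProdFinEquiv (m := n) (n := 2)), Fintype.prod_prod_type,
        ← Finset.mul_prod_erase _ _ (Finset.mem_univ i),
        ← Finset.mul_prod_erase (Finset.univ : Finset (Fin n)) _ (Finset.mem_univ i),
        if_neg (lt_irrefl i), one_mul]
      congr 1
      · simp only [Fin.prod_univ_two, hv0, hv1, Fin.lt_def, finProdFinEquiv_apply_val]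
        simp
      refine Finset.prod_congr rfl fun j hj => ?_
      have hne := Finset.ne_of_mem_erase hj
      simp only [Fin.prod_univ_two, Fin.lt_def, finProdFinEquiv_apply_val, hv0, hv1, Fin.val_zero,
        Fin.val_one]
      rcases lt_or_gt_of_ne (fun h => hne (Fin.ext h) : (j : ℕ) ≠ i) with h | h
      · rw [if_neg (by omega), if_neg (by omega), if_neg (by omega), if_neg (by omega),
          if_neg (by omega)]
        simp
      · rw [if_pos (by omega), if_pos (by omega), if_pos (by omega), if_pos (by omega),
          if_pos (by omega), C_sub]
        ring
    rw [Finset.prod_congr rfl fun i _ => h1 i, Finset.prod_mul_distrib]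
    simp
  -- Both sides carry X^n, which is regular in R[X] for every R; after cancellation the nodes are
  -- merged by evaluating at X = 0.
  rw [hprod, mul_comm _ (X ^ n)] at hdet
  have h2 := congrArg (Polynomial.evalRingHom (0 : R)) ((isRegular_X_pow n).left hdet)
  rw [RingHom.map_det, map_ringHom] at h2
  simp only [map_prod] at h2
  convert h2.symm using 2
  · simp [f, g, columnPairMatrix]
  · refine Finset.prod_congr rfl fun j _ => ?_
    simp
    ring

end columnPairMatrix

/-- Replacing monomials by polynomials of the same degrees is a triangular change of basis. -/
theorem det_coeff_ne_zero {K : Type*} [Field K] (φ : ℕ → K[X]) (hφ : ∀ j, (φ j).natDegree = j)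
    (hφ0 : ∀ j, φ j ≠ 0) (N : ℕ) :
    (Matrix.of fun q l : Fin N => (φ q).coeff l).det ≠ 0 := by
  rw [Matrix.det_of_isLowerTriangular]
  · refine Finset.prod_ne_zero_iff.mpr fun q _ => ?_
    have := leadingCoeff_ne_zero.mpr (hφ0 q)
    rwa [leadingCoeff, hφ] at this
  · intro q l h
    refine coeff_eq_zero_of_natDegree_lt ?_
    rw [hφ]
    exact h

theorem det_polynomial_vandermonde {K : Type*} [Field K] (φ : ℕ → K[X])
    (hφ : ∀ j, (φ j).natDegree = j) {N : ℕ} (x : Fin N → K) :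
    (Matrix.of fun q p : Fin N => (φ q).eval (x p)).det =
      (Matrix.of fun q l : Fin N => (φ q).coeff l).det * ∏ i, ∏ j ∈ Finset.Ioi i, (x j - x i) := by
  rw [← Matrix.det_vandermonde, ← Matrix.det_transpose (Matrix.vandermonde x), ← Matrix.det_mul]
  congr 1
  ext q p
  simp only [Matrix.of_apply, Matrix.mul_apply, Matrix.transpose_apply, Matrix.vandermonde_apply]
  rw [eval_eq_sum_range' (lt_of_eq_of_lt (hφ q) q.2), Finset.sum_range]

theorem det_polynomial_confluent {K : Type*} [Field K] (φ : ℕ → K[X])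
    (hφ : ∀ j, (φ j).natDegree = j) {n : ℕ} (x : Fin n → K) :
    (columnPairMatrix (fun (q : Fin (n * 2)) i => (φ q).eval (x i))
      (fun q i => (derivative (φ q)).eval (x i))).det =
      (Matrix.of fun q l : Fin (n * 2) => (φ q).coeff l).det *
        ∏ i, ∏ j ∈ Finset.Ioi i, (x j - x i) ^ 4 := by
  rw [← columnPairMatrix.det_confluent, ← Matrix.det_mul, columnPairMatrix.left_mul]
  congr 2
  · ext q i
    rw [eval_eq_sum_range' (lt_of_eq_of_lt (hφ q) q.2), Finset.sum_range]
    simp only [Matrix.of_apply]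
  · ext q i
    rw [derivative_eval, sum_over_range' _ _ (n * 2) (lt_of_eq_of_lt (hφ q) q.2),
      Finset.sum_range]
    · simp only [Matrix.of_apply]
      exact Finset.sum_congr rfl fun l _ => by ring
    · simp

/-! ### Ensemble averages as Pfaffians and as sums over orthogonal polynomials -/

section Averages

variable {𝕜 : Type*} [RCLike 𝕜]

/-- `Λ P` is the integral of the polynomial `P` against the density `u` with respect to `μ`. -/
def IsMomentFunctional (μ : Measure ℝ) (u : ℝ → 𝕜) (Λ : 𝕜[X] →ₗ[𝕜] 𝕜) : Prop :=
  ∀ P : 𝕜[X], Integrable (fun x : ℝ => u x * P.eval (x : 𝕜)) μ ∧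
    ∫ x, u x * P.eval (x : 𝕜) ∂μ = Λ P

theorem IsMomentFunctional.of_monomials {μ : Measure ℝ} {u : ℝ → 𝕜} {Λ : 𝕜[X] →ₗ[𝕜] 𝕜}
    (h : ∀ p : ℕ, Integrable (fun x : ℝ => u x * (x : 𝕜) ^ p) μ ∧
      ∫ x, u x * (x : 𝕜) ^ p ∂μ = Λ (X ^ p)) : IsMomentFunctional μ u Λ := by
  intro P
  have h1 : ∀ x : ℝ, u x * P.eval (x : 𝕜) =
      ∑ p ∈ Finset.range (P.natDegree + 1), P.coeff p * (u x * (x : 𝕜) ^ p) := by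
    intro x
    rw [eval_eq_sum_range, Finset.mul_sum]
    exact Finset.sum_congr rfl fun p _ => by ring
  have h2 : Λ P = ∑ p ∈ Finset.range (P.natDegree + 1), P.coeff p * Λ (X ^ p) := by
    conv_lhs => rw [P.as_sum_range_C_mul_X_pow]
    simp only [map_sum, ← smul_eq_C_mul, map_smul, smul_eq_mul]
  simp only [h1]
  refine ⟨integrable_finsetSum _ fun p _ => (h p).1.const_mul _, ?_⟩
  rw [integral_finsetSum _ fun p _ => (h p).1.const_mul _, h2]
  exact Finset.sum_congr rfl fun p _ => by rw [integral_const_mul, (h p).2]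

variable {n : ℕ} {S : Type*} [Fintype S]

theorem integral_sum_prod (μ : Measure ℝ) [SigmaFinite μ] (a : S → 𝕜) (F : S → Fin n → ℝ → 𝕜)
    (hF : ∀ s i, Integrable (F s i) μ) :
    Integrable (fun x : Fin n → ℝ => ∑ s, a s * ∏ i, F s i (x i)) (Measure.pi fun _ => μ) ∧
    ∫ x, ∑ s, a s * ∏ i, F s i (x i) ∂(Measure.pi fun _ => μ) =
      ∑ s, a s * ∏ i, ∫ x, F s i x ∂μ := by
  have h : ∀ s, Integrable (fun x : Fin n → ℝ => a s * ∏ i, F s i (x i))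
      (Measure.pi fun _ => μ) := fun s => (Integrable.fintype_prod (hF s)).const_mul _
  refine ⟨integrable_finsetSum _ fun s _ => h s, ?_⟩
  rw [integral_finsetSum _ fun s _ => h s]
  refine Finset.sum_congr rfl fun s _ => ?_
  rw [integral_const_mul, integral_fintype_prod_eq_prod]

/-- The numerator and denominator of an ensemble average, when the interaction is a sum of
products of polynomials. -/
theorem ensemble_integrals {β : ℕ} {I : Set ℝ} {w : ℝ → ℝ} {f : ℝ → 𝕜} {Λ Λf : 𝕜[X] →ₗ[𝕜] 𝕜}
    (hΛ : IsMomentFunctional (volume.restrict I) (fun x => (w x : 𝕜)) Λ)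
    (hf : IsMomentFunctional (volume.restrict I) (fun x => (w x : 𝕜) * f x) Λf)
    (c : 𝕜) (a : S → 𝕜) (G : S → Fin n → 𝕜[X])
    (hexp : ∀ x : Fin n → ℝ, c * ((∏ i, ∏ j ∈ Finset.Ioi i, |x j - x i| ^ β : ℝ) : 𝕜) =
      ∑ s, a s * ∏ i, (G s i).eval (x i : 𝕜)) :
    Integrable (fun x : Fin n → ℝ => c * ((jointDensity β w x : ℝ) : 𝕜))
      (volume.restrict (Set.univ.pi fun _ => I)) ∧
    c * ((∫ x in Set.univ.pi (fun _ : Fin n => I), jointDensity β w x : ℝ) : 𝕜) =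
      ∑ s, a s * ∏ i, Λ (G s i) ∧
    c * ∫ x in Set.univ.pi (fun _ : Fin n => I), jointDensity β w x • ∑ j, f (x j) =
      ∑ i₀, ∑ s, a s * ∏ i, (Function.update (fun _ : Fin n => Λ) i₀ Λf i) (G s i) := by
  have hvol : (volume : Measure (Fin n → ℝ)).restrict (Set.univ.pi fun _ => I) =
      Measure.pi fun _ => volume.restrict I := by
    rw [volume_pi, Measure.restrict_pi_pi]
  rw [hvol]
  have hdens : ∀ x : Fin n → ℝ, c * ((jointDensity β w x : ℝ) : 𝕜) =
      ∑ s, a s * ∏ i, ((w (x i) : 𝕜) * (G s i).eval (x i : 𝕜)) := by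
    intro x
    rw [jointDensity, RCLike.ofReal_mul, mul_left_comm, hexp, Finset.mul_sum]
    refine Finset.sum_congr rfl fun s _ => ?_
    rw [Finset.prod_mul_distrib, RCLike.ofReal_prod]
    ring
  have h1 := integral_sum_prod (volume.restrict I) a
    (fun s i x => (w x : 𝕜) * (G s i).eval (x : 𝕜)) (fun s i => (hΛ (G s i)).1)
  have hupd : ∀ (i₀ : Fin n) (s : S) (i : Fin n),
      Integrable (fun x => (Function.update (fun _ : Fin n => fun x : ℝ => (w x : 𝕜)) i₀
        (fun x => (w x : 𝕜) * f x) i x) * (G s i).eval (x : 𝕜)) (volume.restrict I) ∧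
      ∫ x in I, (Function.update (fun _ : Fin n => fun x : ℝ => (w x : 𝕜)) i₀
        (fun x => (w x : 𝕜) * f x) i x) * (G s i).eval (x : 𝕜) =
        (Function.update (fun _ : Fin n => Λ) i₀ Λf i) (G s i) := by
    intro i₀ s i
    by_cases hi : i = i₀
    · subst hi
      simp only [Function.update_self]
      exact hf (G s i)
    · simp only [Function.update_of_ne hi]
      exact hΛ (G s i)
  have h2 := fun i₀ : Fin n => integral_sum_prod (volume.restrict I) a
    (fun s i x => (Function.update (fun _ : Fin n => fun x : ℝ => (w x : 𝕜)) i₀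
        (fun x => (w x : 𝕜) * f x) i x) * (G s i).eval (x : 𝕜)) (fun s i => (hupd i₀ s i).1)
  have hnum : ∀ x : Fin n → ℝ, c * (jointDensity β w x • ∑ j, f (x j)) =
      ∑ i₀, ∑ s, a s * ∏ i, ((Function.update (fun _ : Fin n => fun x : ℝ => (w x : 𝕜)) i₀
        (fun x => (w x : 𝕜) * f x) i (x i)) * (G s i).eval (x i : 𝕜)) := by
    intro x
    rw [RCLike.real_smul_eq_coe_mul, ← mul_assoc, hdens, Finset.mul_sum]
    refine Finset.sum_congr rfl fun i₀ _ => ?_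
    rw [Finset.sum_mul]
    refine Finset.sum_congr rfl fun s _ => ?_
    rw [mul_assoc]
    congr 1
    have hw : ∏ i, Function.update (fun _ : Fin n => fun x : ℝ => (w x : 𝕜)) i₀
        (fun x => (w x : 𝕜) * f x) i (x i) = (∏ i, (w (x i) : 𝕜)) * f (x i₀) := by
      rw [← Finset.mul_prod_erase Finset.univ _ (Finset.mem_univ i₀),
        ← Finset.mul_prod_erase Finset.univ (fun i => (w (x i) : 𝕜)) (Finset.mem_univ i₀),
        Function.update_self, mul_right_comm]
      refine congrArg (fun t => (w (x i₀) : 𝕜) * t * f (x i₀)) ?_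
      exact Finset.prod_congr rfl fun i hi => by
        rw [Function.update_of_ne (Finset.ne_of_mem_erase hi)]
    rw [Finset.prod_mul_distrib, Finset.prod_mul_distrib, hw]
    ring
  refine ⟨?_, ?_, ?_⟩
  · simp only [hdens]
    exact h1.1
  · rw [← integral_ofReal, ← integral_const_mul]
    simp only [hdens]
    rw [h1.2]
    refine Finset.sum_congr rfl fun s _ => ?_
    rw [Finset.prod_congr rfl fun i _ => (hΛ (G s i)).2]
  · rw [← integral_const_mul]
    simp only [hnum]
    rw [integral_finsetSum _ fun i₀ _ => (h2 i₀).1]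
    refine Finset.sum_congr rfl fun i₀ _ => ?_
    rw [(h2 i₀).2]
    refine Finset.sum_congr rfl fun s _ => ?_
    rw [Finset.prod_congr rfl fun i _ => (hupd i₀ s i).2]

theorem linearStatisticAverage_eq_div {β : ℕ} {I : Set ℝ} {w : ℝ → ℝ} {f : ℝ → 𝕜} {c Z M : 𝕜}
    (hc : c ≠ 0)
    (hZ : c * ((∫ x in Set.univ.pi (fun _ : Fin n => I), jointDensity β w x : ℝ) : 𝕜) = Z)
    (hM : c * ∫ x in Set.univ.pi (fun _ : Fin n => I), jointDensity β w x • ∑ j, f (x j) = M) :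
    linearStatisticAverage β I w n f = M / Z := by
  rw [linearStatisticAverage, ← hZ, ← hM, RCLike.real_smul_eq_coe_mul, RCLike.ofReal_inv,
    mul_div_mul_left _ _ hc]
  ring

/-- For the quartic interaction the average is a logarithmic derivative of Pfaffian sums. -/
theorem linearStatisticAverage_four {I : Set ℝ} {w : ℝ → ℝ} {f : ℝ → 𝕜} {Λ Λf : 𝕜[X] →ₗ[𝕜] 𝕜}
    (hΛ : IsMomentFunctional (volume.restrict I) (fun x => (w x : 𝕜)) Λ)
    (hf : IsMomentFunctional (volume.restrict I) (fun x => (w x : 𝕜) * f x) Λf)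
    (φ : ℕ → 𝕜[X]) (hφ : ∀ j, (φ j).natDegree = j) (hφ0 : ∀ j, φ j ≠ 0) (n : ℕ) :
    Integrable (fun x : Fin n → ℝ => jointDensity 4 w x)
      (volume.restrict (Set.univ.pi fun _ => I)) ∧
    (∃ c : 𝕜, c ≠ 0 ∧ c * ((∫ x in Set.univ.pi (fun _ : Fin n => I), jointDensity 4 w x : ℝ) : 𝕜) =
      pfaffianSum (fun _ : Fin n => Matrix.of fun p q => Λ (φ p * derivative (φ q)))) ∧
    linearStatisticAverage 4 I w n f =
      (∑ i₀, pfaffianSum (Function.update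
        (fun _ : Fin n => Matrix.of fun p q => Λ (φ p * derivative (φ q))) i₀
        (Matrix.of fun p q => Λf (φ p * derivative (φ q))))) /
      pfaffianSum (fun _ : Fin n => Matrix.of fun p q => Λ (φ p * derivative (φ q))) := by
  have hc := det_coeff_ne_zero φ hφ hφ0 (n * 2)
  set c := (Matrix.of fun q l : Fin (n * 2) => (φ q).coeff l).det with hcdef
  obtain ⟨h1, h2, h3⟩ := ensemble_integrals (n := n) (β := 4) hΛ hf c
    (fun σ : Equiv.Perm (Fin (n * 2)) => ((Equiv.Perm.sign σ : ℤ) : 𝕜))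
    (fun σ i => φ (σ (finProdFinEquiv (i, 0))) * derivative (φ (σ (finProdFinEquiv (i, 1)))))
    (by
      intro x
      simp only [eval_mul]
      rw [← columnPairMatrix.det_eq (fun (q : Fin (n * 2)) i => (φ q).eval ((x i : ℝ) : 𝕜))
        (fun q i => (derivative (φ q)).eval ((x i : ℝ) : 𝕜)), det_polynomial_confluent φ hφ]
      congr 1
      push_cast
      refine Finset.prod_congr rfl fun i _ => Finset.prod_congr rfl fun j _ => ?_
      have : |x j - x i| ^ 4 = (x j - x i) ^ 4 := Even.pow_abs (by decide) _
      rw [← RCLike.ofReal_pow, this]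
      push_cast
      rfl)
  have hint : Integrable (fun x : Fin n → ℝ => jointDensity 4 w x)
      (volume.restrict (Set.univ.pi fun _ => I)) := by
    have h4 := (h1.const_mul c⁻¹).re
    simpa [inv_mul_cancel_left₀ hc] using h4
  refine ⟨hint, ⟨c, hc, h2⟩, ?_⟩
  refine linearStatisticAverage_eq_div hc h2 (h3.trans ?_)
  refine Finset.sum_congr rfl fun i₀ _ => Finset.sum_congr rfl fun σ _ => ?_
  congr 1
  refine Finset.prod_congr rfl fun i _ => ?_
  by_cases hi : i = i₀
  · subst hi; simp
  · simp [Function.update_of_ne hi]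

/-- Placing F in one slot multiplies the product by F / h at the index found there; as the slot
varies, this index takes every value once, whatever the permutation. -/
theorem sum_perm_update {N : ℕ} (h F : Fin N → 𝕜) (hh : ∀ i, h i ≠ 0) :
    ∑ i₀, ∑ σ : Equiv.Perm (Fin N), ∏ i, Function.update (fun i => h (σ i)) i₀ (F (σ i₀)) i =
      (∑ l, F l / h l) * ∑ _σ : Equiv.Perm (Fin N), ∏ i, h i := by
  have h1 : ∀ (σ : Equiv.Perm (Fin N)) i₀,
      ∏ i, Function.update (fun i => h (σ i)) i₀ (F (σ i₀)) i =
        F (σ i₀) / h (σ i₀) * ∏ i, h i := by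
    intro σ i₀
    rw [Finset.prod_update_of_mem (Finset.mem_univ i₀), ← Equiv.prod_comp σ h,
      ← Finset.mul_prod_erase Finset.univ _ (Finset.mem_univ i₀), Finset.sdiff_singleton_eq_erase]
    field_simp [hh (σ i₀)]
  simp only [h1]
  rw [Finset.sum_comm, Finset.mul_sum]
  refine Finset.sum_congr rfl fun σ _ => ?_
  rw [← Finset.sum_mul, Equiv.sum_comp σ (fun l => F l / h l)]

/-- The average over a unitary ensemble in terms of orthogonal polynomials. -/
theorem linearStatisticAverage_two {I : Set ℝ} {w : ℝ → ℝ} {f : ℝ → 𝕜} {Λ Λf : 𝕜[X] →ₗ[𝕜] 𝕜}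
    (hΛ : IsMomentFunctional (volume.restrict I) (fun x => (w x : 𝕜)) Λ)
    (hf : IsMomentFunctional (volume.restrict I) (fun x => (w x : 𝕜) * f x) Λf)
    (φ : ℕ → 𝕜[X]) (hφ : ∀ j, (φ j).natDegree = j) (hφ0 : ∀ j, φ j ≠ 0)
    (horth : ∀ i j, i ≠ j → Λ (φ i * φ j) = 0) (hne : ∀ j, Λ (φ j * φ j) ≠ 0) (N : ℕ) :
    linearStatisticAverage 2 I w N f =
      ∑ l ∈ Finset.range N, Λf (φ l * φ l) / Λ (φ l * φ l) := by
  have hc := det_coeff_ne_zero φ hφ hφ0 N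
  set c := (Matrix.of fun q l : Fin N => (φ q).coeff l).det with hcdef
  obtain ⟨-, h2, h3⟩ := ensemble_integrals (n := N) (β := 2) hΛ hf (c * c)
    (fun s : Equiv.Perm (Fin N) × Equiv.Perm (Fin N) =>
      ((Equiv.Perm.sign s.1 : ℤ) : 𝕜) * ((Equiv.Perm.sign s.2 : ℤ) : 𝕜))
    (fun s i => φ (s.1 i) * φ (s.2 i))
    (by
      intro x
      have e := det_polynomial_vandermonde φ hφ (fun i => ((x i : ℝ) : 𝕜))
      have e2 : ((∏ i, ∏ j ∈ Finset.Ioi i, |x j - x i| ^ 2 : ℝ) : 𝕜) =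
          (∏ i, ∏ j ∈ Finset.Ioi i, (((x j : ℝ) : 𝕜) - ((x i : ℝ) : 𝕜))) *
          (∏ i, ∏ j ∈ Finset.Ioi i, (((x j : ℝ) : 𝕜) - ((x i : ℝ) : 𝕜))) := by
        rw [← Finset.prod_mul_distrib]
        push_cast
        refine Finset.prod_congr rfl fun i _ => ?_
        rw [← Finset.prod_mul_distrib]
        refine Finset.prod_congr rfl fun j _ => ?_
        rw [← RCLike.ofReal_pow, sq_abs]
        push_cast
        ring
      rw [e2, mul_mul_mul_comm, ← e, Matrix.det_apply', Finset.sum_mul_sum,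
        Fintype.sum_prod_type]
      refine Finset.sum_congr rfl fun σ _ => Finset.sum_congr rfl fun τ _ => ?_
      simp only [eval_mul, Finset.prod_mul_distrib, Matrix.of_apply]
      ring)
  have hsq : ∀ σ : Equiv.Perm (Fin N),
      ((Equiv.Perm.sign σ : ℤ) : 𝕜) * ((Equiv.Perm.sign σ : ℤ) : 𝕜) = 1 := by
    intro σ
    rw [← Int.cast_mul, Int.units_coe_mul_self, Int.cast_one]
  have hZ : ∑ s : Equiv.Perm (Fin N) × Equiv.Perm (Fin N),
      ((Equiv.Perm.sign s.1 : ℤ) : 𝕜) * ((Equiv.Perm.sign s.2 : ℤ) : 𝕜) *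
        ∏ i, Λ (φ (s.1 i) * φ (s.2 i)) =
      ∑ _σ : Equiv.Perm (Fin N), ∏ i : Fin N, Λ (φ i * φ i) := by
    rw [Fintype.sum_prod_type]
    refine Finset.sum_congr rfl fun σ _ => ?_
    rw [Finset.sum_eq_single σ]
    · rw [hsq, one_mul, Equiv.prod_comp σ (fun i : Fin N => Λ (φ i * φ i))]
    · intro τ _ hτ
      obtain ⟨i, hi⟩ : ∃ i, σ i ≠ τ i := by
        by_contra hcon
        push Not at hcon
        exact hτ (Equiv.ext fun i => (hcon i).symm)
      rw [Finset.prod_eq_zero (Finset.mem_univ i), mul_zero]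
      exact horth _ _ fun h => hi (Fin.ext h)
    · simp
  have hM : ∑ i₀, ∑ s : Equiv.Perm (Fin N) × Equiv.Perm (Fin N),
      ((Equiv.Perm.sign s.1 : ℤ) : 𝕜) * ((Equiv.Perm.sign s.2 : ℤ) : 𝕜) *
        ∏ i, (Function.update (fun _ : Fin N => Λ) i₀ Λf i) (φ (s.1 i) * φ (s.2 i)) =
      (∑ l : Fin N, Λf (φ l * φ l) / Λ (φ l * φ l)) *
        ∑ _σ : Equiv.Perm (Fin N), ∏ i : Fin N, Λ (φ i * φ i) := by
    rw [← sum_perm_update (fun l : Fin N => Λ (φ l * φ l)) (fun l : Fin N => Λf (φ l * φ l))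
      (fun l => hne l)]
    refine Finset.sum_congr rfl fun i₀ _ => ?_
    rw [Fintype.sum_prod_type]
    refine Finset.sum_congr rfl fun σ _ => ?_
    rw [Finset.sum_eq_single σ]
    · rw [hsq, one_mul]
      refine Finset.prod_congr rfl fun i _ => ?_
      by_cases hi : i = i₀
      · subst hi; simp
      · simp [Function.update_of_ne hi]
    · intro τ _ hτ
      -- Orthogonality is lost in the slot i₀, but two permutations that agree off one point agree
      -- everywhere, so only τ = σ survives here as well.
      obtain ⟨i, hi, hi0⟩ : ∃ i, σ i ≠ τ i ∧ i ≠ i₀ := by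
        by_contra hcon
        push Not at hcon
        have h5 : ∀ i, i ≠ i₀ → σ i = τ i := fun i hi => by
          by_contra h6; exact hi (hcon i h6)
        refine hτ (Equiv.ext fun i => ?_)
        by_cases hi : i = i₀
        · subst hi
          obtain ⟨j, hj⟩ := σ.surjective (τ i)
          by_cases hji : j = i
          · rw [← hj, hji]
          · rw [h5 j hji] at hj
            exact absurd (τ.injective hj) hji
        · exact (h5 i hi).symm
      rw [Finset.prod_eq_zero (Finset.mem_univ i), mul_zero]
      rw [Function.update_of_ne hi0]
      exact horth _ _ fun h => hi (Fin.ext h)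
    · simp
  rw [linearStatisticAverage_eq_div (mul_ne_zero hc hc) (h2.trans hZ) (h3.trans hM),
    mul_div_cancel_right₀, Finset.sum_range]
  rw [Finset.sum_const, nsmul_eq_mul]
  refine mul_ne_zero ?_ (Finset.prod_ne_zero_iff.mpr fun i _ => hne i)
  rw [Finset.card_univ, Fintype.card_perm]
  exact Nat.cast_ne_zero.mpr (Nat.factorial_ne_zero _)

/-- The density is nonnegative, and it is nonzero on the nonempty open set of points with distinct
coordinates in the interval. -/
theorem integral_jointDensity_pos {β : ℕ} {I : Set ℝ} (hI : MeasurableSet I) {w : ℝ → ℝ}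
    (hw : ∀ x ∈ I, 0 ≤ w x) {a b : ℝ} (hab : a < b) (hsub : Set.Ioo a b ⊆ I)
    (hpos : ∀ x ∈ Set.Ioo a b, 0 < w x) {n : ℕ}
    (hint : Integrable (fun x : Fin n → ℝ => jointDensity β w x)
      (volume.restrict (Set.univ.pi fun _ => I))) :
    0 < ∫ x in Set.univ.pi (fun _ : Fin n => I), jointDensity β w x := by
  have hmeas : MeasurableSet (Set.univ.pi (fun _ : Fin n => I)) :=
    MeasurableSet.univ_pi fun _ => hI
  rw [setIntegral_pos_iff_support_of_nonneg_ae _ hint]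
  · set O : Set (Fin n → ℝ) := {x | (∀ i, x i ∈ Set.Ioo a b) ∧ ∀ i j, i ≠ j → x i ≠ x j}
    have hO : IsOpen O := by
      have : O = (⋂ i, (fun x : Fin n → ℝ => x i) ⁻¹' Set.Ioo a b) ∩
          ⋂ i, ⋂ j, ⋂ (_ : i ≠ j), {x : Fin n → ℝ | x i ≠ x j} := by
        ext x
        simp [O]
      rw [this]
      refine IsOpen.inter (isOpen_iInter_of_finite fun i =>
        isOpen_Ioo.preimage (continuous_apply i)) ?_
      refine isOpen_iInter_of_finite fun i => isOpen_iInter_of_finite fun j =>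
        isOpen_iInter_of_finite fun _ => ?_
      exact isOpen_ne_fun (continuous_apply i) (continuous_apply j)
    have hne : O.Nonempty := by
      -- Equally spaced points of the interval are pairwise distinct.
      refine ⟨fun i => a + (b - a) * (((i : ℕ) + 1 : ℝ) / (n + 1)), fun i => ⟨?_, ?_⟩, ?_⟩
      · have : 0 < (b - a) * (((i : ℕ) + 1 : ℝ) / (n + 1)) := by
          have := sub_pos.mpr hab
          positivity
        linarith
      · have h1 : ((i : ℕ) + 1 : ℝ) / (n + 1) < 1 := by
          rw [div_lt_one (by positivity)]
          have : ((i : ℕ) : ℝ) < n := by exact_mod_cast i.2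
          linarith
        have := mul_lt_mul_of_pos_left h1 (sub_pos.mpr hab)
        linarith
      · intro i j hij h
        have h0 : (b - a) ≠ 0 := (sub_pos.mpr hab).ne'
        have h1 : (n + 1 : ℝ) ≠ 0 := by positivity
        have h2 := mul_left_cancel₀ h0 (add_left_cancel h)
        rw [div_left_inj' h1] at h2
        exact hij (Fin.ext (by exact_mod_cast add_right_cancel h2))
    refine (hO.measure_pos volume hne).trans_le (measure_mono ?_)
    rintro x ⟨hx, hx2⟩
    refine ⟨?_, fun i _ => hsub (hx i)⟩
    rw [Function.mem_support, jointDensity]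
    refine mul_ne_zero (Finset.prod_ne_zero_iff.mpr fun j _ => (hpos _ (hx j)).ne') ?_
    refine Finset.prod_ne_zero_iff.mpr fun i _ => Finset.prod_ne_zero_iff.mpr fun j hj => ?_
    exact pow_ne_zero _ (abs_ne_zero.mpr (sub_ne_zero.mpr (hx2 j i (Finset.mem_Ioi.mp hj).ne')))
  · filter_upwards [ae_restrict_mem hmeas] with x hx
    exact mul_nonneg (Finset.prod_nonneg fun j _ => hw _ (hx j trivial))
      (Finset.prod_nonneg fun i _ => Finset.prod_nonneg fun j _ => by positivity)

end Averages

/-! ### Tridiagonal antisymmetric systems and the rank one correction -/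

section RankOneCorrection

variable {K : Type*} [Field K]

theorem sum_range_mul_two (f : ℕ → K) (n : ℕ) :
    ∑ l ∈ Finset.range (n * 2), f l = ∑ j ∈ Finset.range n, (f (2 * j) + f (2 * j + 1)) := by
  induction n with
  | zero => simp
  | succ n ih =>
    rw [Finset.sum_range_succ, ← ih, show (n + 1) * 2 = n * 2 + 1 + 1 by ring,
      Finset.sum_range_succ, Finset.sum_range_succ, mul_comm 2 n, add_assoc]

/-- The even entries of the last column of the inverse of the antisymmetric tridiagonal
`2n × 2n` matrix with entries `t j` above the diagonal, up to sign. -/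
def tridiagonalKernel (t : ℕ → K) (n j : ℕ) : K :=
  (∏ m ∈ Finset.Ico j (n - 1), t (2 * m + 1)) / ∏ m ∈ Finset.Ico j n, t (2 * m)

theorem tridiagonalKernel_last {t : ℕ → K} {n : ℕ} (hn : 1 ≤ n) :
    tridiagonalKernel t n (n - 1) = (t (2 * (n - 1)))⁻¹ := by
  obtain ⟨m, rfl⟩ : ∃ m, n = m + 1 := ⟨n - 1, by omega⟩
  simp [tridiagonalKernel]

theorem tridiagonalKernel_step {t : ℕ → K} {n j : ℕ} (hj : j + 1 < n) :
    tridiagonalKernel t n j =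
      t (2 * j + 1) / t (2 * j) * tridiagonalKernel t n (j + 1) := by
  rw [tridiagonalKernel, tridiagonalKernel, Finset.prod_eq_prod_Ico_succ_bot (by omega),
    Finset.prod_eq_prod_Ico_succ_bot (by omega : j < n)]
  ring

/-- The vector carried by the even indices which solves the tridiagonal system. -/
def tridiagonalSolution (t : ℕ → K) (n l : ℕ) : K :=
  if Even l then tridiagonalKernel t n (l / 2) else 0

theorem tridiagonalSolution_even (t : ℕ → K) (n j : ℕ) :
    tridiagonalSolution t n (2 * j) = tridiagonalKernel t n j := by
  simp [tridiagonalSolution]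

theorem tridiagonalSolution_odd (t : ℕ → K) (n j : ℕ) :
    tridiagonalSolution t n (2 * j + 1) = 0 := by
  simp [tridiagonalSolution]

/-- Even rows meet only odd columns, where the vector vanishes. The row 2j + 1 meets the columns 2j
and 2j + 2, whose contributions cancel by the recurrence of `tridiagonalKernel`; in the last row the
second of them is absent, which leaves -1. -/
theorem sum_mul_tridiagonalSolution (A : ℕ → ℕ → K) (hA : ∀ i j, A i j = -A j i)
    (htri : ∀ i j, i + 1 < j → A i j = 0) (hdiag : ∀ i, A i i = 0)
    (ht : ∀ j, A j (j + 1) ≠ 0) {n i : ℕ} (hi : i < n * 2) :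
    ∑ l ∈ Finset.range (n * 2), A i l * tridiagonalSolution (fun j => A j (j + 1)) n l =
      if i = n * 2 - 1 then -1 else 0 := by
  have htri' : ∀ i j, j + 1 < i → A i j = 0 := fun i j h => by rw [hA, htri j i h, neg_zero]
  simp only [sum_range_mul_two, tridiagonalSolution_even, tridiagonalSolution_odd, mul_zero,
    add_zero]
  rcases Nat.even_or_odd' i with ⟨j, rfl | rfl⟩
  · rw [if_neg (by omega)]
    refine Finset.sum_eq_zero fun m _ => ?_
    rcases lt_trichotomy m j with h | h | h
    · rw [htri' _ _ (by omega), zero_mul]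
    · rw [h, hdiag, zero_mul]
    · rw [htri _ _ (by omega), zero_mul]
  · have hz : ∀ m, m ≠ j → m ≠ j + 1 → A (2 * j + 1) (2 * m) = 0 := by
      intro m h1 h2
      rcases lt_or_gt_of_ne h1 with h | h
      · exact htri' _ _ (by omega)
      · exact htri _ _ (by omega)
    by_cases hj : j + 1 < n
    · rw [if_neg (by omega), Finset.sum_eq_add_of_mem j (j + 1) (Finset.mem_range.mpr (by omega))
        (Finset.mem_range.mpr hj) (by omega) (fun m _ h => by rw [hz m h.1 h.2, zero_mul]),
        tridiagonalKernel_step hj, hA (2 * j + 1) (2 * j), mul_add]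
      have := ht (2 * j)
      field_simp
      ring_nf
    · obtain rfl : j = n - 1 := by omega
      rw [if_pos (by omega), Finset.sum_eq_single_of_mem (n - 1) (Finset.mem_range.mpr (by omega))
        (fun m hm h => by
          rw [hz m h (by have := Finset.mem_range.mp hm; omega), zero_mul]),
        tridiagonalKernel_last (by omega), hA]
      have := ht (2 * (n - 1))
      field_simp

/-- Antisymmetrization removes E: 2B = SgA - (SgA)ᵀ. In SgA the row l = N of A lies outside the
block, and tridiagonality leaves it the single entry A_{N,N-1} in column N - 1. As Az = -e_{N-1} and
A is antisymmetric, zᵀA is the unit row vector at N - 1, so this extra contribution is also a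
multiple of A and XA = SgA/2. -/
theorem rankOne_decomposition [CharZero K] (A S E B : ℕ → ℕ → K) (g z : ℕ → K) {N : ℕ}
    (hA : ∀ i j, A i j = -A j i) (htri : ∀ i j, i + 1 < j → A i j = 0)
    (hE : ∀ i j, E i j = E j i) (hB : ∀ i j, B i j = -B j i)
    (hBA : ∀ i j, i < N → j < N →
      B i j = ∑ l ∈ Finset.range (N + 1), S i l * g l * A l j + E i j)
    (hz : ∀ i, i < N → ∑ l ∈ Finset.range N, A i l * z l = if i = N - 1 then -1 else 0)
    (X : Matrix (Fin N) (Fin N) K)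
    (hX : X = Matrix.of fun i l : Fin N =>
      S i l * g l / 2 + g N * A N (N - 1) / 2 * S i N * z l) :
    (Matrix.of fun i j : Fin N => B i j) =
      X * (Matrix.of fun i j : Fin N => A i j) + (Matrix.of fun i j : Fin N => A i j) *
        X.transpose := by
  have hN : ∀ j, j < N → A N j = if j = N - 1 then A N (N - 1) else 0 := by
    intro j hj
    split_ifs with h
    · rw [h]
    · rw [hA, htri j N (by omega), neg_zero]
  have hXA : ∀ i j : Fin N, (X * (Matrix.of fun i j : Fin N => A i j)) i j =
      (∑ l ∈ Finset.range (N + 1), S i l * g l * A l j) / 2 := by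
    intro i j
    have h1 := hz j j.2
    rw [Finset.sum_range_succ, hN j j.2, Finset.sum_range]
    rw [Finset.sum_range] at h1
    have h2 : ∑ l : Fin N, z l * A l j = if (j : ℕ) = N - 1 then 1 else 0 := by
      have : ∑ l : Fin N, z l * A l j = -∑ l : Fin N, A j l * z l := by
        rw [← Finset.sum_neg_distrib]
        exact Finset.sum_congr rfl fun l _ => by rw [hA l j]; ring
      rw [this, h1]
      split_ifs <;> simp
    rw [Matrix.mul_apply, hX]
    simp only [Matrix.of_apply, add_mul, Finset.sum_add_distrib, mul_assoc _ (z _) (A _ _),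
      ← Finset.mul_sum, h2]
    rw [add_div, Finset.sum_div]
    congr 1
    · exact Finset.sum_congr rfl fun l _ => by ring
    · split_ifs <;> ring
  ext i j
  have hT : ((Matrix.of fun i j : Fin N => A i j) * X.transpose) i j =
      -(X * (Matrix.of fun i j : Fin N => A i j)) j i := by
    rw [Matrix.mul_apply, Matrix.mul_apply, ← Finset.sum_neg_distrib]
    refine Finset.sum_congr rfl fun l _ => ?_
    simp only [Matrix.of_apply, Matrix.transpose_apply]
    rw [hA i l]
    ring
  rw [Matrix.add_apply, hT, hXA, hXA, Matrix.of_apply]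
  have h1 := hBA i j i.2 j.2
  have h2 := hBA j i j.2 i.2
  have h3 := hB i j
  have h4 := hE i j
  have h5 : (2 : K) * B i j = ∑ l ∈ Finset.range (N + 1), S i l * g l * A l j -
      ∑ l ∈ Finset.range (N + 1), S j l * g l * A l i := by
    linear_combination h1 - h2 + h3 + h4
  field_simp
  linear_combination h5

end RankOneCorrection

/-! ### Symplectic averages as half a unitary trace plus a rank one term -/

section Symplectic

variable {𝕜 : Type*} [RCLike 𝕜]

/-- The Wronskian pairing attached to a linear functional. -/
def wronskianPairing {K : Type*} [Field K] (Λ : K[X] →ₗ[K] K) (P Q : K[X]) : K :=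
  Λ (P * derivative Q - derivative P * Q)

theorem wronskianPairing_antisymm {K : Type*} [Field K] (Λ : K[X] →ₗ[K] K) (P Q : K[X]) :
    wronskianPairing Λ P Q = -wronskianPairing Λ Q P := by
  rw [wronskianPairing, wronskianPairing, ← map_neg]
  congr 1
  ring

/-- The average over a symplectic ensemble as half a unitary trace plus a rank one correction. -/
theorem linearStatisticAverage_four_eq {I : Set ℝ} {w : ℝ → ℝ} {f : ℝ → 𝕜}
    {Λ Λf : 𝕜[X] →ₗ[𝕜] 𝕜}
    (hΛ : IsMomentFunctional (volume.restrict I) (fun x => (w x : 𝕜)) Λ)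
    (hf : IsMomentFunctional (volume.restrict I) (fun x => (w x : 𝕜) * f x) Λf)
    (φ : ℕ → 𝕜[X]) (hφ : ∀ j, (φ j).natDegree = j) (hφ0 : ∀ j, φ j ≠ 0) {n : ℕ}
    (hZ : ∫ x in Set.univ.pi (fun _ : Fin n => I), jointDensity 4 w x ≠ 0)
    (S E : ℕ → ℕ → 𝕜) (g : ℕ → 𝕜)
    (htri : ∀ i j, i + 1 < j → wronskianPairing Λ (φ i) (φ j) = 0)
    (ht : ∀ j, wronskianPairing Λ (φ j) (φ (j + 1)) ≠ 0)
    (hE : ∀ i j, E i j = E j i)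
    (hBA : ∀ i j, i < n * 2 → j < n * 2 → wronskianPairing Λf (φ i) (φ j) =
      ∑ l ∈ Finset.range (n * 2 + 1), S i l * g l * wronskianPairing Λ (φ l) (φ j) + E i j) :
    linearStatisticAverage 4 I w n f = (∑ l ∈ Finset.range (n * 2), S l l * g l) / 2 +
      g (n * 2) * wronskianPairing Λ (φ (n * 2)) (φ (n * 2 - 1)) / 2 *
        ∑ j ∈ Finset.range n,
          tridiagonalKernel (fun j => wronskianPairing Λ (φ j) (φ (j + 1))) n j *
            S (2 * j) (n * 2) := by
  obtain ⟨-, ⟨c, hc, hcZ⟩, havg⟩ := linearStatisticAverage_four hΛ hf φ hφ hφ0 n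
  set A : ℕ → ℕ → 𝕜 := fun i j => wronskianPairing Λ (φ i) (φ j) with hAdef
  have hA : ∀ i j, A i j = -A j i := fun i j => wronskianPairing_antisymm _ _ _
  have hdiag : ∀ i, A i i = 0 := fun i => by
    simp only [hAdef, wronskianPairing, mul_comm (φ i), sub_self, map_zero]
  set z := tridiagonalSolution (fun j => A j (j + 1)) n with hzdef
  set X : Matrix (Fin (n * 2)) (Fin (n * 2)) 𝕜 := Matrix.of fun i l : Fin (n * 2) =>
      S i l * g l / 2 + g (n * 2) * A (n * 2) (n * 2 - 1) / 2 * S i (n * 2) * z l with hX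
  have hdec := rankOne_decomposition A S E (fun i j => wronskianPairing Λf (φ i) (φ j)) g z
    hA htri hE (fun i j => wronskianPairing_antisymm _ _ _) hBA
    (fun i hi => sum_mul_tridiagonalSolution A hA htri hdiag ht hi) X hX
  have hskew : ∀ Λ' : 𝕜[X] →ₗ[𝕜] 𝕜,
      (Matrix.of fun p q : Fin (n * 2) => Λ' (φ p * derivative (φ q))) -
      (Matrix.of fun p q : Fin (n * 2) => Λ' (φ p * derivative (φ q))).transpose =
      Matrix.of fun p q : Fin (n * 2) => wronskianPairing Λ' (φ p) (φ q) := by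
    intro Λ'
    ext p q
    simp only [Matrix.sub_apply, Matrix.of_apply, Matrix.transpose_apply, wronskianPairing,
      map_sub, mul_comm (φ q)]
  have htr := pfaffianSum.sum_update_eq_trace_mul
    (Matrix.of fun p q : Fin (n * 2) => Λ (φ p * derivative (φ q)))
    (Matrix.of fun p q : Fin (n * 2) => Λf (φ p * derivative (φ q))) X
    (by rw [hskew, hskew]; exact hdec)
  have hne : pfaffianSum (fun _ : Fin n => Matrix.of fun p q : Fin (n * 2) =>
      Λ (φ p * derivative (φ q))) ≠ 0 := by
    rw [← hcZ]
    exact mul_ne_zero hc (RCLike.ofReal_ne_zero.mpr hZ)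
  rw [havg, htr, mul_div_cancel_right₀ _ hne, hX, Matrix.trace]
  simp only [Matrix.diag_apply, Matrix.of_apply, Finset.sum_add_distrib]
  congr 1
  · rw [Finset.sum_div, Finset.sum_range]
  · rw [← Finset.sum_range (fun l => g (n * 2) * A (n * 2) (n * 2 - 1) / 2 * S l (n * 2) * z l),
      sum_range_mul_two, Finset.mul_sum]
    refine Finset.sum_congr rfl fun j _ => ?_
    rw [hzdef, tridiagonalSolution_even, tridiagonalSolution_odd]
    ring

end Symplectic

/-! ### Expansion in orthogonal polynomials -/

section OrthogonalExpansion

variable {K : Type*} [Field K]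

/-- Expansion in a family of orthogonal polynomials. -/
theorem orthogonal_expansion (Λ : K[X] →ₗ[K] K) (π : ℕ → K[X]) (hπ : ∀ j, (π j).natDegree = j)
    (hπ0 : ∀ j, π j ≠ 0) (horth : ∀ i j, i ≠ j → Λ (π i * π j) = 0)
    (hne : ∀ j, Λ (π j * π j) ≠ 0) (P : K[X]) (d : ℕ) (hP : P.natDegree < d) :
    P = ∑ m ∈ Finset.range d, C (Λ (P * π m) / Λ (π m * π m)) * π m := by
  -- Triangularity: a multiple of π d removes the coefficient of X^d, and the rest follows by
  -- induction on the degree bound.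
  have hspan : ∀ (d : ℕ) (P : K[X]), P.degree < (d : WithBot ℕ) → ∃ c : ℕ → K,
      P = ∑ m ∈ Finset.range d, C (c m) * π m := by
    intro d
    induction d with
    | zero =>
      intro P hP
      refine ⟨0, ?_⟩
      simpa using hP
    | succ d ih =>
      intro P hP
      have hlc : (π d).coeff d ≠ 0 := by
        have := leadingCoeff_ne_zero.mpr (hπ0 d)
        rwa [leadingCoeff, hπ] at this
      have hP' : ∀ i, d < i → P.coeff i = 0 := fun i hi =>
        coeff_eq_zero_of_degree_lt (hP.trans_le (by exact_mod_cast hi))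
      have hπ' : ∀ i, d < i → (π d).coeff i = 0 := fun i hi =>
        coeff_eq_zero_of_natDegree_lt (by rwa [hπ])
      obtain ⟨c, hc⟩ := ih (P - C (P.coeff d / (π d).coeff d) * π d) (by
        rw [degree_lt_iff_coeff_zero]
        intro i hi
        rw [coeff_sub, coeff_C_mul]
        rcases Nat.eq_or_lt_of_le hi with h | h
        · rw [← h]; field_simp; ring
        · rw [hP' i h, hπ' i h]; ring)
      refine ⟨Function.update c d (P.coeff d / (π d).coeff d), ?_⟩
      rw [Finset.sum_range_succ, Function.update_self, Finset.sum_congr rfl fun m hm => by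
        rw [Function.update_of_ne (Finset.mem_range.mp hm).ne], ← hc]
      ring
  obtain ⟨c, hc⟩ := hspan d P (by
    by_cases h0 : P = 0
    · rw [h0, degree_zero]; exact WithBot.bot_lt_coe d
    · rw [degree_eq_natDegree h0]; exact_mod_cast hP)
  conv_lhs => rw [hc]
  refine Finset.sum_congr rfl fun m hm => ?_
  congr 2
  rw [eq_div_iff (hne m)]
  conv_rhs => rw [hc, Finset.sum_mul, map_sum]
  rw [Finset.sum_eq_single_of_mem m hm, mul_assoc, ← smul_eq_C_mul, map_smul, smul_eq_mul]
  intro l _ hl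
  rw [mul_assoc, ← smul_eq_C_mul, map_smul, horth l m hl, smul_zero]

theorem orthogonal_parseval (Λ : K[X] →ₗ[K] K) (π : ℕ → K[X]) (hπ : ∀ j, (π j).natDegree = j)
    (hπ0 : ∀ j, π j ≠ 0) (horth : ∀ i j, i ≠ j → Λ (π i * π j) = 0)
    (hne : ∀ j, Λ (π j * π j) ≠ 0) (P Q : K[X]) (d : ℕ) (hP : P.natDegree < d) :
    Λ (P * Q) = ∑ m ∈ Finset.range d, Λ (P * π m) * Λ (Q * π m) / Λ (π m * π m) := by
  conv_lhs => rw [orthogonal_expansion Λ π hπ hπ0 horth hne P d hP]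
  rw [Finset.sum_mul, map_sum]
  refine Finset.sum_congr rfl fun m _ => ?_
  rw [mul_assoc, ← smul_eq_C_mul, map_smul, smul_eq_mul, mul_comm (π m) Q]
  ring

end OrthogonalExpansion

/-! ### Linear functionals given by their moments -/

section MomentFunctional

variable {K : Type*} [Field K]

/-- The linear functional on polynomials with prescribed moments. -/
def momentFunctional (c : ℕ → K) : K[X] →ₗ[K] K :=
  Polynomial.lsum fun p => c p • LinearMap.id

@[simp]
theorem momentFunctional_X_pow (c : ℕ → K) (p : ℕ) : momentFunctional c (X ^ p) = c p := by
  simp [momentFunctional, Polynomial.lsum_apply, X_pow_eq_monomial]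

theorem linearMap_ext_X_pow {Λ Λ' : K[X] →ₗ[K] K} (h : ∀ p, Λ (X ^ p) = Λ' (X ^ p)) :
    Λ = Λ' := by
  refine Polynomial.lhom_ext' fun p => LinearMap.ext_ring ?_
  have := h p
  rwa [X_pow_eq_monomial] at this

end MomentFunctional

/-! ### Laguerre polynomials of complex parameter -/

section Laguerre

/-- The functional with moments `Γ(s + p + 1)`, continuing integration against `x ^ s * e ^ (-x)`. -/
def gammaFunctional (s : ℂ) : ℂ[X] →ₗ[ℂ] ℂ :=
  momentFunctional fun p => Complex.Gamma (s + p + 1)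

theorem gammaFunctional_X_mul (s : ℂ) (P : ℂ[X]) :
    gammaFunctional s (X * P) = gammaFunctional (s + 1) P := by
  have : (gammaFunctional s).comp (LinearMap.mulLeft ℂ X) = gammaFunctional (s + 1) := by
    refine linearMap_ext_X_pow fun p => ?_
    rw [LinearMap.comp_apply, LinearMap.mulLeft_apply, ← pow_succ']
    simp only [gammaFunctional, momentFunctional_X_pow]
    congr 1
    push_cast
    ring
  exact LinearMap.congr_fun this P

theorem gammaFunctional_one (s : ℂ) : gammaFunctional s 1 = Complex.Gamma (s + 1) := by
  have := momentFunctional_X_pow (fun p : ℕ => Complex.Gamma (s + p + 1)) 0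
  simpa [gammaFunctional] using this

/-- The raising operator of Laguerre polynomials. -/
def laguerreRaise (s : ℂ) (P : ℂ[X]) : ℂ[X] := X * derivative P + (C (s + 1) - X) * P

/-- `laguerreRaise s P` is x^{-s} e^x times the derivative of x^{s+1} e^{-x} P, hence integrates to
zero. On moments this is Γ(z + 1) = zΓ(z), which asks for nonvanishing arguments but not for
convergence. -/
theorem gammaFunctional_raise {s : ℂ} (hs : ∀ m : ℕ, s + m + 1 ≠ 0) (P : ℂ[X]) :
    gammaFunctional s (laguerreRaise s P) = 0 := by
  set R : ℂ[X] →ₗ[ℂ] ℂ[X] := (LinearMap.mulLeft ℂ X).comp derivative +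
    LinearMap.mulLeft ℂ (C (s + 1) - X) with hR
  have : (gammaFunctional s).comp R = 0 := by
    refine linearMap_ext_X_pow fun p => ?_
    have e : R (X ^ p) = ((p : ℂ) + s + 1) • X ^ p - X ^ (p + 1) := by
      simp only [hR, LinearMap.add_apply, LinearMap.comp_apply, LinearMap.mulLeft_apply,
        derivative_X_pow, smul_eq_C_mul]
      rcases p with _ | p
      · simp
      · simp only [Nat.add_sub_cancel, map_add, C_1, map_natCast]
        ring
    rw [LinearMap.comp_apply, e, map_sub, map_smul]
    simp only [gammaFunctional, momentFunctional_X_pow, smul_eq_mul, LinearMap.zero_apply]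
    have h2 : s + ((p + 1 : ℕ) : ℂ) + 1 = (s + p + 1) + 1 := by push_cast; ring
    rw [h2, Complex.Gamma_add_one _ (hs p)]
    ring
  exact LinearMap.congr_fun this P

/-- The Laguerre polynomials `L_n^{(s)}`. -/
def laguerrePoly : ℕ → ℂ → ℂ[X]
  | 0, _ => 1
  | n + 1, s => C ((n + 1 : ℂ)⁻¹) * laguerreRaise s (laguerrePoly n (s + 1))

theorem C_mul_laguerrePoly_succ (n : ℕ) (s : ℂ) :
    C (n + 1 : ℂ) * laguerrePoly (n + 1) s = laguerreRaise s (laguerrePoly n (s + 1)) := by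
  rw [laguerrePoly, ← mul_assoc, ← C_mul, mul_inv_cancel₀ (Nat.cast_add_one_ne_zero n), C_1,
    one_mul]

theorem C_natCast_succ_ne_zero (n : ℕ) : (C (n + 1 : ℂ) : ℂ[X]) ≠ 0 :=
  C_ne_zero.mpr (Nat.cast_add_one_ne_zero n)

theorem derivative_laguerreRaise (s : ℂ) (P : ℂ[X]) :
    derivative (laguerreRaise s P) = laguerreRaise (s + 1) (derivative P) - P := by
  simp only [laguerreRaise, derivative_mul, derivative_sub, derivative_X, derivative_C,
    derivative_one, map_add, C_1]
  ring

theorem laguerreRaise_C_mul (s a : ℂ) (P : ℂ[X]) :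
    laguerreRaise s (C a * P) = C a * laguerreRaise s P := by
  simp only [laguerreRaise, derivative_C_mul]
  ring

theorem laguerreRaise_neg (s : ℂ) (P : ℂ[X]) :
    laguerreRaise s (-P) = -laguerreRaise s P := by
  simp only [laguerreRaise, derivative_neg]
  ring

theorem laguerreRaise_sub (s : ℂ) (P Q : ℂ[X]) :
    laguerreRaise s (P - Q) = laguerreRaise s P - laguerreRaise s Q := by
  simp only [laguerreRaise, derivative_sub]
  ring

theorem laguerreRaise_add_param (s t : ℂ) (P : ℂ[X]) :
    laguerreRaise (s + t) P = laguerreRaise s P + C t * P := by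
  simp only [laguerreRaise, map_add]
  ring

theorem derivative_laguerrePoly (n : ℕ) (s : ℂ) :
    derivative (laguerrePoly (n + 1) s) = -laguerrePoly n (s + 1) := by
  induction n generalizing s with
  | zero =>
    simp [laguerrePoly, laguerreRaise]
  | succ n ih =>
    refine mul_left_cancel₀ (C_natCast_succ_ne_zero (n + 1)) ?_
    rw [← derivative_C_mul, C_mul_laguerrePoly_succ, derivative_laguerreRaise, ih,
      laguerreRaise_neg, ← C_mul_laguerrePoly_succ]
    push_cast
    simp only [map_add, C_1]
    ring

theorem iterate_derivative_laguerrePoly (m n : ℕ) (s : ℂ) :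
    derivative^[m] (laguerrePoly (n + m) s) = C ((-1) ^ m) * laguerrePoly n (s + m) := by
  induction m generalizing s with
  | zero => simp
  | succ m ih =>
    rw [Function.iterate_succ_apply, ← add_assoc, derivative_laguerrePoly, iterate_derivative_neg,
      ih, pow_succ]
    push_cast
    rw [show s + 1 + (m : ℂ) = s + (m + 1) by ring]
    simp

theorem laguerrePoly_contiguous (n : ℕ) (s : ℂ) :
    laguerrePoly (n + 1) s = laguerrePoly (n + 1) (s + 1) - laguerrePoly n (s + 1) := by
  induction n generalizing s with
  | zero =>
    simp only [laguerrePoly, laguerreRaise, derivative_one, map_add, C_1]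
    norm_num
    ring
  | succ n ih =>
    refine mul_left_cancel₀ (C_natCast_succ_ne_zero (n + 1)) ?_
    have e1 := C_mul_laguerrePoly_succ (n + 1) s
    have e2 := C_mul_laguerrePoly_succ (n + 1) (s + 1)
    have e3 := congrArg (laguerreRaise s) (ih (s + 1))
    have e4 := C_mul_laguerrePoly_succ n (s + 1)
    rw [laguerreRaise_add_param] at e2 e4
    rw [laguerreRaise_sub] at e3
    push_cast at e1 e2 e3 e4 ⊢
    simp only [map_add, C_1] at e1 e2 e3 e4 ⊢
    linear_combination e1 + e3 - e2 + e4 + ih (s + 1)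

theorem laguerrePoly_lower (n : ℕ) (s : ℂ) :
    X * derivative (laguerrePoly n (s + 1)) + C (s + 1) * laguerrePoly n (s + 1) =
      C (n + s + 1) * laguerrePoly n s := by
  induction n generalizing s with
  | zero => simp [laguerrePoly]
  | succ n ih =>
    refine mul_left_cancel₀ (C_natCast_succ_ne_zero n) ?_
    have e : laguerreRaise s (C ((n : ℂ) + (s + 1) + 1) * laguerrePoly n (s + 1)) =
        C ((n : ℂ) + (s + 1) + 1) * (C ((n : ℂ) + 1) * laguerrePoly (n + 1) s) := by
      rw [laguerreRaise_C_mul, C_mul_laguerrePoly_succ]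
    rw [← ih (s + 1)] at e
    have e2 := C_mul_laguerrePoly_succ n (s + 1)
    have e3 := congrArg derivative e2
    rw [derivative_C_mul] at e3
    push_cast
    simp only [laguerreRaise, derivative_mul, derivative_X, derivative_C, derivative_one,
      derivative_sub, map_add, C_1] at e e2 e3 ⊢
    linear_combination e + X * e3 + (C s + 1) * e2

theorem natDegree_laguerrePoly_le (n : ℕ) (s : ℂ) : (laguerrePoly n s).natDegree ≤ n := by
  induction n generalizing s with
  | zero => simp [laguerrePoly]
  | succ n ih =>
    rw [laguerrePoly]
    refine (natDegree_C_mul_le _ _).trans ?_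
    rw [laguerreRaise]
    refine natDegree_add_le_of_degree_le ?_ ?_
    · refine natDegree_mul_le.trans ?_
      have := natDegree_derivative_le (laguerrePoly n (s + 1))
      have := ih (s + 1)
      have : (X : ℂ[X]).natDegree ≤ 1 := natDegree_X_le
      omega
    · refine natDegree_mul_le.trans ?_
      have := ih (s + 1)
      have : (C (s + 1) - X : ℂ[X]).natDegree ≤ 1 := by
        refine (natDegree_sub_le _ _).trans ?_
        simp
      omega

/-- The n-th derivative is the constant (-1)^n, so the degree does not drop for any complex
parameter. -/
theorem natDegree_laguerrePoly (n : ℕ) (s : ℂ) : (laguerrePoly n s).natDegree = n := by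
  refine le_antisymm (natDegree_laguerrePoly_le n s) ?_
  by_contra h
  push Not at h
  have h1 := iterate_derivative_laguerrePoly n 0 s
  rw [zero_add, iterate_derivative_eq_zero h] at h1
  simp only [laguerrePoly, mul_one] at h1
  exact C_ne_zero.mpr (pow_ne_zero n (by norm_num)) h1.symm

theorem laguerrePoly_ne_zero (n : ℕ) (s : ℂ) : laguerrePoly n s ≠ 0 := by
  intro h
  have h1 := iterate_derivative_laguerrePoly n 0 s
  rw [zero_add, h, iterate_derivative_zero] at h1
  simp only [laguerrePoly, mul_one] at h1
  exact C_ne_zero.mpr (pow_ne_zero n (by norm_num)) h1.symm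

/-- Rodrigues' formula and n integrations by parts, each of which raises the parameter by one. -/
theorem gammaFunctional_laguerrePoly_mul {s : ℂ} (hs : ∀ m : ℕ, s + m + 1 ≠ 0) (n : ℕ)
    (Q : ℂ[X]) : gammaFunctional s (laguerrePoly n s * Q) =
      (-1) ^ n / (n.factorial : ℂ) * gammaFunctional (s + n) (derivative^[n] Q) := by
  induction n generalizing s Q with
  | zero => simp [laguerrePoly]
  | succ n ih =>
    have hs' : ∀ m : ℕ, s + 1 + m + 1 ≠ 0 := fun m => by
      have := hs (m + 1); push_cast at this; rwa [add_right_comm s 1, add_assoc s]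
    have h1 : C (n + 1 : ℂ) * (laguerrePoly (n + 1) s * Q) =
        laguerreRaise s (laguerrePoly n (s + 1) * Q) -
          X * (laguerrePoly n (s + 1) * derivative Q) := by
      rw [← mul_assoc, C_mul_laguerrePoly_succ]
      simp only [laguerreRaise, derivative_mul]
      ring
    have h2 := congrArg (gammaFunctional s) h1
    rw [← smul_eq_C_mul, map_smul, map_sub, gammaFunctional_raise hs, gammaFunctional_X_mul,
      ih hs', smul_eq_mul] at h2
    have h3 : (n + 1 : ℂ) ≠ 0 := Nat.cast_add_one_ne_zero n
    have h4 : (n.factorial : ℂ) ≠ 0 := Nat.cast_ne_zero.mpr n.factorial_ne_zero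
    rw [Nat.factorial_succ, Function.iterate_succ_apply]
    push_cast
    rw [show s + (n + 1 : ℂ) = s + 1 + n by ring]
    refine mul_left_cancel₀ h3 (h2.trans ?_)
    field_simp
    ring

theorem gammaFunctional_orthogonal {s : ℂ} (hs : ∀ m : ℕ, s + m + 1 ≠ 0) {i j : ℕ} (h : i ≠ j) :
    gammaFunctional s (laguerrePoly i s * laguerrePoly j s) = 0 := by
  have key : ∀ i j, j < i → gammaFunctional s (laguerrePoly i s * laguerrePoly j s) = 0 := by
    intro i j hij
    rw [gammaFunctional_laguerrePoly_mul hs, iterate_derivative_eq_zero, map_zero, mul_zero]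
    rwa [natDegree_laguerrePoly]
  rcases lt_or_gt_of_ne h with h | h
  · rw [mul_comm, key _ _ h]
  · exact key _ _ h

theorem gammaFunctional_norm {s : ℂ} (hs : ∀ m : ℕ, s + m + 1 ≠ 0) (n : ℕ) :
    gammaFunctional s (laguerrePoly n s * laguerrePoly n s) =
      Complex.Gamma (s + n + 1) / n.factorial := by
  have h := iterate_derivative_laguerrePoly n 0 s
  rw [zero_add] at h
  rw [gammaFunctional_laguerrePoly_mul hs, h, laguerrePoly, ← smul_eq_C_mul, map_smul,
    gammaFunctional_one, smul_eq_mul, div_mul_eq_mul_div, ← mul_assoc, ← mul_pow]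
  norm_num

theorem succ_mul_choose_succ (k : ℂ) (r : ℕ) :
    ((r : ℂ) + 1) * Ring.choose k (r + 1) = k * Ring.choose (k - 1) r := by
  have h1 := Ring.choose_succ_succ (k - 1) r
  have h2 := Ring.choose_smul_choose k (n := r + 1) (k := 1) (by omega)
  simpa [nsmul_eq_mul] using h2

/-- Raising with s differs from raising with s + k by multiplication by k, and the latter integrates
to zero. The induction trades (s, k) for (s + 1, k - 1), which keeps the functional fixed and
produces the falling factorial of k. -/
theorem gammaFunctional_laguerrePoly (s k : ℂ) (hs : ∀ m : ℕ, s + k + m + 1 ≠ 0) (r : ℕ) :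
    gammaFunctional (s + k) (laguerrePoly r s) =
      (-1) ^ r * Ring.choose k r * Complex.Gamma (s + k + 1) := by
  induction r generalizing s k with
  | zero => simp [laguerrePoly, gammaFunctional_one]
  | succ r ih =>
    have h3 : (r + 1 : ℂ) ≠ 0 := Nat.cast_add_one_ne_zero r
    refine mul_left_cancel₀ h3 ?_
    have h1 : C (r + 1 : ℂ) * laguerrePoly (r + 1) s =
        laguerreRaise (s + k) (laguerrePoly r (s + 1)) - C k * laguerrePoly r (s + 1) := by
      rw [C_mul_laguerrePoly_succ, laguerreRaise_add_param]
      ring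
    have h2 := congrArg (gammaFunctional (s + k)) h1
    have e : s + 1 + (k - 1) = s + k := by ring
    have h4 := ih (s + 1) (k - 1) (by rwa [e])
    rw [e] at h4
    rw [← smul_eq_C_mul, map_smul, map_sub, gammaFunctional_raise hs, ← smul_eq_C_mul, map_smul,
      h4, smul_eq_mul, smul_eq_mul] at h2
    rw [h2]
    linear_combination (-1) ^ r * Complex.Gamma (s + k + 1) * succ_mul_choose_succ k r

/-- Integrating by parts m times on the polynomial of parameter s + k differentiates the other one
into degree n - m with a raised parameter, to which `gammaFunctional_laguerrePoly` applies. -/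
theorem gammaFunctional_connection (s k : ℂ) (hs : ∀ m : ℕ, s + k + m + 1 ≠ 0) {m n : ℕ}
    (hmn : m ≤ n) :
    gammaFunctional (s + k) (laguerrePoly n s * laguerrePoly m (s + k)) =
      (-1) ^ (n - m) * Ring.choose k (n - m) * (Complex.Gamma (s + k + m + 1) / m.factorial) := by
  obtain ⟨r, rfl⟩ := Nat.exists_eq_add_of_le' hmn
  rw [mul_comm, gammaFunctional_laguerrePoly_mul hs, iterate_derivative_laguerrePoly,
    ← smul_eq_C_mul, map_smul, show s + k + (m : ℂ) = s + m + k by ring,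
    gammaFunctional_laguerrePoly, Nat.add_sub_cancel, smul_eq_mul]
  · have : ((-1 : ℂ) ^ m) * (-1) ^ m = 1 := by rw [← mul_pow]; norm_num
    linear_combination (-1) ^ r * Ring.choose k r * Complex.Gamma (s + m + k + 1) / m.factorial *
      this
  · intro l
    have := hs (m + l)
    push_cast at this
    intro h
    exact this (by linear_combination h)

/-- Parseval's identity in the polynomials of parameter s + k, which are orthogonal for this
functional. -/
theorem gammaFunctional_mul_laguerrePoly (s k : ℂ) (hs : ∀ m : ℕ, s + k + m + 1 ≠ 0) {p q : ℕ}
    (hpq : p ≤ q) :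
    gammaFunctional (s + k) (laguerrePoly p s * laguerrePoly q s) =
      (-1) ^ (p + q) * ∑ m ∈ Finset.range (p + 1), Ring.choose k (p - m) * Ring.choose k (q - m) *
        (Complex.Gamma (s + k + m + 1) / m.factorial) := by
  have hG : ∀ m : ℕ, Complex.Gamma (s + k + m + 1) / (m.factorial : ℂ) ≠ 0 := fun m => by
    refine div_ne_zero (Complex.Gamma_ne_zero fun l h => ?_)
      (Nat.cast_ne_zero.mpr m.factorial_ne_zero)
    have := hs (m + l)
    push_cast at this
    exact this (by linear_combination h)
  rw [orthogonal_parseval (gammaFunctional (s + k)) (fun j => laguerrePoly j (s + k))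
    (fun j => natDegree_laguerrePoly _ _) (fun j => laguerrePoly_ne_zero _ _)
    (fun i j h => gammaFunctional_orthogonal hs h)
    (fun j => by rw [gammaFunctional_norm hs]; exact hG j) _ _ (p + 1)
    (by rw [natDegree_laguerrePoly]; omega), Finset.mul_sum]
  refine Finset.sum_congr rfl fun m hm => ?_
  have hm' : m ≤ p := by have := Finset.mem_range.mp hm; omega
  rw [gammaFunctional_connection s k hs hm', gammaFunctional_connection s k hs (hm'.trans hpq),
    gammaFunctional_norm hs]
  have hsign : (-1 : ℂ) ^ (p - m) * (-1) ^ (q - m) = (-1) ^ (p + q) := by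
    have h2 : (-1 : ℂ) ^ (2 * m) = 1 := by rw [pow_mul]; norm_num
    rw [show p + q = (p - m + (q - m)) + 2 * m by omega, pow_add _ (p - m + (q - m)), h2, mul_one,
      pow_add]
  rw [← hsign]
  have := hG m
  generalize Complex.Gamma (s + k + m + 1) / (m.factorial : ℂ) = G at *
  field_simp

/-- Laguerre polynomials are skew-orthogonal up to nearest neighbours. -/
theorem wronskianPairing_laguerrePoly {s : ℂ} (hs : ∀ m : ℕ, s + 1 + m + 1 ≠ 0) {i j : ℕ}
    (h : i < j) :
    wronskianPairing (gammaFunctional (s + 1)) (laguerrePoly i s) (laguerrePoly j s) =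
      if j = i + 1 then -(Complex.Gamma (s + i + 2) / i.factorial) else 0 := by
  obtain ⟨j, rfl⟩ : ∃ l, j = l + 1 := ⟨j - 1, by omega⟩
  -- Derivatives and the contiguous relation bring everything to the parameter s + 1, for which the
  -- functional is orthogonal; the products of the two lower polynomials cancel.
  have key : wronskianPairing (gammaFunctional (s + 1)) (laguerrePoly i s)
      (laguerrePoly (j + 1) s) =
      -gammaFunctional (s + 1) (laguerrePoly i (s + 1) * laguerrePoly j (s + 1)) := by
    rw [wronskianPairing, derivative_laguerrePoly]
    rcases i with _ | i
    · simp [laguerrePoly]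
    · rw [derivative_laguerrePoly, laguerrePoly_contiguous i, laguerrePoly_contiguous j]
      have h0 := gammaFunctional_orthogonal hs (i := i) (j := j + 1) (by omega)
      have e : (laguerrePoly (i + 1) (s + 1) - laguerrePoly i (s + 1)) * -laguerrePoly j (s + 1) -
          -laguerrePoly i (s + 1) * (laguerrePoly (j + 1) (s + 1) - laguerrePoly j (s + 1)) =
          -(laguerrePoly (i + 1) (s + 1) * laguerrePoly j (s + 1)) +
            laguerrePoly i (s + 1) * laguerrePoly (j + 1) (s + 1) := by ring
      rw [e, map_add, h0, add_zero, map_neg]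
  rw [key]
  split_ifs with hj
  · obtain rfl : j = i := by omega
    rw [gammaFunctional_norm hs]
    congr 3
    ring
  · rw [gammaFunctional_orthogonal hs (by omega), neg_zero]

/-- The structure relation of Laguerre polynomials. -/
theorem laguerrePoly_structure (j : ℕ) (s : ℂ) :
    C 2 * (X * derivative (laguerrePoly j s)) + (C (s + 1) - X) * laguerrePoly j s =
      C (j + 1 : ℂ) * laguerrePoly (j + 1) s -
        if j = 0 then 0 else C (s + j) * laguerrePoly (j - 1) s := by
  rcases j with _ | j
  · simp [laguerrePoly, laguerreRaise]
  · rw [if_neg (by omega), Nat.add_sub_cancel]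
    have h1 := laguerrePoly_contiguous j s
    have h2 := derivative_laguerrePoly j s
    have h3 := C_mul_laguerrePoly_succ (j + 1) s
    have h5 := laguerrePoly_lower j s
    have h6 := congrArg derivative h1
    rw [derivative_sub] at h6
    push_cast at h3 h5 ⊢
    simp only [laguerreRaise, map_add, C_1] at h3 h5 ⊢
    rw [show (C 2 : ℂ[X]) = 2 by rfl]
    linear_combination X * h2 - h3 - h5 + X * h6 + (C s + 1 - X) * h1
end Laguerre

/-! ### Behaviour of averages under dilations -/

section Scaling

variable {E : Type*} [NormedAddCommGroup E] [NormedSpace ℝ E]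

open scoped Pointwise in
theorem setIntegral_pi_Ici_scale {n : ℕ} {c : ℝ} (hc : 0 < c) (G : (Fin n → ℝ) → E) :
    ∫ x in Set.univ.pi (fun _ : Fin n => Set.Ici (0 : ℝ)), G x =
      c ^ n • ∫ x in Set.univ.pi (fun _ : Fin n => Set.Ici (0 : ℝ)), G (c • x) := by
  have hcs : c • Set.univ.pi (fun _ : Fin n => Set.Ici (0 : ℝ)) =
      Set.univ.pi (fun _ : Fin n => Set.Ici (0 : ℝ)) := by
    ext x
    rw [Set.mem_smul_set_iff_inv_smul_mem₀ hc.ne']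
    simp only [Set.mem_pi, Set.mem_univ, forall_const, Set.mem_Ici, Pi.smul_apply, smul_eq_mul]
    exact forall_congr' fun i => by rw [mul_nonneg_iff_of_pos_left (inv_pos.mpr hc)]
  rw [Measure.setIntegral_comp_smul_of_pos _ _ _ hc, hcs, smul_smul, Module.finrank_fin_fun,
    mul_inv_cancel₀ (pow_ne_zero _ hc.ne'), one_smul]

/-- A dilation multiplies the density by one constant D and the volume by c^n; both drop out of the
normalized average. -/
theorem linearStatisticAverage_scale {β n : ℕ} {w v : ℝ → ℝ} {f g : ℝ → E} {c κ : ℝ} (hc : 0 < c)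
    (hκ : κ ≠ 0) (hw : ∀ x, 0 ≤ x → w (c * x) = κ * v x) (hf : ∀ x, 0 ≤ x → f (c * x) = g x) :
    linearStatisticAverage β (Set.Ici 0) w n f = linearStatisticAverage β (Set.Ici 0) v n g := by
  rw [linearStatisticAverage, linearStatisticAverage]
  generalize hs : Set.univ.pi (fun _ : Fin n => Set.Ici (0 : ℝ)) = s
  have hmeas : MeasurableSet s := hs ▸ MeasurableSet.univ_pi fun _ => measurableSet_Ici
  have hpos : ∀ x ∈ s, ∀ j, 0 ≤ x j := fun x hx j => by
    rw [← hs] at hx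
    exact hx j trivial
  set D : ℝ := κ ^ n * ∏ i : Fin n, ∏ _j ∈ Finset.Ioi i, c ^ β with hD
  have hD0 : D ≠ 0 := mul_ne_zero (pow_ne_zero _ hκ) (Finset.prod_ne_zero_iff.mpr fun i _ =>
    Finset.prod_ne_zero_iff.mpr fun j _ => pow_ne_zero _ hc.ne')
  have hdens : ∀ x ∈ s, jointDensity β w (c • x) = D * jointDensity β v x := by
    intro x hx
    simp only [jointDensity, Pi.smul_apply, smul_eq_mul]
    rw [Finset.prod_congr rfl fun j _ => hw (x j) (hpos x hx j), Finset.prod_mul_distrib,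
      Finset.prod_const, Finset.card_univ, Fintype.card_fin, hD]
    have : ∏ i : Fin n, ∏ j ∈ Finset.Ioi i, |c * x j - c * x i| ^ β =
        (∏ i : Fin n, ∏ _j ∈ Finset.Ioi i, c ^ β) *
          ∏ i : Fin n, ∏ j ∈ Finset.Ioi i, |x j - x i| ^ β := by
      simp only [← Finset.prod_mul_distrib]
      refine Finset.prod_congr rfl fun i _ => Finset.prod_congr rfl fun j _ => ?_
      rw [← mul_sub, abs_mul, abs_of_pos hc, mul_pow]
    rw [this]
    ring
  have hZ : ∫ x in s, jointDensity β w x = (c ^ n * D) * ∫ x in s, jointDensity β v x := by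
    have h := setIntegral_pi_Ici_scale (n := n) hc (jointDensity β w)
    rw [hs, setIntegral_congr_fun hmeas hdens, integral_const_mul, smul_eq_mul, ← mul_assoc] at h
    exact h
  have hN : ∫ x in s, jointDensity β w x • ∑ j, f (x j) =
      (c ^ n * D) • ∫ x in s, jointDensity β v x • ∑ j, g (x j) := by
    have h2 : ∀ x ∈ s, jointDensity β w (c • x) • ∑ j, f ((c • x) j) =
        D • (jointDensity β v x • ∑ j, g (x j)) := by
      intro x hx
      rw [hdens x hx, mul_smul]
      congr 2
      exact Finset.sum_congr rfl fun j _ => hf (x j) (hpos x hx j)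
    have h := setIntegral_pi_Ici_scale (n := n) hc fun x => jointDensity β w x • ∑ j, f (x j)
    rw [hs, setIntegral_congr_fun hmeas h2, integral_smul, smul_smul] at h
    exact h
  rw [hZ, hN, smul_smul]
  congr 1
  have := pow_ne_zero n hc.ne'
  field_simp

theorem linearStatisticAverage_const_mul {β n : ℕ} {I : Set ℝ} {w : ℝ → ℝ} (a : ℂ) (f : ℝ → ℂ) :
    linearStatisticAverage β I w n (fun x => a * f x) = a * linearStatisticAverage β I w n f := by
  simp only [linearStatisticAverage, ← Finset.mul_sum, ← mul_smul_comm]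
  rw [integral_const_mul, mul_smul_comm]

theorem linearStatisticAverage_ofReal {β n : ℕ} {I : Set ℝ} {w : ℝ → ℝ} (f : ℝ → ℝ) :
    ((linearStatisticAverage β I w n f : ℝ) : ℂ) =
      linearStatisticAverage β I w n (fun x => (f x : ℂ)) := by
  simp only [linearStatisticAverage, smul_eq_mul, Complex.real_smul]
  rw [Complex.ofReal_mul, ← integral_complex_ofReal]
  congr 1
  refine integral_congr_ae (ae_of_all _ fun x => ?_)
  simp

end Scaling

/-! ### Laguerre weights, Wronskian expansion and tridiagonal kernel -/

section LaguerreEnsemble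

theorem isMomentFunctional_gamma {a : ℝ} {k : ℂ} (h : -1 < a + k.re) :
    IsMomentFunctional (volume.restrict (Set.Ici 0))
      (fun x : ℝ => ((x ^ a * Real.exp (-x) : ℝ) : ℂ) * (x : ℂ) ^ k) (gammaFunctional (a + k)) := by
  have hr : (volume : Measure ℝ).restrict (Set.Ici 0) = volume.restrict (Set.Ioi 0) :=
    Measure.restrict_congr_set Ioi_ae_eq_Ici.symm
  rw [hr]
  refine IsMomentFunctional.of_monomials fun p => ?_
  have hre : 0 < ((a : ℂ) + k + p + 1).re := by
    simp only [Complex.add_re, Complex.ofReal_re, Complex.natCast_re, Complex.one_re]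
    have : (0 : ℝ) ≤ p := Nat.cast_nonneg p
    linarith
  have hcongr : ∀ x ∈ Set.Ioi (0 : ℝ),
      ((-x).exp : ℂ) * (x : ℂ) ^ ((a : ℂ) + k + p + 1 - 1) =
      ((x ^ a * Real.exp (-x) : ℝ) : ℂ) * (x : ℂ) ^ k * (x : ℂ) ^ p := by
    intro x hx
    have hx0 : (x : ℂ) ≠ 0 := Complex.ofReal_ne_zero.mpr (ne_of_gt hx)
    rw [add_sub_cancel_right, Complex.cpow_add _ _ hx0, Complex.cpow_add _ _ hx0,
      Complex.cpow_natCast, Complex.ofReal_mul, Complex.ofReal_cpow (le_of_lt hx)]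
    ring
  constructor
  · exact (integrableOn_congr_fun hcongr measurableSet_Ioi).mp
      (Complex.GammaIntegral_convergent hre)
  · rw [gammaFunctional, momentFunctional_X_pow, Complex.Gamma_eq_integral hre,
      Complex.GammaIntegral]
    exact (setIntegral_congr_fun measurableSet_Ioi hcongr).symm

theorem isMomentFunctional_gamma_one {a : ℝ} (h : -1 < a) :
    IsMomentFunctional (volume.restrict (Set.Ici 0))
      (fun x : ℝ => ((x ^ a * Real.exp (-x) : ℝ) : ℂ)) (gammaFunctional a) := by
  have := isMomentFunctional_gamma (a := a) (k := 0) (by simpa using h)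
  simpa using this

theorem laguerreMoment_four_eq_average (b : ℝ) (k : ℂ) (n : ℕ) :
    laguerreMoment 4 b k n = (2 : ℂ) ^ (-k) * linearStatisticAverage 4 (Set.Ici 0)
      (fun x => x ^ (2 * b + 1) * Real.exp (-x)) n (fun x : ℝ => (x : ℂ) ^ k) := by
  rw [laguerreMoment, ← linearStatisticAverage_const_mul]
  -- The substitution x ↦ x / 2 turns e^{-2x} into e^{-x} and brings the factor 2^{-k} out of x^k.
  refine linearStatisticAverage_scale (c := 1 / 2) (κ := (1 / 2) ^ (2 * b + 1)) (by norm_num)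
    (by positivity) (fun x hx => ?_) (fun x hx => ?_)
  · rw [laguerreWeight, show ((4 : ℕ) : ℝ) / 2 * (b + 1) - 1 = 2 * b + 1 by push_cast; ring,
      Real.mul_rpow (by norm_num) hx, show -((4 : ℕ) : ℝ) * (1 / 2 * x) / 2 = -x by
        push_cast; ring]
    ring
  · rw [Complex.ofReal_mul, Complex.mul_cpow_ofReal_nonneg (by norm_num) hx]
    congr 1
    push_cast
    rw [one_div, Complex.inv_cpow _ _ (by
      rw [show (2 : ℂ) = ((2 : ℝ) : ℂ) by norm_num, Complex.arg_ofReal_of_nonneg (by norm_num)]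
      exact Real.pi_ne_zero.symm),
      Complex.cpow_neg]

theorem laguerreMoment_two_eq_average (b : ℝ) (k : ℂ) (n : ℕ) :
    laguerreMoment 2 b k n = linearStatisticAverage 2 (Set.Ici 0)
      (fun x => x ^ b * Real.exp (-x)) n (fun x : ℝ => (x : ℂ) ^ k) := by
  rw [laguerreMoment]
  congr 1
  funext x
  rw [laguerreWeight]
  congr 2
  · push_cast; ring
  · push_cast; ring

theorem integral_jointDensity_gamma_ne_zero {a : ℝ} (ha : -1 < a) (n : ℕ) :
    ∫ x in Set.univ.pi (fun _ : Fin n => Set.Ici (0 : ℝ)),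
      jointDensity 4 (fun x => x ^ a * Real.exp (-x)) x ≠ 0 := by
  refine (integral_jointDensity_pos measurableSet_Ici
    (fun x hx => mul_nonneg (Real.rpow_nonneg hx _) (Real.exp_pos _).le) (zero_lt_one' ℝ)
    (fun x hx => hx.1.le) (fun x hx => mul_pos (Real.rpow_pos_of_pos hx.1 _) (Real.exp_pos _))
    ?_).ne'
  -- Integrability of the density comes from the determinant expansion in monomials, applied to the
  -- trivial statistic 1.
  have h := isMomentFunctional_gamma_one ha
  exact (linearStatisticAverage_four (w := fun x => x ^ a * Real.exp (-x))
    (f := fun _ => (1 : ℂ)) h (by simp only [mul_one]; exact h)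
    (fun j => X ^ j) (fun j => natDegree_X_pow j) (fun j => pow_ne_zero j X_ne_zero) n).1

/-- Integration by parts: x(PQ' - P'Q) equals P(2xQ' + (α + 1 - x)Q) + kPQ up to a term annihilated
by the functional with parameter α + k. For Q = L_j the structure relation reduces the bracket to
L_{j-1} and L_{j+1}, with coefficients equal to the Wronskian pairings times l!/Γ(α + l + 1). The
remaining term is symmetric in i and j. -/
theorem laguerre_wronskian_expansion {α k : ℂ} (hα : -2 < α.re) (hs : ∀ m : ℕ, α + k + m + 1 ≠ 0)
    {N i j : ℕ} (hj : j < N) :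
    wronskianPairing (gammaFunctional (α + 1 + k)) (laguerrePoly i α) (laguerrePoly j α) =
      ∑ l ∈ Finset.range (N + 1), gammaFunctional (α + k) (laguerrePoly i α * laguerrePoly l α) *
        (l.factorial * (Complex.Gamma (α + l + 1))⁻¹) *
        wronskianPairing (gammaFunctional (α + 1)) (laguerrePoly l α) (laguerrePoly j α) +
      k * gammaFunctional (α + k) (laguerrePoly i α * laguerrePoly j α) := by
  have hs1 : ∀ m : ℕ, α + 1 + m + 1 ≠ 0 := fun m h => by
    have := congrArg Complex.re h
    simp only [Complex.add_re, Complex.one_re, Complex.natCast_re, Complex.zero_re] at this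
    have : (0 : ℝ) ≤ m := Nat.cast_nonneg m
    linarith
  have hG : ∀ m : ℕ, Complex.Gamma (α + m + 2) ≠ 0 := fun m =>
    Complex.Gamma_ne_zero fun l h => hs1 (m + l) (by push_cast; linear_combination h)
  have hup : ∀ j : ℕ, (((j + 1).factorial : ℂ) * (Complex.Gamma (α + (j + 1 : ℕ) + 1))⁻¹) *
      wronskianPairing (gammaFunctional (α + 1)) (laguerrePoly (j + 1) α) (laguerrePoly j α) =
      j + 1 := by
    intro j
    have h1 := hG j
    have h2 : (j.factorial : ℂ) ≠ 0 := Nat.cast_ne_zero.mpr j.factorial_ne_zero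
    rw [wronskianPairing_antisymm, wronskianPairing_laguerrePoly hs1 (Nat.lt_succ_self j),
      if_pos rfl, neg_neg, Nat.factorial_succ]
    push_cast
    rw [show α + ((j : ℂ) + 1) + 1 = α + j + 2 by ring]
    field_simp
  have hdown : ∀ j : ℕ, ((j.factorial : ℂ) * (Complex.Gamma (α + j + 1))⁻¹) *
      wronskianPairing (gammaFunctional (α + 1)) (laguerrePoly j α) (laguerrePoly (j + 1) α) =
      -(α + j + 1) := by
    intro j
    have h2 : (j.factorial : ℂ) ≠ 0 := Nat.cast_ne_zero.mpr j.factorial_ne_zero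
    rw [wronskianPairing_laguerrePoly hs1 (Nat.lt_succ_self j), if_pos rfl]
    -- At the pole of Γ the convention Γ(0) = 0 with inverse 0 gives 1/Γ its correct value, so both
    -- sides vanish.
    by_cases h0 : α + j + 1 = 0
    · rw [h0, Complex.Gamma_zero]
      simp
    · have h3 : Complex.Gamma (α + j + 2) = (α + j + 1) * Complex.Gamma (α + j + 1) := by
        rw [← Complex.Gamma_add_one _ h0]
        congr 1
        ring
      have h4 : Complex.Gamma (α + j + 1) ≠ 0 := by
        have := hG j
        rw [h3] at this
        exact right_ne_zero_of_mul this
      rw [h3]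
      field_simp
  have hzero : ∀ l, l ≠ j + 1 → l + 1 ≠ j → wronskianPairing (gammaFunctional (α + 1))
      (laguerrePoly l α) (laguerrePoly j α) = 0 := by
    intro l h1 h2
    rcases lt_trichotomy l j with h | h | h
    · rw [wronskianPairing_laguerrePoly hs1 h, if_neg (Ne.symm h2)]
    · rw [h, wronskianPairing, mul_comm (derivative _), sub_self, map_zero]
    · rw [wronskianPairing_antisymm, wronskianPairing_laguerrePoly hs1 h, if_neg h1, neg_zero]
  have hsum : ∑ l ∈ Finset.range (N + 1),
      gammaFunctional (α + k) (laguerrePoly i α * laguerrePoly l α) *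
        (l.factorial * (Complex.Gamma (α + l + 1))⁻¹) *
        wronskianPairing (gammaFunctional (α + 1)) (laguerrePoly l α) (laguerrePoly j α) =
      gammaFunctional (α + k) (laguerrePoly i α * (C 2 * (X * derivative (laguerrePoly j α)) +
        (C (α + 1) - X) * laguerrePoly j α)) := by
    rw [laguerrePoly_structure]
    rcases j with _ | j
    · rw [Finset.sum_eq_single_of_mem 1 (Finset.mem_range.mpr (by omega))
        (fun l _ h => by rw [hzero l (by simpa using h) (by omega), mul_zero]), mul_assoc]
      have := hup 0
      simp only [zero_add] at this ⊢
      rw [this]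
      simp
    · rw [Finset.sum_eq_add_of_mem j (j + 1 + 1) (Finset.mem_range.mpr (by omega))
        (Finset.mem_range.mpr (by omega)) (by omega)
        (fun l _ h => by rw [hzero l h.2 (by omega), mul_zero]), mul_assoc (gammaFunctional _ _),
        mul_assoc (gammaFunctional _ _), hup, hdown, if_neg (by omega), Nat.add_sub_cancel, mul_sub, map_sub]
      have e : ∀ (a : ℂ) (P Q : ℂ[X]), gammaFunctional (α + k) (P * (C a * Q)) =
          a * gammaFunctional (α + k) (P * Q) := by
        intro a P Q
        rw [mul_left_comm, ← smul_eq_C_mul, map_smul, smul_eq_mul]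
      rw [e, e]
      push_cast
      ring
  -- The product rule for `laguerreRaise (α + k)` applied to the product of the two polynomials.
  have e : X * (laguerrePoly i α * derivative (laguerrePoly j α) -
      derivative (laguerrePoly i α) * laguerrePoly j α) =
      laguerrePoly i α * (C 2 * (X * derivative (laguerrePoly j α)) +
        (C (α + 1) - X) * laguerrePoly j α) + C k * (laguerrePoly i α * laguerrePoly j α) -
      laguerreRaise (α + k) (laguerrePoly i α * laguerrePoly j α) := by
    simp only [laguerreRaise, derivative_mul, map_add, C_1]
    rw [show (C 2 : ℂ[X]) = 2 by rfl]
    ring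
  rw [hsum, wronskianPairing, show α + 1 + k = α + k + 1 by ring, ← gammaFunctional_X_mul, e,
    map_sub, map_add, gammaFunctional_raise hs, sub_zero, ← smul_eq_C_mul k, map_smul,
    smul_eq_mul]

/-- The ratio of consecutive entries is 2(b + m + 1)/(2m + 1), and the factorials, Γ(b + m + 1) and
the power of 4 telescope it. The induction starts at the last even index and moves downwards. -/
theorem tridiagonalKernel_laguerre {b : ℝ} (hb : -1 < b) (d m : ℕ) :
    tridiagonalKernel (fun j : ℕ => -(Complex.Gamma (2 * b + j + 2) / (j.factorial : ℂ)))
      (m + d + 1) m =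
    -((2 * m).factorial * (m + d).factorial * Complex.Gamma (b + m + d + 1) * 4 ^ d /
      (m.factorial * Complex.Gamma (b + m + 1) * Complex.Gamma (2 * b + 2 * m + 2 * d + 2))) := by
  have hG1 : ∀ x : ℝ, 0 ≤ x → Complex.Gamma ((b : ℂ) + x + 1) ≠ 0 := fun x hx =>
    Complex.Gamma_ne_zero_of_re_pos (by simp; linarith)
  have hG2 : ∀ x : ℝ, 0 ≤ x → Complex.Gamma (2 * (b : ℂ) + x + 2) ≠ 0 := fun x hx =>
    Complex.Gamma_ne_zero_of_re_pos (by simp; linarith)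
  have hfac : ∀ m : ℕ, (m.factorial : ℂ) ≠ 0 := fun m => Nat.cast_ne_zero.mpr m.factorial_ne_zero
  induction d generalizing m with
  | zero =>
    have h1 := tridiagonalKernel_last
      (t := fun j : ℕ => -(Complex.Gamma (2 * b + j + 2) / (j.factorial : ℂ))) (n := m + 0 + 1)
      (by omega)
    simp only [add_zero, Nat.add_sub_cancel] at h1 ⊢
    rw [h1]
    have h2 := hG1 m (Nat.cast_nonneg m)
    have h3 := hG2 (2 * m) (by positivity)
    have h4 := hfac m
    have h5 := hfac (2 * m)
    push_cast at h2 h3 ⊢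
    field_simp
    simp
  | succ d ih =>
    rw [tridiagonalKernel_step (by omega), show m + (d + 1) + 1 = m + 1 + d + 1 by ring, ih]
    have h1 := hG1 m (Nat.cast_nonneg m)
    have h2 := hG2 (2 * m) (by positivity)
    have h5 : (b : ℂ) + m + 1 ≠ 0 := by
      intro h
      have h6 := congrArg Complex.re h
      simp only [Complex.add_re, Complex.ofReal_re, Complex.natCast_re, Complex.one_re,
        Complex.zero_re] at h6
      have : (0 : ℝ) ≤ m := Nat.cast_nonneg m
      linarith
    have h5' : 2 * (b : ℂ) + 2 * m + 2 ≠ 0 := by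
      rw [show 2 * (b : ℂ) + 2 * m + 2 = 2 * (b + m + 1) by ring]
      exact mul_ne_zero two_ne_zero h5
    have h3 : Complex.Gamma ((b : ℂ) + (m + 1 : ℕ) + 1) =
        (b + m + 1) * Complex.Gamma ((b : ℂ) + m + 1) := by
      rw [← Complex.Gamma_add_one _ h5]
      push_cast; ring_nf
    have h4 : Complex.Gamma (2 * (b : ℂ) + (2 * m + 1 : ℕ) + 2) =
        (2 * b + 2 * m + 2) * Complex.Gamma (2 * (b : ℂ) + (2 * m : ℕ) + 2) := by
      rw [Nat.cast_mul, Nat.cast_ofNat, ← Complex.Gamma_add_one _ h5']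
      push_cast; ring_nf
    rw [h3, h4, show 2 * (m + 1) = 2 * m + 1 + 1 by ring, Nat.factorial_succ (2 * m + 1),
      Nat.factorial_succ (2 * m), Nat.factorial_succ m,
      show m + 1 + d = m + (d + 1) by ring]
    have e1 : (b : ℂ) + (m + 1 : ℕ) + d + 1 = b + m + (d + 1 : ℕ) + 1 := by push_cast; ring
    have e2 : 2 * (b : ℂ) + 2 * (m + 1 : ℕ) + 2 * d + 2 = 2 * b + 2 * m + 2 * (d + 1 : ℕ) + 2 := by
      push_cast; ring
    rw [e1, e2]
    have h6 := hG2 (2 * m + 2 * (d + 1)) (by positivity)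
    have h7 := hfac m
    have h8 := hfac (2 * m)
    have h9 : (m : ℂ) + 1 ≠ 0 := Nat.cast_add_one_ne_zero m
    have h10 : (2 * (m : ℂ) + 1) ≠ 0 := by
      exact_mod_cast Nat.succ_ne_zero (2 * m)
    push_cast at h1 h2 h6 ⊢
    rw [← add_assoc] at h6
    generalize Complex.Gamma ((b : ℂ) + m + 1) = G1 at *
    generalize Complex.Gamma (2 * (b : ℂ) + 2 * m + 2) = G2 at *
    generalize Complex.Gamma (2 * (b : ℂ) + 2 * m + 2 * (d + 1) + 2) = G3 at *
    field_simp
    ring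

end LaguerreEnsemble

/-! ### Moments of the Laguerre ensembles and of the proper delay times -/

section LaguerreMoments

theorem add_natCast_add_one_ne_zero {s : ℂ} (h : -2 < s.re) (h1 : s ≠ -1) (m : ℕ) :
    s + m + 1 ≠ 0 := by
  intro h0
  rcases m with _ | m
  · exact h1 (by simpa [add_eq_zero_iff_eq_neg] using h0)
  · have h2 := congrArg Complex.re h0
    simp only [Complex.add_re, Complex.natCast_re, Complex.one_re, Complex.zero_re] at h2
    push_cast at h2
    have : (0 : ℝ) ≤ m := Nat.cast_nonneg m
    linarith

theorem add_natCast_add_one_ne_zero_of_neg_one_lt {s : ℂ} (h : -1 < s.re) (m : ℕ) :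
    s + m + 1 ≠ 0 :=
  add_natCast_add_one_ne_zero (by linarith) (fun h1 => by simp [h1] at h) m

/-- The moments of the Laguerre unitary ensemble, continued analytically. -/
def laguerreContinuation (N : ℕ) (p : ℂ × ℂ) : ℂ :=
  ∑ l ∈ Finset.range N, (∑ m ∈ Finset.range (l + 1),
    Ring.choose p.2 (l - m) * Ring.choose p.2 (l - m) *
      (Complex.Gamma (p.1 + p.2 + m + 1) / m.factorial)) *
    (l.factorial * (Complex.Gamma (p.1 + l + 1))⁻¹)

theorem gammaFunctional_sq_laguerrePoly {s k : ℂ} (hs : ∀ m : ℕ, s + k + m + 1 ≠ 0) (l : ℕ) :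
    gammaFunctional (s + k) (laguerrePoly l s * laguerrePoly l s) =
      ∑ m ∈ Finset.range (l + 1), Ring.choose k (l - m) * Ring.choose k (l - m) *
        (Complex.Gamma (s + k + m + 1) / m.factorial) := by
  rw [gammaFunctional_mul_laguerrePoly s k hs le_rfl, Even.neg_one_pow ⟨l, rfl⟩, one_mul]

theorem laguerreMoment_two_eq {b : ℝ} {k : ℂ} (hb : -1 < b) (hk : -1 < b + k.re) (N : ℕ) :
    laguerreMoment 2 b k N = laguerreContinuation N ((b : ℂ), k) := by
  have hs0 : ∀ m : ℕ, (b : ℂ) + m + 1 ≠ 0 :=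
    add_natCast_add_one_ne_zero_of_neg_one_lt (by simpa using hb)
  have hs : ∀ m : ℕ, (b : ℂ) + k + m + 1 ≠ 0 :=
    add_natCast_add_one_ne_zero_of_neg_one_lt (by simpa using hk)
  rw [laguerreMoment_two_eq_average, linearStatisticAverage_two
    (w := fun x => x ^ b * Real.exp (-x)) (isMomentFunctional_gamma_one hb)
    (isMomentFunctional_gamma hk) (fun j => laguerrePoly j b)
    (fun j => natDegree_laguerrePoly j b) (fun j => laguerrePoly_ne_zero j b)
    (fun i j h => gammaFunctional_orthogonal hs0 h)]
  · refine Finset.sum_congr rfl fun l _ => ?_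
    rw [gammaFunctional_sq_laguerrePoly hs, gammaFunctional_norm hs0, div_div_eq_mul_div,
      mul_div_assoc, div_eq_mul_inv (l.factorial : ℂ)]
  · intro j
    rw [gammaFunctional_norm hs0]
    refine div_ne_zero (Complex.Gamma_ne_zero_of_re_pos ?_)
      (Nat.cast_ne_zero.mpr j.factorial_ne_zero)
    simp only [Complex.add_re, Complex.ofReal_re, Complex.natCast_re, Complex.one_re]
    have : (0 : ℝ) ≤ j := Nat.cast_nonneg j
    linarith

theorem sum_Icc_one_eq_sum_range_sub {M : Type*} [AddCommMonoid M] (f : ℕ → M) (n : ℕ) :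
    ∑ j ∈ Finset.Icc 1 n, f j = ∑ j ∈ Finset.range n, f (n - j) := by
  refine Finset.sum_nbij' (fun j => n - j) (fun j => n - j) ?_ ?_ ?_ ?_ ?_
  · intro j hj
    simp only [Finset.mem_Icc, Finset.mem_range] at hj ⊢
    omega
  · intro j hj
    simp only [Finset.mem_Icc, Finset.mem_range] at hj ⊢
    omega
  · intro j hj
    simp only [Finset.mem_Icc] at hj ⊢
    omega
  · intro j hj
    simp only [Finset.mem_range] at hj ⊢
    omega
  · intro j hj
    simp only [Finset.mem_Icc] at hj
    rw [show n - (n - j) = j by omega]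

/-- In the indices j ↦ n - j and i = 2j - m the Pochhammer symbols containing i contribute Γ(2b + k
+ m + 1)/m!, the m-th weight in the expansion of the pairing of L_{2j} with L_{2n}; all other
factors assemble into a kernel entry. -/
theorem laguerreCorrection_term {b : ℝ} (hb : -1 < b) (k : ℂ) {n j m : ℕ} (hj : j < n)
    (hm : m ≤ 2 * j) :
    pochC (2 * b + 2 * n) (k - (2 * j - m : ℕ) - 2 * (n - j : ℕ) + 1) *
      pochC (2 * n - (2 * j - m : ℕ) - 2 * (n - j : ℕ) + 1) (2 * j - m : ℕ) /
      ((2 : ℂ) ^ (k - 2 * (n - j : ℕ) + 2) * pochC (n + 1) (-(n - j : ℕ)) *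
        pochC (b + n) (1 - (n - j : ℕ))) =
    -(2 ^ (-k) * n * tridiagonalKernel
      (fun j : ℕ => -(Complex.Gamma (2 * b + j + 2) / (j.factorial : ℂ))) n j *
      (Complex.Gamma (2 * b + k + m + 1) / m.factorial)) := by
  obtain ⟨d, rfl⟩ : ∃ d, n = j + d + 1 := ⟨n - j - 1, by omega⟩
  rw [tridiagonalKernel_laguerre hb, show j + d + 1 - j = d + 1 by omega, Nat.cast_sub hm]
  simp only [pochC]
  push_cast
  have h1 : 2 * (b : ℂ) + 2 * (j + d + 1) + (k - (2 * j - m) - 2 * (d + 1) + 1) =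
      2 * b + k + m + 1 := by ring
  have h2 : 2 * ((j : ℂ) + d + 1) - (2 * j - m) - 2 * (d + 1) + 1 + (2 * j - m) =
      (2 * j : ℕ) + 1 := by push_cast; ring
  have h3 : 2 * ((j : ℂ) + d + 1) - (2 * j - m) - 2 * (d + 1) + 1 = m + 1 := by ring
  have h4 : (j : ℂ) + d + 1 + 1 + -(d + 1) = j + 1 := by ring
  have h5 : (b : ℂ) + (j + d + 1) + (1 - (d + 1)) = b + j + 1 := by ring
  have h6 : (2 : ℂ) ^ (k - 2 * ((d : ℂ) + 1) + 2) = (2 ^ (-k))⁻¹ / 4 ^ d := by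
    rw [← Complex.cpow_neg, neg_neg, show k - 2 * ((d : ℂ) + 1) + 2 = k - (2 * d : ℕ) by
      push_cast; ring, Complex.cpow_sub _ _ two_ne_zero, Complex.cpow_natCast, pow_mul]
    norm_num
  have h7 : (j : ℂ) + d + 1 + 1 = (j + d + 1 : ℕ) + 1 := by push_cast; ring
  have h8 : (b : ℂ) + (j + d + 1) = b + j + d + 1 := by ring
  have h9 : 2 * (b : ℂ) + 2 * (j + d + 1) = 2 * b + 2 * j + 2 * d + 2 := by ring
  rw [h1, h2, h3, h4, h5, h6, h7, h8, h9, Complex.Gamma_nat_eq_factorial,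
    Complex.Gamma_nat_eq_factorial, Complex.Gamma_nat_eq_factorial,
    Complex.Gamma_nat_eq_factorial, Nat.factorial_succ]
  have hfac : ∀ m : ℕ, (m.factorial : ℂ) ≠ 0 := fun m => Nat.cast_ne_zero.mpr m.factorial_ne_zero
  have hj0 : (0 : ℝ) ≤ j := Nat.cast_nonneg j
  have hd0 : (0 : ℝ) ≤ d := Nat.cast_nonneg d
  have g1 : Complex.Gamma ((b : ℂ) + j + 1) ≠ 0 :=
    Complex.Gamma_ne_zero_of_re_pos (by simp; linarith)
  have g2 : Complex.Gamma ((b : ℂ) + j + d + 1) ≠ 0 :=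
    Complex.Gamma_ne_zero_of_re_pos (by simp; linarith)
  have g3 : Complex.Gamma (2 * (b : ℂ) + 2 * j + 2 * d + 2) ≠ 0 :=
    Complex.Gamma_ne_zero_of_re_pos (by simp; linarith)
  have g4 : (2 : ℂ) ^ (-k) ≠ 0 := by simp [Complex.cpow_eq_zero_iff]
  have g5 := hfac j
  have g6 := hfac m
  have g7 := hfac (j + d)
  have g8 : (j : ℂ) + d + 1 ≠ 0 := by exact_mod_cast Nat.succ_ne_zero (j + d)
  push_cast
  field_simp

/-- The polynomials are those of parameter α = 2b, formally orthogonal for x^α e^{-x}, which need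
not be integrable. As integrals only pairings against x^{α+1} e^{-x} and x^{α+1+k} e^{-x} occur, and
these converge; the rest is algebra with `gammaFunctional`. -/
theorem laguerreMoment_four_eq {b : ℝ} {k : ℂ} (hb : -1 < b) (hk : -2 < 2 * b + k.re)
    (hbk : 2 * (b : ℂ) + k ≠ -1) {n : ℕ} (hn : 1 ≤ n) :
    laguerreMoment 4 b k n = (2 : ℂ) ^ (-k - 1) * laguerreContinuation (2 * n) (2 * (b : ℂ), k) -
      laguerreCorrection b k n := by
  set α : ℂ := 2 * (b : ℂ) with hα
  have hαre : -2 < α.re := by simp [hα]; linarith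
  have hs : ∀ m : ℕ, α + k + m + 1 ≠ 0 :=
    add_natCast_add_one_ne_zero (by simp [hα]; linarith) hbk
  have hs1 : ∀ m : ℕ, α + 1 + m + 1 ≠ 0 :=
    add_natCast_add_one_ne_zero_of_neg_one_lt (by simp [hα]; linarith)
  have hΛ := isMomentFunctional_gamma_one (a := 2 * b + 1) (by linarith)
  have hf := isMomentFunctional_gamma (a := 2 * b + 1) (k := k) (by linarith)
  have hcast : ((2 * b + 1 : ℝ) : ℂ) = α + 1 := by rw [hα]; push_cast; ring
  rw [hcast] at hΛ hf
  have ht : ∀ j : ℕ, wronskianPairing (gammaFunctional (α + 1)) (laguerrePoly j α)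
      (laguerrePoly (j + 1) α) = -(Complex.Gamma (α + j + 2) / j.factorial) := fun j => by
    rw [wronskianPairing_laguerrePoly hs1 (Nat.lt_succ_self j), if_pos rfl]
  have hG : ∀ m : ℕ, Complex.Gamma (α + m + 2) ≠ 0 := fun m =>
    Complex.Gamma_ne_zero fun l h => hs1 (m + l) (by push_cast; linear_combination h)
  have hfac : ∀ m : ℕ, (m.factorial : ℂ) ≠ 0 := fun m => Nat.cast_ne_zero.mpr m.factorial_ne_zero
  have havg := linearStatisticAverage_four_eq (w := fun x => x ^ (2 * b + 1) * Real.exp (-x))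
    hΛ hf (fun j => laguerrePoly j α)
    (fun j => natDegree_laguerrePoly j α) (fun j => laguerrePoly_ne_zero j α)
    (integral_jointDensity_gamma_ne_zero (a := 2 * b + 1) (by linarith) n)
    (fun i l => gammaFunctional (α + k) (laguerrePoly i α * laguerrePoly l α))
    (fun i l => k * gammaFunctional (α + k) (laguerrePoly i α * laguerrePoly l α))
    (fun l => l.factorial * (Complex.Gamma (α + l + 1))⁻¹)
    (fun i j h => by rw [wronskianPairing_laguerrePoly hs1 (by omega), if_neg (by omega)])
    (fun j => by rw [ht]; exact neg_ne_zero.mpr (div_ne_zero (hG j) (hfac j)))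
    (fun i j => by rw [mul_comm (laguerrePoly i α)])
    (fun i j _ hj => laguerre_wronskian_expansion hαre hs hj)
  -- The coefficient g_N A_{N,N-1} of the rank one term, for N = 2n.
  have hγ : ((n * 2).factorial * (Complex.Gamma (α + (n * 2 : ℕ) + 1))⁻¹) *
      wronskianPairing (gammaFunctional (α + 1)) (laguerrePoly (n * 2) α)
        (laguerrePoly (n * 2 - 1) α) = 2 * n := by
    obtain ⟨M, hM⟩ : ∃ M, n * 2 = M + 1 := ⟨n * 2 - 1, by omega⟩
    have hM' : (2 * n : ℂ) = M + 1 := by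
      have := congrArg (Nat.cast (R := ℂ)) hM
      push_cast at this
      rw [mul_comm, this]
    rw [hM, Nat.add_sub_cancel, wronskianPairing_antisymm, ht, hM', Nat.factorial_succ]
    have h1 := hG M
    have h2 := hfac M
    push_cast
    rw [show α + ((M : ℂ) + 1) + 1 = α + M + 2 by ring]
    field_simp
  have htf : (fun j => wronskianPairing (gammaFunctional (α + 1)) (laguerrePoly j α)
      (laguerrePoly (j + 1) α)) =
      fun j : ℕ => -(Complex.Gamma (2 * b + j + 2) / (j.factorial : ℂ)) := by
    funext j
    rw [ht]
  rw [hγ, htf] at havg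
  have hmain : (∑ l ∈ Finset.range (n * 2), gammaFunctional (α + k)
      (laguerrePoly l α * laguerrePoly l α) *
        (l.factorial * (Complex.Gamma (α + l + 1))⁻¹)) = laguerreContinuation (2 * n) (α, k) := by
    rw [laguerreContinuation, mul_comm n 2]
    exact Finset.sum_congr rfl fun l _ => by rw [gammaFunctional_sq_laguerrePoly hs]
  have hcorr : laguerreCorrection b k n = -(2 ^ (-k) * n * ∑ j ∈ Finset.range n,
      tridiagonalKernel (fun j : ℕ => -(Complex.Gamma (2 * b + j + 2) / (j.factorial : ℂ))) n j *
        gammaFunctional (α + k) (laguerrePoly (2 * j) α * laguerrePoly (n * 2) α)) := by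
    rw [laguerreCorrection, sum_Icc_one_eq_sum_range_sub, Finset.mul_sum, ← Finset.sum_neg_distrib]
    refine Finset.sum_congr rfl fun j hj => ?_
    have hj' := Finset.mem_range.mp hj
    -- The inner sum is reversed, i = 2j - m, to match the expansion over m ≤ 2j; the sign is
    -- trivial because 2j + 2n is even.
    rw [show 2 * n - 2 * (n - j) = 2 * j by omega, gammaFunctional_mul_laguerrePoly _ _ hs
      (by omega), Even.neg_one_pow ⟨j + n, by ring⟩, one_mul, Finset.mul_sum, Finset.mul_sum,
      ← Finset.sum_neg_distrib, ← Nat.range_succ_eq_Icc_zero, ← Finset.sum_flip]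
    refine Finset.sum_congr rfl fun m hm => ?_
    have hm' : m ≤ 2 * j := by have := Finset.mem_range.mp hm; omega
    rw [mul_div_assoc, laguerreCorrection_term hb k hj' hm',
      show 2 * j - m + 2 * (n - j) = n * 2 - m by omega]
    ring
  rw [laguerreMoment_four_eq_average, havg, hmain, hcorr, Complex.cpow_sub _ _ two_ne_zero,
    Complex.cpow_one]
  ring

theorem differentiable_ringChoose (r : ℕ) : Differentiable ℂ fun k : ℂ => Ring.choose k r := by
  induction r with
  | zero => simp
  | succ r ih =>
    have h : (fun k : ℂ => Ring.choose k (r + 1)) =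
        fun k => k * Ring.choose (k - 1) r / ((r : ℂ) + 1) := by
      funext k
      rw [eq_div_iff (Nat.cast_add_one_ne_zero r), mul_comm, succ_mul_choose_succ]
    rw [h]
    have h2 : Differentiable ℂ fun k : ℂ => Ring.choose (k - 1) r :=
      ih.comp (differentiable_id.sub_const 1)
    exact (differentiable_id.mul h2).div_const _

theorem analyticAt_Gamma {s : ℂ} (hs : -1 < s.re) (hs0 : s ≠ 0) :
    AnalyticAt ℂ Complex.Gamma s := by
  rw [Complex.analyticAt_iff_eventually_differentiableAt]
  have h1 : ∀ᶠ z : ℂ in 𝓝 s, -1 < z.re :=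
    (isOpen_lt continuous_const Complex.continuous_re).mem_nhds hs
  filter_upwards [h1, isOpen_ne.mem_nhds hs0] with z hz hz0
  refine Complex.differentiableAt_Gamma z fun m h => ?_
  rcases m with _ | m
  · exact hz0 (by simpa using h)
  · rw [h] at hz
    simp at hz
    have : (0 : ℝ) ≤ m := Nat.cast_nonneg m
    linarith

theorem analyticOnNhd_laguerreContinuation (N : ℕ) :
    AnalyticOnNhd ℂ (laguerreContinuation N)
      {p | -2 < p.1.re ∧ -2 < p.1.re + p.2.re ∧ p.1 + p.2 ≠ -1} := by
  rintro p ⟨-, h2, h3⟩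
  have hch : ∀ r : ℕ, AnalyticAt ℂ (fun p : ℂ × ℂ => Ring.choose p.2 r) p := fun r =>
    AnalyticAt.comp (g := fun k : ℂ => Ring.choose k r) (f := Prod.snd)
      ((differentiable_ringChoose r).analyticAt _) analyticAt_snd
  have hG : ∀ m : ℕ, AnalyticAt ℂ (fun p : ℂ × ℂ => Complex.Gamma (p.1 + p.2 + m + 1)) p := by
    intro m
    refine AnalyticAt.comp (g := Complex.Gamma) (f := fun p : ℂ × ℂ => p.1 + p.2 + m + 1) ?_ ?_
    · refine analyticAt_Gamma ?_ (add_natCast_add_one_ne_zero (by simpa using h2) h3 m)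
      simp only [Complex.add_re, Complex.natCast_re, Complex.one_re]
      have : (0 : ℝ) ≤ m := Nat.cast_nonneg m
      linarith
    · exact ((analyticAt_fst.add analyticAt_snd).add analyticAt_const).add analyticAt_const
  -- 1/Γ is entire, so the normalizations produce no singularity; the poles come only from Γ(B + k +
  -- m + 1).
  have hI : ∀ l : ℕ, AnalyticAt ℂ (fun p : ℂ × ℂ => (Complex.Gamma (p.1 + l + 1))⁻¹) p := by
    intro l
    refine AnalyticAt.comp (g := fun s => (Complex.Gamma s)⁻¹)
      (f := fun p : ℂ × ℂ => p.1 + l + 1) (Complex.differentiable_one_div_Gamma.analyticAt _) ?_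
    exact (analyticAt_fst.add analyticAt_const).add analyticAt_const
  unfold laguerreContinuation
  refine Finset.analyticAt_fun_sum _ fun l _ => AnalyticAt.mul ?_ (analyticAt_const.mul (hI l))
  refine Finset.analyticAt_fun_sum _ fun m _ => ?_
  exact ((hch _).mul (hch _)).mul ((hG m).div analyticAt_const (by
    exact_mod_cast m.factorial_ne_zero))

theorem analyticAt_pfaffianSum {𝕜 E : Type*} [RCLike 𝕜] [NormedAddCommGroup E] [NormedSpace 𝕜 E]
    {n : ℕ} {A : E → Fin n → Matrix (Fin (n * 2)) (Fin (n * 2)) 𝕜} {s : E}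
    (h : ∀ i p q, AnalyticAt 𝕜 (fun s => A s i p q) s) :
    AnalyticAt 𝕜 (fun s => pfaffianSum (A s)) s := by
  unfold pfaffianSum
  exact Finset.analyticAt_fun_sum _ fun σ _ => analyticAt_const.mul
    (Finset.analyticAt_fun_prod _ fun i _ => h i _ _)

theorem analyticAt_momentFunctional {𝕜 E : Type*} [RCLike 𝕜] [NormedAddCommGroup E]
    [NormedSpace 𝕜 E] {c : E → ℕ → 𝕜} {s : E} (h : ∀ p, AnalyticAt 𝕜 (fun s => c s p) s)
    (P : 𝕜[X]) : AnalyticAt 𝕜 (fun s => momentFunctional (c s) P) s := by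
  have e : ∀ s, momentFunctional (c s) P =
      ∑ p ∈ Finset.range (P.natDegree + 1), P.coeff p * c s p := by
    intro s
    conv_lhs => rw [P.as_sum_range_C_mul_X_pow]
    simp only [map_sum, ← smul_eq_C_mul, map_smul, smul_eq_mul, momentFunctional_X_pow]
  simp only [e]
  exact Finset.analyticAt_fun_sum _ fun p _ => analyticAt_const.mul (h p)

/-- In monomials the moment is a quotient of Pfaffian sums in which s enters only through 2^{-s} and
Γ(2b + 1 + s + m + 1), with arguments of positive real part. Nothing is singular at 2b + s = -1. -/
theorem analyticAt_laguerreMoment_four {b : ℝ} {k : ℂ} (hb : -1 < b) (hk : -2 < 2 * b + k.re)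
    (n : ℕ) : AnalyticAt ℂ (fun s => laguerreMoment 4 b s n) k := by
  have hΛ := isMomentFunctional_gamma_one (a := 2 * b + 1) (by linarith)
  set T : Matrix (Fin (n * 2)) (Fin (n * 2)) ℂ := Matrix.of fun p q =>
    gammaFunctional (2 * b + 1 : ℝ) (X ^ (p : ℕ) * derivative (X ^ (q : ℕ))) with hT
  set U : ℂ → Matrix (Fin (n * 2)) (Fin (n * 2)) ℂ := fun s => Matrix.of fun p q =>
    gammaFunctional ((2 * b + 1 : ℝ) + s) (X ^ (p : ℕ) * derivative (X ^ (q : ℕ))) with hU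
  have hev : ∀ᶠ s : ℂ in 𝓝 k, -2 < 2 * b + s.re :=
    (isOpen_lt continuous_const (continuous_const.add Complex.continuous_re)).mem_nhds hk
  have heq : (fun s => (2 : ℂ) ^ (-s) *
      ((∑ i₀, pfaffianSum (Function.update (fun _ : Fin n => T) i₀ (U s))) /
        pfaffianSum (fun _ : Fin n => T))) =ᶠ[𝓝 k] fun s => laguerreMoment 4 b s n := by
    filter_upwards [hev] with s hs
    have hf := isMomentFunctional_gamma (a := 2 * b + 1) (k := s) (by linarith)
    rw [laguerreMoment_four_eq_average, (linearStatisticAverage_four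
      (w := fun x => x ^ (2 * b + 1) * Real.exp (-x)) hΛ hf (fun j => X ^ j)
      (fun j => natDegree_X_pow j) (fun j => pow_ne_zero j X_ne_zero) n).2.2]
  refine AnalyticAt.congr ?_ heq
  refine AnalyticAt.mul ?_ (AnalyticAt.div_const ?_)
  · have : Differentiable ℂ fun s : ℂ => (2 : ℂ) ^ (-s) := fun s =>
      (differentiableAt_id.neg).const_cpow (Or.inl two_ne_zero)
    exact this.analyticAt k
  · refine Finset.analyticAt_fun_sum _ fun i₀ _ => analyticAt_pfaffianSum fun i p q => ?_
    by_cases hi : i = i₀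
    · subst hi
      simp only [Function.update_self, hU, Matrix.of_apply]
      refine analyticAt_momentFunctional (fun m => ?_) _
      refine AnalyticAt.comp (g := Complex.Gamma)
        (f := fun s : ℂ => ((2 * b + 1 : ℝ) : ℂ) + s + m + 1) ?_ (by fun_prop)
      have hre : 0 < (((2 * b + 1 : ℝ) : ℂ) + k + m + 1).re := by
        simp only [Complex.add_re, Complex.ofReal_re, Complex.natCast_re, Complex.one_re]
        have : (0 : ℝ) ≤ m := Nat.cast_nonneg m
        linarith
      exact analyticAt_Gamma (by linarith) fun h => by rw [h] at hre; simp at hre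
    · simp only [Function.update_of_ne hi]
      exact analyticAt_const

/-- On a punctured neighbourhood of k the right-hand side equals the symplectic moment, which is
continuous at k; hence the poles of its two terms cancel. -/
theorem tendsto_laguerre_right_side {b : ℝ} {k : ℂ} (hb : -1 < b) (hk : 2 * (b : ℂ) + k = -1)
    {n : ℕ} (hn : 1 ≤ n) :
    Tendsto (fun s : ℂ => (2 : ℂ) ^ (-s - 1) * laguerreContinuation (2 * n) (2 * (b : ℂ), s) -
      laguerreCorrection b s n) (𝓝[≠] k) (𝓝 (laguerreMoment 4 b k n)) := by
  have hre : -2 < 2 * b + k.re := by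
    have := congrArg Complex.re hk
    simp at this
    linarith
  have hcont := (analyticAt_laguerreMoment_four hb hre n).continuousAt.tendsto.mono_left
    (nhdsWithin_le_nhds (s := {k}ᶜ))
  refine hcont.congr' ?_
  have hev : ∀ᶠ s : ℂ in 𝓝 k, -2 < 2 * b + s.re :=
    (isOpen_lt continuous_const (continuous_const.add Complex.continuous_re)).mem_nhds hre
  filter_upwards [hev.filter_mono nhdsWithin_le_nhds, self_mem_nhdsWithin] with s hs hsk
  exact laguerreMoment_four_eq hb hs (fun h => hsk (add_left_cancel (h.trans hk.symm))) hn

/-- The substitution x = nγ turns the Laguerre weight x^{2n} e^{-2x}, which is the case b = n - 1/2,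
into the weight of the inverse delay times and takes n^{-k} out of x^{-k}. -/
theorem delayMoment_four_eq {n k : ℕ} (hn : 1 ≤ n) :
    (delayMoment 4 k n : ℂ) =
      (n : ℂ) ^ ((k : ℤ) - 1) * laguerreMoment 4 ((n : ℝ) - 1 / 2) (-(k : ℂ)) n := by
  have hn0 : (0 : ℝ) < n := by exact_mod_cast hn
  have hnC : (n : ℂ) ≠ 0 := by exact_mod_cast hn0.ne'
  have h : laguerreMoment 4 ((n : ℝ) - 1 / 2) (-(k : ℂ)) n =
      ((n : ℂ) ^ k)⁻¹ * linearStatisticAverage 4 (Set.Ici 0)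
        (fun γ => γ ^ ((n : ℝ) * (4 : ℕ) / 2) * Real.exp (-((4 : ℕ) : ℝ) * n * γ / 2)) n
        (fun γ : ℝ => (((γ⁻¹) ^ k : ℝ) : ℂ)) := by
    rw [laguerreMoment, ← linearStatisticAverage_const_mul]
    refine linearStatisticAverage_scale (κ := (n : ℝ) ^ ((n : ℝ) * 4 / 2)) hn0
      (Real.rpow_pos_of_pos hn0 _).ne' (fun x hx => ?_) (fun x hx => ?_)
    · rw [laguerreWeight, show ((4 : ℕ) : ℝ) / 2 * ((n : ℝ) - 1 / 2 + 1) - 1 = n * 4 / 2 by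
        push_cast; ring, Real.mul_rpow hn0.le hx, show -((4 : ℕ) : ℝ) * (n * x) / 2 =
        -((4 : ℕ) : ℝ) * n * x / 2 by ring]
      push_cast
      ring
    · rw [Complex.cpow_neg, Complex.cpow_natCast]
      push_cast
      rw [mul_pow, mul_inv, inv_pow]
  rw [h, delayMoment, zpow_sub₀ hnC, zpow_natCast, zpow_one, Complex.ofReal_mul,
    linearStatisticAverage_ofReal]
  have := pow_ne_zero k hnC
  push_cast
  field_simp

end LaguerreMoments

/-! ### Jacobi polynomials on the unit interval -/

section Jacobi

/-- The functional with the moments of the beta density `x ^ B * (1 - x) ^ A` on `[0,1]`. -/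
def betaFunctional (A B : ℝ) : ℝ[X] →ₗ[ℝ] ℝ :=
  momentFunctional fun p => Real.Gamma (B + p + 1) * Real.Gamma (A + 1) / Real.Gamma (A + B + p + 2)

theorem betaFunctional_X_pow (A B : ℝ) (p : ℕ) : betaFunctional A B (X ^ p) =
    Real.Gamma (B + p + 1) * Real.Gamma (A + 1) / Real.Gamma (A + B + p + 2) := by
  rw [betaFunctional, momentFunctional_X_pow]

theorem betaFunctional_one (A B : ℝ) : betaFunctional A B 1 =
    Real.Gamma (B + 1) * Real.Gamma (A + 1) / Real.Gamma (A + B + 2) := by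
  simpa using betaFunctional_X_pow A B 0

theorem betaFunctional_X_mul (A B : ℝ) (P : ℝ[X]) :
    betaFunctional A B (X * P) = betaFunctional A (B + 1) P := by
  have : (betaFunctional A B).comp (LinearMap.mulLeft ℝ X) = betaFunctional A (B + 1) := by
    refine linearMap_ext_X_pow fun p => ?_
    rw [LinearMap.comp_apply, LinearMap.mulLeft_apply, ← pow_succ', betaFunctional_X_pow,
      betaFunctional_X_pow]
    push_cast
    rw [show B + ((p : ℝ) + 1) + 1 = B + 1 + p + 1 by ring,
      show A + B + ((p : ℝ) + 1) + 2 = A + (B + 1) + p + 2 by ring]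
  exact LinearMap.congr_fun this P

theorem betaFunctional_one_sub_mul {A B : ℝ} (hA : -1 < A) (hB : -1 < B) (P : ℝ[X]) :
    betaFunctional A B ((1 - X) * P) = betaFunctional (A + 1) B P := by
  have : (betaFunctional A B).comp (LinearMap.mulLeft ℝ (1 - X)) = betaFunctional (A + 1) B := by
    refine linearMap_ext_X_pow fun p => ?_
    have hp : (0 : ℝ) ≤ p := Nat.cast_nonneg p
    rw [LinearMap.comp_apply, LinearMap.mulLeft_apply, sub_mul, one_mul, ← pow_succ', map_sub,
      betaFunctional_X_pow, betaFunctional_X_pow, betaFunctional_X_pow,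
      show A + B + ((p + 1 : ℕ) : ℝ) + 2 = A + B + p + 2 + 1 by push_cast; ring,
      show B + ((p + 1 : ℕ) : ℝ) + 1 = B + p + 1 + 1 by push_cast; ring,
      show A + 1 + B + p + 2 = A + B + p + 2 + 1 by ring,
      Real.Gamma_add_one (s := A + B + p + 2) (by linarith),
      Real.Gamma_add_one (s := B + p + 1) (by linarith),
      Real.Gamma_add_one (s := A + 1) (by linarith)]
    have h1 : Real.Gamma (A + B + p + 2) ≠ 0 := (Real.Gamma_pos_of_pos (by linarith)).ne'
    have h2 : A + B + p + 2 ≠ 0 := by linarith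
    field_simp
    ring
  exact LinearMap.congr_fun this P

/-- The raising operator of Jacobi polynomials on `[0,1]`. -/
def jacobiRaise (A B : ℝ) (P : ℝ[X]) : ℝ[X] :=
  X * (1 - X) * derivative P + (C (B + 1) * (1 - X) - C (A + 1) * X) * P

/-- `jacobiRaise A B P` is the derivative of x^{B+1} (1 - x)^{A+1} P divided by x^B (1 - x)^A, so
the boundary terms being zero it integrates to zero. -/
theorem betaFunctional_raise {A B : ℝ} (hA : -1 < A) (hB : -1 < B) (P : ℝ[X]) :
    betaFunctional A B (jacobiRaise A B P) = 0 := by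
  set R : ℝ[X] →ₗ[ℝ] ℝ[X] := (LinearMap.mulLeft ℝ (X * (1 - X))).comp derivative +
    LinearMap.mulLeft ℝ (C (B + 1) * (1 - X) - C (A + 1) * X) with hR
  have : (betaFunctional A B).comp R = 0 := by
    refine linearMap_ext_X_pow fun p => ?_
    have hp : (0 : ℝ) ≤ p := Nat.cast_nonneg p
    have e : R (X ^ p) = (B + p + 1) • X ^ p - (A + B + p + 2) • X ^ (p + 1) := by
      simp only [hR, LinearMap.add_apply, LinearMap.comp_apply, LinearMap.mulLeft_apply,
        derivative_X_pow, smul_eq_C_mul, map_add, C_1, map_natCast]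
      rw [show (C 2 : ℝ[X]) = 2 by rfl]
      rcases p with _ | p
      · simp only [Nat.cast_zero, pow_zero]
        ring
      · simp only [Nat.add_sub_cancel]
        ring
    rw [LinearMap.comp_apply, e, map_sub, map_smul, map_smul, betaFunctional_X_pow,
      betaFunctional_X_pow, show A + B + ((p + 1 : ℕ) : ℝ) + 2 = A + B + p + 2 + 1 by
        push_cast; ring, show B + ((p + 1 : ℕ) : ℝ) + 1 = B + p + 1 + 1 by push_cast; ring,
      Real.Gamma_add_one (s := A + B + p + 2) (by linarith),
      Real.Gamma_add_one (s := B + p + 1) (by linarith)]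
    have h1 : Real.Gamma (A + B + p + 2) ≠ 0 := (Real.Gamma_pos_of_pos (by linarith)).ne'
    have h2 : A + B + p + 2 ≠ 0 := by linarith
    simp only [smul_eq_mul, LinearMap.zero_apply]
    field_simp
    ring
  exact LinearMap.congr_fun this P

/-- Jacobi polynomials on `[0,1]`, orthogonal with respect to `x ^ B * (1 - x) ^ A`. -/
def jacobiPoly : ℕ → ℝ → ℝ → ℝ[X]
  | 0, _, _ => 1
  | n + 1, A, B => C ((n + 1 : ℝ)⁻¹) * jacobiRaise A B (jacobiPoly n (A + 1) (B + 1))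

theorem C_mul_jacobiPoly_succ (n : ℕ) (A B : ℝ) :
    C (n + 1 : ℝ) * jacobiPoly (n + 1) A B = jacobiRaise A B (jacobiPoly n (A + 1) (B + 1)) := by
  rw [jacobiPoly, ← mul_assoc, ← C_mul, mul_inv_cancel₀ (Nat.cast_add_one_ne_zero n), C_1,
    one_mul]

theorem derivative_jacobiRaise (A B : ℝ) (P : ℝ[X]) :
    derivative (jacobiRaise A B P) =
      jacobiRaise (A + 1) (B + 1) (derivative P) - C (A + B + 2) * P := by
  simp only [jacobiRaise, derivative_mul, derivative_sub, derivative_X, derivative_C,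
    derivative_one, map_add, C_1]
  rw [show (C 2 : ℝ[X]) = 2 by rfl]
  ring

theorem jacobiRaise_C_mul (A B a : ℝ) (P : ℝ[X]) :
    jacobiRaise A B (C a * P) = C a * jacobiRaise A B P := by
  simp only [jacobiRaise, derivative_C_mul]
  ring

theorem derivative_jacobiPoly (n : ℕ) (A B : ℝ) :
    derivative (jacobiPoly (n + 1) A B) =
      C (-(n + A + B + 2)) * jacobiPoly n (A + 1) (B + 1) := by
  induction n generalizing A B with
  | zero =>
    simp only [jacobiPoly, jacobiRaise, derivative_mul, derivative_sub, derivative_X,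
      derivative_C, derivative_one, map_add, C_1, map_neg, Nat.cast_zero, C_0]
    rw [show (C 2 : ℝ[X]) = 2 by rfl]
    norm_num
    ring
  | succ n ih =>
    have h0 : (C ((n + 1 : ℕ) + 1 : ℝ) : ℝ[X]) ≠ 0 := C_ne_zero.mpr (Nat.cast_add_one_ne_zero _)
    refine mul_left_cancel₀ h0 ?_
    rw [← derivative_C_mul, C_mul_jacobiPoly_succ, derivative_jacobiRaise, ih,
      jacobiRaise_C_mul, ← C_mul_jacobiPoly_succ]
    push_cast
    simp only [map_add, map_neg, C_1]
    rw [show (C 2 : ℝ[X]) = 2 by rfl]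
    ring

/-- A derivative lowers the degree by one, raises both parameters and multiplies by -(degree + A + B
+ 1); the product of these factors is the quotient of Γ values. -/
theorem iterate_derivative_jacobiPoly {A B : ℝ} (hAB : 0 < A + B + 1) (m n : ℕ) :
    derivative^[m] (jacobiPoly (n + m) A B) =
      C ((-1) ^ m * (Real.Gamma (n + 2 * m + A + B + 1) / Real.Gamma (n + m + A + B + 1))) *
        jacobiPoly n (A + m) (B + m) := by
  induction m generalizing A B with
  | zero =>
    have : Real.Gamma (n + A + B + 1) ≠ 0 := (Real.Gamma_pos_of_pos (by
      have : (0 : ℝ) ≤ n := Nat.cast_nonneg n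
      linarith)).ne'
    simp [this]
  | succ m ih =>
    have hn : (0 : ℝ) ≤ n := Nat.cast_nonneg n
    have hm : (0 : ℝ) ≤ m := Nat.cast_nonneg m
    rw [Function.iterate_succ_apply, ← add_assoc, derivative_jacobiPoly, iterate_derivative_C_mul,
      ih (A := A + 1) (B := B + 1) (by linarith), ← mul_assoc, ← C_mul]
    push_cast
    rw [show A + 1 + (m : ℝ) = A + (m + 1) by ring, show B + 1 + (m : ℝ) = B + (m + 1) by ring,
      show (n : ℝ) + 2 * m + (A + 1) + (B + 1) + 1 = n + 2 * (m + 1) + A + B + 1 by ring,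
      show (n : ℝ) + m + (A + 1) + (B + 1) + 1 = (n + m + A + B + 2) + 1 by ring,
      show (n : ℝ) + (m + 1) + A + B + 1 = n + m + A + B + 2 by ring,
      Real.Gamma_add_one (s := n + m + A + B + 2) (by linarith)]
    have h1 : Real.Gamma (n + m + A + B + 2) ≠ 0 := (Real.Gamma_pos_of_pos (by linarith)).ne'
    have h2 : (n : ℝ) + m + A + B + 2 ≠ 0 := by linarith
    congr 2
    field_simp
    ring

theorem iterate_derivative_jacobiPoly_self {A B : ℝ} (hAB : 0 < A + B + 1) (n : ℕ) :
    derivative^[n] (jacobiPoly n A B) =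
      C ((-1) ^ n * (Real.Gamma (2 * n + A + B + 1) / Real.Gamma (n + A + B + 1))) := by
  have h := iterate_derivative_jacobiPoly hAB n 0
  rw [zero_add, jacobiPoly, mul_one] at h
  simpa using h

theorem jacobiPoly_iterate_coeff_ne_zero {A B : ℝ} (hAB : 0 < A + B + 1) (n : ℕ) :
    (-1) ^ n * (Real.Gamma (2 * n + A + B + 1) / Real.Gamma (n + A + B + 1)) ≠ 0 := by
  have hn : (0 : ℝ) ≤ n := Nat.cast_nonneg n
  exact mul_ne_zero (pow_ne_zero _ (by norm_num)) (div_ne_zero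
    (Real.Gamma_pos_of_pos (by linarith)).ne' (Real.Gamma_pos_of_pos (by linarith)).ne')

theorem natDegree_jacobiPoly_le (n : ℕ) (A B : ℝ) : (jacobiPoly n A B).natDegree ≤ n := by
  induction n generalizing A B with
  | zero => simp [jacobiPoly]
  | succ n ih =>
    rw [jacobiPoly]
    refine (natDegree_C_mul_le _ _).trans ?_
    rw [jacobiRaise]
    have h1X : (1 - X : ℝ[X]).natDegree ≤ 1 := by
      refine (natDegree_sub_le _ _).trans ?_
      simp
    rcases n with _ | n
    · simp only [jacobiPoly, derivative_one, mul_zero, mul_one, zero_add]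
      refine (natDegree_sub_le _ _).trans (max_le ?_ ?_)
      · exact (natDegree_C_mul_le _ _).trans h1X
      · exact (natDegree_C_mul_le _ _).trans natDegree_X_le
    · refine natDegree_add_le_of_degree_le ?_ ?_
      · refine natDegree_mul_le.trans ?_
        have h1 := natDegree_derivative_le (jacobiPoly (n + 1) (A + 1) (B + 1))
        have h2 := ih (A + 1) (B + 1)
        have h3 : (X * (1 - X) : ℝ[X]).natDegree ≤ 2 :=
          natDegree_mul_le.trans (add_le_add natDegree_X_le h1X)
        omega
      · refine natDegree_mul_le.trans ?_
        have := ih (A + 1) (B + 1)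
        have : (C (B + 1) * (1 - X) - C (A + 1) * X : ℝ[X]).natDegree ≤ 1 :=
          (natDegree_sub_le _ _).trans (max_le ((natDegree_C_mul_le _ _).trans h1X)
            ((natDegree_C_mul_le _ _).trans natDegree_X_le))
        omega

theorem natDegree_jacobiPoly {A B : ℝ} (hAB : 0 < A + B + 1) (n : ℕ) :
    (jacobiPoly n A B).natDegree = n := by
  refine le_antisymm (natDegree_jacobiPoly_le n A B) ?_
  by_contra h
  push Not at h
  have h1 := iterate_derivative_jacobiPoly_self hAB n
  rw [iterate_derivative_eq_zero h] at h1
  exact C_ne_zero.mpr (jacobiPoly_iterate_coeff_ne_zero hAB n) h1.symm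

theorem jacobiPoly_ne_zero {A B : ℝ} (hAB : 0 < A + B + 1) (n : ℕ) : jacobiPoly n A B ≠ 0 := by
  intro h
  have h1 := iterate_derivative_jacobiPoly_self hAB n
  rw [h, iterate_derivative_zero] at h1
  exact C_ne_zero.mpr (jacobiPoly_iterate_coeff_ne_zero hAB n) h1.symm

/-- Rodrigues' formula: every integration by parts leaves a factor x(1 - x), absorbed by raising
both exponents. -/
theorem betaFunctional_jacobiPoly_mul {A B : ℝ} (hA : -1 < A) (hB : -1 < B) (n : ℕ)
    (Q : ℝ[X]) : betaFunctional A B (jacobiPoly n A B * Q) =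
      (-1) ^ n / (n.factorial : ℝ) * betaFunctional (A + n) (B + n) (derivative^[n] Q) := by
  induction n generalizing A B Q with
  | zero => simp [jacobiPoly]
  | succ n ih =>
    have h1 : C (n + 1 : ℝ) * (jacobiPoly (n + 1) A B * Q) =
        jacobiRaise A B (jacobiPoly n (A + 1) (B + 1) * Q) -
          (1 - X) * (X * (jacobiPoly n (A + 1) (B + 1) * derivative Q)) := by
      rw [← mul_assoc, C_mul_jacobiPoly_succ]
      simp only [jacobiRaise, derivative_mul]
      ring
    have h2 := congrArg (betaFunctional A B) h1
    rw [← smul_eq_C_mul, map_smul, map_sub, betaFunctional_raise hA hB,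
      betaFunctional_one_sub_mul hA hB, betaFunctional_X_mul,
      ih (by linarith) (by linarith), smul_eq_mul] at h2
    have h3 : (n + 1 : ℝ) ≠ 0 := Nat.cast_add_one_ne_zero n
    have h4 : (n.factorial : ℝ) ≠ 0 := Nat.cast_ne_zero.mpr n.factorial_ne_zero
    rw [Nat.factorial_succ, Function.iterate_succ_apply]
    push_cast
    rw [show A + (n + 1 : ℝ) = A + 1 + n by ring, show B + (n + 1 : ℝ) = B + 1 + n by ring]
    refine mul_left_cancel₀ h3 (h2.trans ?_)
    field_simp
    ring

theorem betaFunctional_jacobiPoly_mul_eq_zero {A B : ℝ} (hA : -1 < A) (hB : -1 < B) {n : ℕ}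
    {Q : ℝ[X]} (hQ : Q.natDegree < n) : betaFunctional A B (jacobiPoly n A B * Q) = 0 := by
  rw [betaFunctional_jacobiPoly_mul hA hB, iterate_derivative_eq_zero hQ, map_zero, mul_zero]

theorem betaFunctional_orthogonal {A B : ℝ} (hA : -1 < A) (hB : 0 ≤ B) {i j : ℕ} (h : i ≠ j) :
    betaFunctional A B (jacobiPoly i A B * jacobiPoly j A B) = 0 := by
  have key : ∀ i j, j < i → betaFunctional A B (jacobiPoly i A B * jacobiPoly j A B) = 0 := by
    intro i j hij
    refine betaFunctional_jacobiPoly_mul_eq_zero hA (by linarith) ?_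
    rwa [natDegree_jacobiPoly (by linarith)]
  rcases lt_or_gt_of_ne h with h | h
  · rw [mul_comm, key _ _ h]
  · exact key _ _ h

/-- The squared norms of Jacobi polynomials. -/
def jacobiNorm (A B : ℝ) (n : ℕ) : ℝ :=
  Real.Gamma (B + n + 1) * Real.Gamma (A + n + 1) /
    (n.factorial * Real.Gamma (A + B + n + 1) * (A + B + 2 * n + 1))

theorem jacobiNorm_pos {A B : ℝ} (hA : -1 < A) (hB : 0 ≤ B) (n : ℕ) : 0 < jacobiNorm A B n := by
  have hn : (0 : ℝ) ≤ n := Nat.cast_nonneg n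
  have h1 : 0 < Real.Gamma (B + n + 1) := Real.Gamma_pos_of_pos (by linarith)
  have h2 : 0 < Real.Gamma (A + n + 1) := Real.Gamma_pos_of_pos (by linarith)
  have h3 : 0 < Real.Gamma (A + B + n + 1) := Real.Gamma_pos_of_pos (by linarith)
  have h4 : 0 < A + B + 2 * n + 1 := by linarith
  have h5 : (0 : ℝ) < n.factorial := Nat.cast_pos.mpr n.factorial_pos
  unfold jacobiNorm
  positivity

theorem betaFunctional_norm {A B : ℝ} (hA : -1 < A) (hB : 0 ≤ B) (n : ℕ) :
    betaFunctional A B (jacobiPoly n A B * jacobiPoly n A B) = jacobiNorm A B n := by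
  have hn : (0 : ℝ) ≤ n := Nat.cast_nonneg n
  have e : ∀ c : ℝ, (C c : ℝ[X]) = c • 1 := fun c => by rw [smul_eq_C_mul, mul_one]
  rw [betaFunctional_jacobiPoly_mul hA (by linarith),
    iterate_derivative_jacobiPoly_self (by linarith), e, map_smul, betaFunctional_one, smul_eq_mul,
    jacobiNorm, show A + n + (B + n) + 2 = (A + B + 2 * n + 1) + 1 by ring,
    Real.Gamma_add_one (s := A + B + 2 * n + 1) (by linarith),
    show 2 * (n : ℝ) + A + B + 1 = A + B + 2 * n + 1 by ring,
    show (n : ℝ) + A + B + 1 = A + B + n + 1 by ring]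
  have h1 : Real.Gamma (A + B + 2 * n + 1) ≠ 0 := (Real.Gamma_pos_of_pos (by linarith)).ne'
  have h2 : ((-1 : ℝ) ^ n) * (-1) ^ n = 1 := by rw [← mul_pow]; norm_num
  have h3 : Real.Gamma (A + B + n + 1) ≠ 0 := (Real.Gamma_pos_of_pos (by linarith)).ne'
  have h4 : A + B + 2 * n + 1 ≠ 0 := by linarith
  have h5 : (n.factorial : ℝ) ≠ 0 := Nat.cast_ne_zero.mpr n.factorial_ne_zero
  field_simp
  linear_combination Real.Gamma (A + n + 1) * h2

/-- Raising with B instead of B + k costs the term k(1 - x). The induction passes from (A, B, k) to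
(A + 1, B + 1, k - 1), keeping B + k and building the binomial coefficient. -/
theorem betaFunctional_jacobiPoly {A B : ℝ} (hA : -1 < A) (hB : 0 ≤ B) (k r : ℕ) :
    betaFunctional A (B + k) (jacobiPoly r A B) =
      (-1) ^ r * (k.choose r : ℝ) * betaFunctional (A + r) (B + k) 1 := by
  induction r generalizing A B k with
  | zero => simp [jacobiPoly]
  | succ r ih =>
    have h3 : (r + 1 : ℝ) ≠ 0 := Nat.cast_add_one_ne_zero r
    have hk : (0 : ℝ) ≤ k := Nat.cast_nonneg k
    refine mul_left_cancel₀ h3 ?_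
    have h1 : C (r + 1 : ℝ) * jacobiPoly (r + 1) A B =
        jacobiRaise A (B + k) (jacobiPoly r (A + 1) (B + 1)) -
          C (k : ℝ) * ((1 - X) * jacobiPoly r (A + 1) (B + 1)) := by
      rw [C_mul_jacobiPoly_succ]
      simp only [jacobiRaise, map_add, C_1]
      ring
    have h2 := congrArg (betaFunctional A (B + k)) h1
    rw [← smul_eq_C_mul, map_smul, map_sub, betaFunctional_raise hA (by linarith),
      ← smul_eq_C_mul, map_smul, betaFunctional_one_sub_mul hA (by linarith), smul_eq_mul,
      smul_eq_mul] at h2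
    rw [h2]
    -- For k = 0 the remaining term has the factor k, and the binomial coefficient on the right
    -- vanishes too.
    rcases k with _ | k
    · simp
    · have h4 := ih (A := A + 1) (B := B + 1) (by linarith) (by linarith) k
      push_cast
      rw [show B + ((k : ℝ) + 1) = B + 1 + k by ring, h4,
        show A + ((r : ℝ) + 1) = A + 1 + r by ring]
      have h5 : ((k + 1 : ℕ) * k.choose r : ℝ) = ((k + 1).choose (r + 1) : ℝ) * (r + 1 : ℕ) := by
        exact_mod_cast Nat.add_one_mul_choose_eq k r
      push_cast at h5
      linear_combination (-(-1) ^ r * betaFunctional (A + 1 + r) (B + 1 + k) 1) * h5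

/-- As for Laguerre polynomials: m integrations by parts on the polynomial of parameters (A, B + k),
then `betaFunctional_jacobiPoly` for the m-th derivative of the other one. -/
theorem betaFunctional_connection {A B : ℝ} (hA : -1 < A) (hB : 0 ≤ B) (k : ℕ) {m n : ℕ}
    (hmn : m ≤ n) :
    betaFunctional A (B + k) (jacobiPoly n A B * jacobiPoly m A (B + k)) =
      (-1) ^ (n - m) * (k.choose (n - m) : ℝ) *
        (Real.Gamma (A + B + n + m + 1) / (Real.Gamma (A + B + n + 1) * m.factorial) *
          (Real.Gamma (A + n + 1) * Real.Gamma (B + k + m + 1) /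
            Real.Gamma (A + B + k + n + m + 2))) := by
  obtain ⟨r, rfl⟩ := Nat.exists_eq_add_of_le' hmn
  have hk : (0 : ℝ) ≤ k := Nat.cast_nonneg k
  have hm : (0 : ℝ) ≤ m := Nat.cast_nonneg m
  rw [mul_comm, betaFunctional_jacobiPoly_mul hA (by linarith),
    iterate_derivative_jacobiPoly (by linarith), ← smul_eq_C_mul, map_smul,
    show B + k + (m : ℝ) = B + m + k by ring,
    betaFunctional_jacobiPoly (by linarith) (by linarith), Nat.add_sub_cancel, smul_eq_mul,
    betaFunctional_one]
  push_cast
  rw [show (r : ℝ) + 2 * m + A + B + 1 = A + B + (r + m) + m + 1 by ring,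
    show (r : ℝ) + m + A + B + 1 = A + B + (r + m) + 1 by ring,
    show A + m + r + (B + m + k) + 2 = A + B + k + (r + m) + m + 2 by ring,
    show A + (m : ℝ) + r + 1 = A + (r + m) + 1 by ring]
  have : ((-1 : ℝ) ^ m) * (-1) ^ m = 1 := by rw [← mul_pow]; norm_num
  generalize Real.Gamma (A + B + (r + m) + m + 1) = G1
  generalize Real.Gamma (A + B + (r + m) + 1) = G2
  generalize Real.Gamma (A + B + k + (r + m) + m + 2) = G3
  generalize Real.Gamma (A + (r + m) + 1) = G4
  generalize Real.Gamma (B + m + k + 1) = G5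
  simp only [div_eq_mul_inv, mul_inv]
  linear_combination (-1) ^ r * (k.choose r : ℝ) * G1 * G2⁻¹ * G3⁻¹ * G4 * G5 *
    (m.factorial : ℝ)⁻¹ * this

/-- The coefficients in the expansion of `betaFunctional A (B + k)` on products of Jacobi
polynomials, up to binomial coefficients. -/
def jacobiProductCoeff (A B : ℝ) (k p q m : ℕ) : ℝ :=
  Real.Gamma (A + B + p + m + 1) * Real.Gamma (A + B + q + m + 1) * Real.Gamma (A + p + 1) *
    Real.Gamma (A + q + 1) * Real.Gamma (B + k + m + 1) * Real.Gamma (A + B + k + m + 1) *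
    (A + B + k + 2 * m + 1) /
  (Real.Gamma (A + B + p + 1) * Real.Gamma (A + B + q + 1) * m.factorial *
    Real.Gamma (A + B + k + p + m + 2) * Real.Gamma (A + B + k + q + m + 2) *
    Real.Gamma (A + m + 1))

theorem betaFunctional_connection_mul {A B : ℝ} (hA : -1 < A) (hB : 0 ≤ B) (k : ℕ) {m p q : ℕ}
    (hmp : m ≤ p) (hmq : m ≤ q) :
    betaFunctional A (B + k) (jacobiPoly p A B * jacobiPoly m A (B + k)) *
        betaFunctional A (B + k) (jacobiPoly q A B * jacobiPoly m A (B + k)) /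
        jacobiNorm A (B + k) m =
      (-1) ^ (p + q) * ((k.choose (p - m) : ℝ) * k.choose (q - m) *
        jacobiProductCoeff A B k p q m) := by
  have hk : (0 : ℝ) ≤ k := Nat.cast_nonneg k
  have hm : (0 : ℝ) ≤ m := Nat.cast_nonneg m
  rw [betaFunctional_connection hA hB k hmp, betaFunctional_connection hA hB k hmq,
    jacobiNorm, jacobiProductCoeff]
  have hsign : (-1 : ℝ) ^ (p - m) * (-1) ^ (q - m) = (-1) ^ (p + q) := by
    have h2 : (-1 : ℝ) ^ (2 * m) = 1 := by rw [pow_mul]; norm_num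
    rw [show p + q = (p - m + (q - m)) + 2 * m by omega, pow_add _ (p - m + (q - m)), h2, mul_one,
      pow_add]
  rw [← hsign, show A + (B + k) + m + 1 = A + B + k + m + 1 by ring,
    show A + (B + k) + 2 * m + 1 = A + B + k + 2 * m + 1 by ring]
  have h1 : Real.Gamma (B + k + m + 1) ≠ 0 := (Real.Gamma_pos_of_pos (by linarith)).ne'
  have h2 : (m.factorial : ℝ) ≠ 0 := Nat.cast_ne_zero.mpr m.factorial_ne_zero
  generalize Real.Gamma (A + B + p + m + 1) = a₁
  generalize Real.Gamma (A + B + q + m + 1) = a₂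
  generalize Real.Gamma (A + p + 1) = a₃
  generalize Real.Gamma (A + q + 1) = a₄
  generalize Real.Gamma (B + k + m + 1) = b at h1 ⊢
  generalize Real.Gamma (A + B + k + m + 1) = c₁
  generalize A + B + k + 2 * m + 1 = c₂
  generalize Real.Gamma (A + B + p + 1) = d₁
  generalize Real.Gamma (A + B + q + 1) = d₂
  generalize Real.Gamma (A + B + k + p + m + 2) = e₁
  generalize Real.Gamma (A + B + k + q + m + 2) = e₂
  generalize Real.Gamma (A + m + 1) = g
  generalize (m.factorial : ℝ) = f at h2 ⊢
  generalize (k.choose (p - m) : ℝ) = x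
  generalize (k.choose (q - m) : ℝ) = y
  generalize (-1 : ℝ) ^ (p - m) = s
  generalize (-1 : ℝ) ^ (q - m) = t
  have hb : b * b * b⁻¹ = b := by rw [mul_assoc, mul_inv_cancel₀ h1, mul_one]
  have hf : f⁻¹ * f⁻¹ * f = f⁻¹ := by rw [mul_assoc, inv_mul_cancel₀ h2, mul_one]
  simp only [div_eq_mul_inv, mul_inv, inv_inv]
  linear_combination
    (s * t * x * y * a₁ * a₂ * a₃ * a₄ * c₁ * c₂ * d₁⁻¹ * d₂⁻¹ * e₁⁻¹ * e₂⁻¹ * g⁻¹) *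
      ((f⁻¹ * f⁻¹ * f) * hb + b * hf)

/-- Parseval's identity in the polynomials of parameters (A, B + k), with
`betaFunctional_connection_mul` evaluating each summand. -/
theorem betaFunctional_mul_jacobiPoly {A B : ℝ} (hA : -1 < A) (hB : 0 ≤ B) (k : ℕ) {p q : ℕ}
    (hpq : p ≤ q) :
    betaFunctional A (B + k) (jacobiPoly p A B * jacobiPoly q A B) =
      (-1) ^ (p + q) * ∑ m ∈ Finset.range (p + 1), (k.choose (p - m) : ℝ) * k.choose (q - m) *
        jacobiProductCoeff A B k p q m := by
  have hk : (0 : ℝ) ≤ k := Nat.cast_nonneg k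
  have hB' : 0 ≤ B + k := by linarith
  rw [orthogonal_parseval (betaFunctional A (B + k)) (fun j => jacobiPoly j A (B + k))
    (fun j => natDegree_jacobiPoly (by linarith) _) (fun j => jacobiPoly_ne_zero (by linarith) _)
    (fun i j h => betaFunctional_orthogonal hA hB' h)
    (fun j => by rw [betaFunctional_norm hA hB']; exact (jacobiNorm_pos hA hB' j).ne') _ _ (p + 1)
    (by rw [natDegree_jacobiPoly (by linarith)]; omega), Finset.mul_sum]
  refine Finset.sum_congr rfl fun m hm => ?_
  have hm' : m ≤ p := by have := Finset.mem_range.mp hm; omega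
  rw [betaFunctional_norm hA hB', betaFunctional_connection_mul hA hB k hm' (hm'.trans hpq)]

/-- Twice the image of a Jacobi polynomial under the skew-symmetric first order operator. -/
def jacobiSkew (A B : ℝ) (j : ℕ) : ℝ[X] :=
  2 * (X * (1 - X) * derivative (jacobiPoly j A B)) +
    (C (B + 1) * (1 - X) - C (A + 1) * X) * jacobiPoly j A B

/-- The factor x(1 - x) by which the two weights differ allows an integration by parts: x(1 - x)(PQ'
- P'Q) is P times the skew operator applied to Q, plus k(1 - x)PQ, minus a term that integrates to
zero. -/
theorem wronskianPairing_betaFunctional {A B : ℝ} (hA : -1 < A) (hB : 0 ≤ B) (k i j : ℕ) :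
    wronskianPairing (betaFunctional (A + 1) (B + 1 + k)) (jacobiPoly i A B) (jacobiPoly j A B) =
      betaFunctional A (B + k) (jacobiPoly i A B * jacobiSkew A B j) +
        k * betaFunctional A (B + k) ((1 - X) * (jacobiPoly i A B * jacobiPoly j A B)) := by
  have hk : (0 : ℝ) ≤ k := Nat.cast_nonneg k
  have e : (1 - X) * (X * (jacobiPoly i A B * derivative (jacobiPoly j A B) -
      derivative (jacobiPoly i A B) * jacobiPoly j A B)) =
      jacobiPoly i A B * jacobiSkew A B j +
        C (k : ℝ) * ((1 - X) * (jacobiPoly i A B * jacobiPoly j A B)) -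
      jacobiRaise A (B + k) (jacobiPoly i A B * jacobiPoly j A B) := by
    simp only [jacobiRaise, jacobiSkew, derivative_mul, map_add, C_1]
    ring
  rw [wronskianPairing, show B + 1 + (k : ℝ) = B + k + 1 by ring, ← betaFunctional_X_mul,
    ← betaFunctional_one_sub_mul hA (by linarith), e, map_sub, map_add,
    betaFunctional_raise hA (by linarith), sub_zero, ← smul_eq_C_mul (k : ℝ), map_smul,
    smul_eq_mul]

theorem wronskianPairing_betaFunctional_zero {A B : ℝ} (hA : -1 < A) (hB : 0 ≤ B) (i j : ℕ) :
    wronskianPairing (betaFunctional (A + 1) (B + 1)) (jacobiPoly i A B) (jacobiPoly j A B) =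
      betaFunctional A B (jacobiPoly i A B * jacobiSkew A B j) := by
  have := wronskianPairing_betaFunctional hA hB 0 i j
  simpa using this

theorem natDegree_jacobiSkew_le (A B : ℝ) (j : ℕ) : (jacobiSkew A B j).natDegree ≤ j + 1 := by
  have h1X : (1 - X : ℝ[X]).natDegree ≤ 1 := by
    refine (natDegree_sub_le _ _).trans ?_
    simp
  have h0 := natDegree_jacobiPoly_le j A B
  rw [jacobiSkew]
  refine natDegree_add_le_of_degree_le ?_ ?_
  · rcases j with _ | j
    · simp [jacobiPoly]
    · have h1 := natDegree_derivative_le (jacobiPoly (j + 1) A B)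
      have h3 : (X * (1 - X) : ℝ[X]).natDegree ≤ 2 :=
        natDegree_mul_le.trans (add_le_add natDegree_X_le h1X)
      have h4 : (X * (1 - X) * derivative (jacobiPoly (j + 1) A B)).natDegree ≤ _ :=
        natDegree_mul_le
      have h5 := natDegree_C_mul_le (2 : ℝ) (X * (1 - X) * derivative (jacobiPoly (j + 1) A B))
      rw [show (C 2 : ℝ[X]) = 2 by rfl] at h5
      omega
  · refine natDegree_mul_le.trans ?_
    have : (C (B + 1) * (1 - X) - C (A + 1) * X : ℝ[X]).natDegree ≤ 1 :=
      (natDegree_sub_le _ _).trans (max_le ((natDegree_C_mul_le _ _).trans h1X)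
        ((natDegree_C_mul_le _ _).trans natDegree_X_le))
    omega

theorem coeff_jacobiPoly_self {A B : ℝ} (hAB : 0 < A + B + 1) (j : ℕ) :
    (j.factorial : ℝ) * (jacobiPoly j A B).coeff j =
      (-1) ^ j * (Real.Gamma (A + B + 2 * j + 1) / Real.Gamma (A + B + j + 1)) := by
  have h := congrArg (fun P => coeff P 0) (iterate_derivative_jacobiPoly_self hAB j)
  simp only [coeff_C_zero, coeff_iterate_derivative, zero_add, Nat.descFactorial_self,
    nsmul_eq_mul] at h
  rw [h, show 2 * (j : ℝ) + A + B + 1 = A + B + 2 * j + 1 by ring,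
    show (j : ℝ) + A + B + 1 = A + B + j + 1 by ring]

theorem coeff_jacobiSkew (A B : ℝ) (j : ℕ) :
    (jacobiSkew A B j).coeff (j + 1) = -(A + B + 2 * j + 2) * (jacobiPoly j A B).coeff j := by
  have h0 : (jacobiPoly j A B).coeff (j + 1) = 0 :=
    coeff_eq_zero_of_natDegree_lt (Nat.lt_succ_of_le (natDegree_jacobiPoly_le j A B))
  have h00 : (jacobiPoly j A B).coeff (j + 1 + 1) = 0 :=
    coeff_eq_zero_of_natDegree_lt (by have := natDegree_jacobiPoly_le j A B; omega)
  have e : jacobiSkew A B j = C 2 * (X * derivative (jacobiPoly j A B)) -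
      C 2 * (X * (X * derivative (jacobiPoly j A B))) + C (B + 1) * jacobiPoly j A B -
      C (A + B + 2) * (X * jacobiPoly j A B) := by
    simp only [jacobiSkew, map_add, C_1]
    rw [show (C 2 : ℝ[X]) = 2 by rfl]
    ring
  rw [e]
  simp only [coeff_sub, coeff_add, coeff_C_mul, coeff_X_mul, coeff_derivative, h0]
  rcases j with _ | j
  · simp
    ring
  · simp only [coeff_X_mul, coeff_derivative]
    push_cast
    ring

/-- The nearest neighbour skew products of Jacobi polynomials. -/
def jacobiTau (A B : ℝ) (j : ℕ) : ℝ :=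
  Real.Gamma (A + j + 2) * Real.Gamma (B + j + 2) /
    (j.factorial * Real.Gamma (A + B + j + 1) * (A + B + 2 * j + 1) * (A + B + 2 * j + 3))

theorem jacobiTau_pos {A B : ℝ} (hA : -1 < A) (hB : 0 ≤ B) (j : ℕ) : 0 < jacobiTau A B j := by
  have hj : (0 : ℝ) ≤ j := Nat.cast_nonneg j
  have h1 : 0 < Real.Gamma (B + j + 2) := Real.Gamma_pos_of_pos (by linarith)
  have h2 : 0 < Real.Gamma (A + j + 2) := Real.Gamma_pos_of_pos (by linarith)
  have h3 : 0 < Real.Gamma (A + B + j + 1) := Real.Gamma_pos_of_pos (by linarith)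
  have h4 : 0 < A + B + 2 * j + 1 := by linarith
  have h6 : 0 < A + B + 2 * j + 3 := by linarith
  have h5 : (0 : ℝ) < j.factorial := Nat.cast_pos.mpr j.factorial_pos
  unfold jacobiTau
  positivity

/-- The skew operator raises degrees by at most one; antisymmetry lets it act on the polynomial of
smaller index, and orthogonality to lower degrees concludes. -/
theorem wronskianPairing_jacobiPoly_of_lt {A B : ℝ} (hA : -1 < A) (hB : 0 ≤ B) {i j : ℕ}
    (h : i + 1 < j) : wronskianPairing (betaFunctional (A + 1) (B + 1)) (jacobiPoly i A B)
      (jacobiPoly j A B) = 0 := by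
  rw [wronskianPairing_antisymm, wronskianPairing_betaFunctional_zero hA hB,
    betaFunctional_jacobiPoly_mul_eq_zero hA (by linarith)
      ((natDegree_jacobiSkew_le A B i).trans_lt h), neg_zero]

/-- After j + 1 integrations by parts only the leading coefficient of `jacobiSkew A B j` is left. -/
theorem wronskianPairing_jacobiPoly_succ {A B : ℝ} (hA : -1 < A) (hB : 0 ≤ B) (j : ℕ) :
    wronskianPairing (betaFunctional (A + 1) (B + 1)) (jacobiPoly (j + 1) A B)
      (jacobiPoly j A B) = jacobiTau A B j := by
  have hj : (0 : ℝ) ≤ j := Nat.cast_nonneg j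
  have hD : derivative^[j + 1] (jacobiSkew A B j) =
      C (((j + 1).factorial : ℝ) * (jacobiSkew A B j).coeff (j + 1)) := by
    have hdeg : (derivative^[j + 1] (jacobiSkew A B j)).natDegree ≤ 0 := by
      refine (natDegree_iterate_derivative _ _).trans ?_
      have := natDegree_jacobiSkew_le A B j
      omega
    rw [eq_C_of_natDegree_le_zero hdeg, coeff_iterate_derivative, zero_add,
      Nat.descFactorial_self, nsmul_eq_mul]
  have e : ∀ c : ℝ, (C c : ℝ[X]) = c • 1 := fun c => by rw [smul_eq_C_mul, mul_one]
  have hc := coeff_jacobiPoly_self (A := A) (B := B) (by linarith) j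
  rw [wronskianPairing_betaFunctional_zero hA hB, betaFunctional_jacobiPoly_mul hA (by linarith),
    hD, e, map_smul, betaFunctional_one, coeff_jacobiSkew, smul_eq_mul, jacobiTau]
  push_cast
  have h5 : (j.factorial : ℝ) ≠ 0 := Nat.cast_ne_zero.mpr j.factorial_ne_zero
  have h6 : ((j + 1).factorial : ℝ) ≠ 0 := Nat.cast_ne_zero.mpr (j + 1).factorial_ne_zero
  have hc' : (jacobiPoly j A B).coeff j = (-1) ^ j * (Real.Gamma (A + B + 2 * j + 1) /
      Real.Gamma (A + B + j + 1)) / j.factorial := by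
    rw [eq_div_iff h5, mul_comm, hc]
  rw [hc', show A + ((j : ℝ) + 1) + (B + (j + 1)) + 2 = (A + B + 2 * j + 1) + 1 + 1 + 1 by ring,
    Real.Gamma_add_one (s := A + B + 2 * j + 1 + 1 + 1) (by linarith),
    Real.Gamma_add_one (s := A + B + 2 * j + 1 + 1) (by linarith),
    Real.Gamma_add_one (s := A + B + 2 * j + 1) (by linarith),
    show A + ((j : ℝ) + 1) + 1 = A + j + 2 by ring,
    show B + ((j : ℝ) + 1) + 1 = B + j + 2 by ring]
  have h1 : Real.Gamma (A + B + 2 * j + 1) ≠ 0 := (Real.Gamma_pos_of_pos (by linarith)).ne'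
  have h2 : ((-1 : ℝ) ^ j) * (-1) ^ j = 1 := by rw [← mul_pow]; norm_num
  have h3 : Real.Gamma (A + B + j + 1) ≠ 0 := (Real.Gamma_pos_of_pos (by linarith)).ne'
  have h4 : A + B + 2 * j + 1 ≠ 0 := by linarith
  have h7 : A + B + 2 * j + 1 + 1 ≠ 0 := by linarith
  have h8 : A + B + 2 * j + 1 + 1 + 1 ≠ 0 := by linarith
  have h9 : A + B + 2 * j + 3 ≠ 0 := by linarith
  rw [show A + B + 2 * (j : ℝ) + 3 = A + B + 2 * j + 1 + 1 + 1 by ring,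
    show -(A + B + 2 * (j : ℝ) + 2) = -(A + B + 2 * j + 1 + 1) by ring, pow_succ]
  generalize Real.Gamma (A + B + 2 * j + 1) = G₁ at h1 ⊢
  generalize Real.Gamma (A + B + j + 1) = G₂ at h3 ⊢
  generalize Real.Gamma (A + j + 2) = G₃
  generalize Real.Gamma (B + j + 2) = G₄
  generalize A + B + 2 * (j : ℝ) + 1 = Y at h4 h7 h8 ⊢
  generalize ((-1 : ℝ) ^ j) = s at h2 ⊢
  field_simp
  linear_combination G₄ * G₃ * h2

theorem wronskianPairing_jacobiPoly_next {A B : ℝ} (hA : -1 < A) (hB : 0 ≤ B) (j : ℕ) :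
    wronskianPairing (betaFunctional (A + 1) (B + 1)) (jacobiPoly j A B)
      (jacobiPoly (j + 1) A B) = -jacobiTau A B j := by
  rw [wronskianPairing_antisymm, wronskianPairing_jacobiPoly_succ hA hB]

/-- `jacobiSkew A B j` has degree at most j + 1 ≤ N, so it expands in the orthogonal polynomials of
index at most N; its coefficients are the unshifted Wronskian pairings over the squared norms. -/
theorem jacobi_wronskian_expansion {A B : ℝ} (hA : -1 < A) (hB : 0 ≤ B) (k : ℕ) {N i j : ℕ}
    (hj : j < N) :
    wronskianPairing (betaFunctional (A + 1) (B + 1 + k)) (jacobiPoly i A B) (jacobiPoly j A B) =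
      ∑ l ∈ Finset.range (N + 1), betaFunctional A (B + k) (jacobiPoly i A B * jacobiPoly l A B) *
        (jacobiNorm A B l)⁻¹ *
        wronskianPairing (betaFunctional (A + 1) (B + 1)) (jacobiPoly l A B) (jacobiPoly j A B) +
      k * betaFunctional A (B + k) ((1 - X) * (jacobiPoly i A B * jacobiPoly j A B)) := by
  have hexp := orthogonal_expansion (betaFunctional A B) (fun j => jacobiPoly j A B)
    (fun j => natDegree_jacobiPoly (by linarith) _) (fun j => jacobiPoly_ne_zero (by linarith) _)
    (fun i j h => betaFunctional_orthogonal hA hB h)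
    (fun j => by rw [betaFunctional_norm hA hB]; exact (jacobiNorm_pos hA hB j).ne')
    (jacobiSkew A B j) (N + 1) ((natDegree_jacobiSkew_le A B j).trans_lt (by omega))
  rw [wronskianPairing_betaFunctional hA hB]
  congr 1
  conv_lhs => rw [hexp]
  rw [Finset.mul_sum, map_sum]
  refine Finset.sum_congr rfl fun l _ => ?_
  rw [mul_left_comm, ← smul_eq_C_mul, map_smul, smul_eq_mul, betaFunctional_norm hA hB,
    wronskianPairing_betaFunctional_zero hA hB, mul_comm (jacobiSkew A B j)]
  ring

end Jacobi

/-! ### Beta integrals and averages over Jacobi ensembles -/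

section JacobiEnsemble

theorem integral_rpow_mul_one_sub_rpow {a b : ℝ} (ha : -1 < a) (hb : -1 < b) :
    IntegrableOn (fun x : ℝ => x ^ b * (1 - x) ^ a) (Set.Ioo 0 1) ∧
    ∫ x in Set.Ioo (0 : ℝ) 1, x ^ b * (1 - x) ^ a =
      Real.Gamma (b + 1) * Real.Gamma (a + 1) / Real.Gamma (a + b + 2) := by
  have h1 : 0 < ((b + 1 : ℝ) : ℂ).re := by rw [Complex.ofReal_re]; linarith
  have h2 : 0 < ((a + 1 : ℝ) : ℂ).re := by rw [Complex.ofReal_re]; linarith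
  have hcongr : ∀ x ∈ Set.Ioo (0 : ℝ) 1,
      (x : ℂ) ^ (((b + 1 : ℝ) : ℂ) - 1) * (1 - (x : ℂ)) ^ (((a + 1 : ℝ) : ℂ) - 1) =
      ((x ^ b * (1 - x) ^ a : ℝ) : ℂ) := by
    intro x hx
    rw [Complex.ofReal_mul, Complex.ofReal_cpow hx.1.le, Complex.ofReal_cpow (by linarith [hx.2])]
    push_cast
    simp only [add_sub_cancel_right]
  have hint := Complex.betaIntegral_convergent h1 h2
  rw [intervalIntegrable_iff_integrableOn_Ioo_of_le zero_le_one,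
    integrableOn_congr_fun hcongr measurableSet_Ioo] at hint
  refine ⟨by rw [IntegrableOn]; simpa using hint.re, ?_⟩
  have h3 := ProbabilityTheory.beta_eq_betaIntegralReal (b + 1) (a + 1) (by linarith) (by linarith)
  rw [Complex.betaIntegral, intervalIntegral.integral_of_le zero_le_one,
    integral_Ioc_eq_integral_Ioo, setIntegral_congr_fun measurableSet_Ioo hcongr,
    integral_complex_ofReal, Complex.ofReal_re] at h3
  rw [← h3, ProbabilityTheory.beta, show b + 1 + (a + 1) = a + b + 2 by ring]

theorem isMomentFunctional_beta {A B : ℝ} (hA : -1 < A) (hB : -1 < B) (k : ℕ) :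
    IsMomentFunctional (volume.restrict (Set.Icc 0 1))
      (fun x : ℝ => x ^ B * (1 - x) ^ A * x ^ k) (betaFunctional A (B + k)) := by
  have hr : (volume : Measure ℝ).restrict (Set.Icc 0 1) = volume.restrict (Set.Ioo 0 1) :=
    Measure.restrict_congr_set Ioo_ae_eq_Icc.symm
  rw [hr]
  refine IsMomentFunctional.of_monomials fun p => ?_
  have hk : (0 : ℝ) ≤ k := Nat.cast_nonneg k
  have hp : (0 : ℝ) ≤ p := Nat.cast_nonneg p
  have hcongr : ∀ x ∈ Set.Ioo (0 : ℝ) 1, x ^ (B + k + p) * (1 - x) ^ A =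
      x ^ B * (1 - x) ^ A * x ^ k * x ^ p := by
    intro x hx
    rw [Real.rpow_add hx.1, Real.rpow_add hx.1, Real.rpow_natCast, Real.rpow_natCast]
    ring
  obtain ⟨h1, h2⟩ := integral_rpow_mul_one_sub_rpow (b := B + k + p) hA (by linarith)
  refine ⟨(integrableOn_congr_fun hcongr measurableSet_Ioo).mp h1, ?_⟩
  rw [betaFunctional_X_pow, show A + (B + k) + p + 2 = A + (B + k + p) + 2 by ring, ← h2]
  exact (setIntegral_congr_fun measurableSet_Ioo hcongr).symm

theorem isMomentFunctional_beta_one {A B : ℝ} (hA : -1 < A) (hB : -1 < B) :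
    IsMomentFunctional (volume.restrict (Set.Icc 0 1))
      (fun x : ℝ => x ^ B * (1 - x) ^ A) (betaFunctional A B) := by
  have := isMomentFunctional_beta hA hB 0
  simpa using this

theorem integral_jointDensity_beta_ne_zero {A B : ℝ} (hA : -1 < A) (hB : -1 < B) (n : ℕ) :
    ∫ x in Set.univ.pi (fun _ : Fin n => Set.Icc (0 : ℝ) 1),
      jointDensity 4 (fun x => x ^ B * (1 - x) ^ A) x ≠ 0 := by
  refine (integral_jointDensity_pos measurableSet_Icc
    (fun x hx => mul_nonneg (Real.rpow_nonneg hx.1 _) (Real.rpow_nonneg (by linarith [hx.2]) _))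
    (zero_lt_one' ℝ) Set.Ioo_subset_Icc_self
    (fun x hx => mul_pos (Real.rpow_pos_of_pos hx.1 _) (Real.rpow_pos_of_pos (by linarith [hx.2]) _))
    ?_).ne'
  have h := isMomentFunctional_beta_one hA hB
  exact (linearStatisticAverage_four (w := fun x => x ^ B * (1 - x) ^ A)
    (f := fun _ => (1 : ℝ)) h (by simp only [mul_one]; exact h)
    (fun j => X ^ j) (fun j => natDegree_X_pow j) (fun j => pow_ne_zero j X_ne_zero) n).1

theorem transmissionMoment_four_eq_average (δ : ℝ) (k n m : ℕ) :
    transmissionMoment 4 δ k n m = linearStatisticAverage 4 (Set.Icc 0 1)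
      (fun x => x ^ (2 * ((m : ℝ) - n) + 1) * (1 - x) ^ (δ / 2)) n (fun x => x ^ k) := by
  rw [transmissionMoment, jacobiMoment]
  congr 1
  funext x
  rw [jacobiWeight_transmission 4 (by norm_num)]
  congr 2
  push_cast
  ring

theorem transmissionMoment_two_eq_average (δ : ℝ) (k n m : ℕ) :
    transmissionMoment 2 δ k n m = linearStatisticAverage 2 (Set.Icc 0 1)
      (fun x => x ^ ((m : ℝ) - n) * (1 - x) ^ (δ / 2)) n (fun x => x ^ k) := by
  rw [transmissionMoment, jacobiMoment]
  congr 1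
  funext x
  rw [jacobiWeight_transmission 2 (by norm_num)]
  congr 2
  push_cast
  ring

/-- A and B are the exponents of the unitary weight; both symplectic exponents are larger by one
because the integration by parts in the Wronskian uses up x(1 - x). Only even indices appear since
the last column of the inverse matrix has no odd entries. -/
theorem linearStatisticAverage_four_beta {A B : ℝ} (hA : -1 < A) (hB : 0 ≤ B) (k : ℕ) {n : ℕ}
    (hn : 1 ≤ n) :
    linearStatisticAverage 4 (Set.Icc 0 1) (fun x : ℝ => x ^ (B + 1) * (1 - x) ^ (A + 1)) n
        (fun x => x ^ k) =
      linearStatisticAverage 2 (Set.Icc 0 1) (fun x : ℝ => x ^ B * (1 - x) ^ A) (2 * n)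
        (fun x => x ^ k) / 2 +
      jacobiTau A B (2 * n - 1) / jacobiNorm A B (2 * n) / 2 *
        ∑ j ∈ Finset.range n, tridiagonalKernel (fun l => -jacobiTau A B l) n j *
          betaFunctional A (B + k) (jacobiPoly (2 * j) A B * jacobiPoly (2 * n) A B) := by
  have hk : (0 : ℝ) ≤ k := Nat.cast_nonneg k
  have hdeg : ∀ j, (jacobiPoly j A B).natDegree = j := fun j =>
    natDegree_jacobiPoly (by linarith) j
  have hne : ∀ j, jacobiPoly j A B ≠ 0 := fun j => jacobiPoly_ne_zero (by linarith) j
  have h4 := linearStatisticAverage_four_eq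
    (w := fun x : ℝ => x ^ (B + 1) * (1 - x) ^ (A + 1)) (f := fun x : ℝ => x ^ k)
    (isMomentFunctional_beta_one (A := A + 1) (B := B + 1) (by linarith) (by linarith))
    (isMomentFunctional_beta (A := A + 1) (B := B + 1) (by linarith) (by linarith) k)
    (fun j => jacobiPoly j A B) hdeg hne (n := n)
    (integral_jointDensity_beta_ne_zero (by linarith) (by linarith) n)
    (fun i l => betaFunctional A (B + k) (jacobiPoly i A B * jacobiPoly l A B))
    (fun i j => k * betaFunctional A (B + k) ((1 - X) * (jacobiPoly i A B * jacobiPoly j A B)))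
    (fun l => (jacobiNorm A B l)⁻¹)
    (fun i j h => wronskianPairing_jacobiPoly_of_lt hA hB h)
    (fun j => by
      rw [wronskianPairing_jacobiPoly_next hA hB]
      exact neg_ne_zero.mpr (jacobiTau_pos hA hB j).ne')
    (fun i j => by rw [mul_comm (jacobiPoly i A B)])
    (fun i j _ hj => jacobi_wronskian_expansion hA hB k hj)
  have h2 := linearStatisticAverage_two
    (w := fun x : ℝ => x ^ B * (1 - x) ^ A) (f := fun x : ℝ => x ^ k)
    (isMomentFunctional_beta_one hA (by linarith)) (isMomentFunctional_beta hA (by linarith) k)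
    (fun j => jacobiPoly j A B) hdeg hne (fun i j h => betaFunctional_orthogonal hA hB h)
    (fun j => by rw [betaFunctional_norm hA hB]; exact (jacobiNorm_pos hA hB j).ne') (2 * n)
  simp only [betaFunctional_norm hA hB, wronskianPairing_jacobiPoly_next hA hB] at h2 h4
  rw [h4, h2, mul_comm 2 n]
  obtain ⟨M, hM⟩ : ∃ M, n * 2 = M + 1 := ⟨n * 2 - 1, by omega⟩
  rw [hM, Nat.add_sub_cancel, wronskianPairing_jacobiPoly_succ hA hB]
  simp only [div_eq_mul_inv]
  ring

end JacobiEnsemble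

/-! ### Closed form of the Jacobi kernel -/

section JacobiCoefficients

theorem pochZ_eq_Gamma_div {x : ℝ} {s : ℤ} (hx : 0 < x) (hxs : 0 < x + s) :
    pochZ x s = Real.Gamma (x + s) / Real.Gamma x := by
  obtain ⟨s, rfl | rfl⟩ := s.eq_nat_or_neg
  · rw [pochZ_ofNat_eq x (fun l h => ?_)]
    · simp
    · have : (0 : ℝ) ≤ l := Nat.cast_nonneg l
      linarith
  · push_cast at hxs ⊢
    rw [pochZ_neg_eq x s (fun l h => ?_), sub_eq_add_neg]
    have : (0 : ℝ) ≤ l := Nat.cast_nonneg l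
    linarith

/-- The factor that solves the two-term recurrence of the tridiagonal kernel of Jacobi
polynomials. -/
def jacobiKernelFactor (A B : ℝ) (m : ℕ) : ℝ :=
  (2 * m).factorial * (A + B + 1 + 4 * m) * Real.Gamma (A + B + 2 * m + 1) /
    (m.factorial * Real.Gamma (A / 2 + 1 + m) * Real.Gamma (B / 2 + 1 + m) *
      Real.Gamma ((A + B) / 2 + m + 1))

theorem jacobiKernelFactor_pos {A B : ℝ} (hA : -1 < A) (hB : 0 ≤ B) (m : ℕ) :
    0 < jacobiKernelFactor A B m := by
  have hm : (0 : ℝ) ≤ m := Nat.cast_nonneg m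
  have h1 : 0 < Real.Gamma (A + B + 2 * m + 1) := Real.Gamma_pos_of_pos (by linarith)
  have h2 : 0 < Real.Gamma (A / 2 + 1 + m) := Real.Gamma_pos_of_pos (by linarith)
  have h3 : 0 < Real.Gamma (B / 2 + 1 + m) := Real.Gamma_pos_of_pos (by linarith)
  have h4 : 0 < Real.Gamma ((A + B) / 2 + m + 1) := Real.Gamma_pos_of_pos (by linarith)
  have h5 : 0 < A + B + 1 + 4 * m := by linarith
  have h6 : (0 : ℝ) < m.factorial := Nat.cast_pos.mpr m.factorial_pos
  have h7 : (0 : ℝ) < (2 * m).factorial := Nat.cast_pos.mpr (2 * m).factorial_pos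
  unfold jacobiKernelFactor
  positivity

/-- Multiplied by this factor, the two-term recurrence of the kernel acquires the constant ratio 16.
The Γ values at half arguments produce this constant through A + 2m + 2 = 2(A/2 + 1 + m) and its
analogues. -/
theorem jacobiTau_mul_jacobiKernelFactor_succ {A B : ℝ} (hA : -1 < A) (hB : 0 ≤ B) (m : ℕ) :
    jacobiTau A B (2 * m + 1) * jacobiKernelFactor A B (m + 1) =
      16 * jacobiTau A B (2 * m) * jacobiKernelFactor A B m := by
  have hm : (0 : ℝ) ≤ m := Nat.cast_nonneg m
  rw [jacobiTau, jacobiTau, jacobiKernelFactor, jacobiKernelFactor,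
    show 2 * (m + 1) = 2 * m + 1 + 1 by ring, Nat.factorial_succ (2 * m + 1),
    Nat.factorial_succ (2 * m), Nat.factorial_succ m]
  push_cast
  rw [show A + (2 * (m : ℝ) + 1) + 2 = A + 2 * m + 2 + 1 by ring,
    show B + (2 * (m : ℝ) + 1) + 2 = B + 2 * m + 2 + 1 by ring,
    show A + B + (2 * (m : ℝ) + 1) + 1 = A + B + 2 * m + 1 + 1 by ring,
    show A + B + 2 * ((m : ℝ) + 1) + 1 = A + B + 2 * m + 1 + 1 + 1 by ring,
    show A / 2 + 1 + ((m : ℝ) + 1) = A / 2 + 1 + m + 1 by ring,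
    show B / 2 + 1 + ((m : ℝ) + 1) = B / 2 + 1 + m + 1 by ring,
    show (A + B) / 2 + ((m : ℝ) + 1) + 1 = (A + B) / 2 + m + 1 + 1 by ring,
    Real.Gamma_add_one (s := A + 2 * m + 2) (by linarith),
    Real.Gamma_add_one (s := B + 2 * m + 2) (by linarith),
    Real.Gamma_add_one (s := A + B + 2 * m + 1 + 1) (by linarith),
    Real.Gamma_add_one (s := A + B + 2 * m + 1) (by linarith),
    Real.Gamma_add_one (s := A / 2 + 1 + m) (by linarith),
    Real.Gamma_add_one (s := B / 2 + 1 + m) (by linarith),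
    Real.Gamma_add_one (s := (A + B) / 2 + m + 1) (by linarith)]
  have h1 : Real.Gamma (A + B + 2 * m + 1) ≠ 0 := (Real.Gamma_pos_of_pos (by linarith)).ne'
  have h2 : Real.Gamma (A / 2 + 1 + m) ≠ 0 := (Real.Gamma_pos_of_pos (by linarith)).ne'
  have h3 : Real.Gamma (B / 2 + 1 + m) ≠ 0 := (Real.Gamma_pos_of_pos (by linarith)).ne'
  have h4 : Real.Gamma ((A + B) / 2 + m + 1) ≠ 0 := (Real.Gamma_pos_of_pos (by linarith)).ne'
  have h6 : (m.factorial : ℝ) ≠ 0 := Nat.cast_ne_zero.mpr m.factorial_ne_zero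
  have h7 : ((2 * m).factorial : ℝ) ≠ 0 := Nat.cast_ne_zero.mpr (2 * m).factorial_ne_zero
  generalize Real.Gamma (A + B + 2 * m + 1) = G₁ at h1 ⊢
  generalize Real.Gamma (A / 2 + 1 + m) = G₂ at h2 ⊢
  generalize Real.Gamma (B / 2 + 1 + m) = G₃ at h3 ⊢
  generalize Real.Gamma ((A + B) / 2 + m + 1) = G₄ at h4 ⊢
  generalize Real.Gamma (A + 2 * m + 2) = G₅
  generalize Real.Gamma (B + 2 * m + 2) = G₆
  generalize ((2 * m).factorial : ℝ) = f at h7 ⊢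
  generalize (m.factorial : ℝ) = f' at h6 ⊢
  have e1 : A / 2 + 1 + m ≠ 0 := by linarith
  have e2 : B / 2 + 1 + m ≠ 0 := by linarith
  have e3 : (A + B) / 2 + m + 1 ≠ 0 := by linarith
  have e4 : A + B + 2 * m + 1 ≠ 0 := by linarith
  have e5 : A + B + 2 * m + 1 + 1 ≠ 0 := by linarith
  have e6 : A + B + 2 * (2 * m) + 1 ≠ 0 := by linarith
  have e7 : A + B + 2 * (2 * m) + 3 ≠ 0 := by linarith
  have e8 : A + B + 2 * (2 * m + 1) + 3 ≠ 0 := by linarith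
  have e9 : 2 * (m : ℝ) + 1 ≠ 0 := by linarith
  have e10 : (m : ℝ) + 1 ≠ 0 := by linarith
  rw [show A + B + 1 + 4 * ((m : ℝ) + 1) = A + B + 2 * (2 * m + 1) + 3 by ring,
    show A + B + 1 + 4 * (m : ℝ) = A + B + 2 * (2 * m) + 1 by ring,
    show A + B + 2 * (2 * (m : ℝ) + 1) + 1 = A + B + 2 * (2 * m) + 3 by ring,
    show A + 2 * (m : ℝ) + 2 = 2 * (A / 2 + 1 + m) by ring,
    show B + 2 * (m : ℝ) + 2 = 2 * (B / 2 + 1 + m) by ring,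
    show A + B + 2 * (m : ℝ) + 1 + 1 = 2 * ((A + B) / 2 + m + 1) by ring,
    show 2 * (m : ℝ) + 1 + 1 = 2 * (m + 1) by ring]
  generalize A / 2 + 1 + (m : ℝ) = x₁ at e1 ⊢
  generalize B / 2 + 1 + (m : ℝ) = x₂ at e2 ⊢
  generalize (A + B) / 2 + (m : ℝ) + 1 = x₃ at e3 ⊢
  generalize A + B + 2 * (m : ℝ) + 1 = x₄ at e4 ⊢
  generalize A + B + 2 * (2 * (m : ℝ)) + 1 = x₅ at e6 ⊢
  generalize A + B + 2 * (2 * (m : ℝ)) + 3 = x₆ at e7 ⊢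
  generalize A + B + 2 * (2 * (m : ℝ) + 1) + 3 = x₇ at e8 ⊢
  field_simp
  ring

/-- The recurrence with constant ratio telescopes. The power 16^d is, up to a factor 2, the power
2^(4j-3) of the coefficients with d + 1 in place of j. -/
theorem tridiagonalKernel_jacobi {A B : ℝ} (hA : -1 < A) (hB : 0 ≤ B) (d m : ℕ) :
    tridiagonalKernel (fun j => -jacobiTau A B j) (m + d + 1) m =
      -(16 ^ d * jacobiKernelFactor A B m /
        (jacobiTau A B (2 * (m + d)) * jacobiKernelFactor A B (m + d))) := by
  induction d generalizing m with
  | zero =>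
    have h1 := tridiagonalKernel_last (t := fun j => -jacobiTau A B j) (n := m + 0 + 1) (by omega)
    simp only [add_zero, Nat.add_sub_cancel] at h1 ⊢
    have h2 := (jacobiKernelFactor_pos hA hB m).ne'
    rw [h1, pow_zero, one_mul, mul_comm (jacobiTau _ _ _), ← div_div, div_self h2, one_div,
      inv_neg]
  | succ d ih =>
    rw [tridiagonalKernel_step (by omega), show m + (d + 1) + 1 = m + 1 + d + 1 by ring, ih,
      show m + 1 + d = m + (d + 1) by ring, neg_div_neg_eq]
    have h1 := (jacobiKernelFactor_pos hA hB (m + 1)).ne'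
    have h2 := (jacobiTau_pos hA hB (2 * m)).ne'
    have h3 : jacobiTau A B (2 * m + 1) / jacobiTau A B (2 * m) * jacobiKernelFactor A B (m + 1) =
        16 * jacobiKernelFactor A B m := by
      rw [div_mul_eq_mul_div, jacobiTau_mul_jacobiKernelFactor_succ hA hB, div_eq_iff h2]
      ring
    rw [pow_succ]
    simp only [div_eq_mul_inv] at h3 ⊢
    linear_combination (-16 ^ d * (jacobiTau A B (2 * (m + (d + 1))) *
      jacobiKernelFactor A B (m + (d + 1)))⁻¹) * h3

/-- This collects the factors that depend on n = M + 1 alone: the rank one coefficient, the last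
kernel entry, and the Γ values of index q = 2n in `jacobiProductCoeff`. -/
theorem jacobiTau_div_jacobiNorm {A B : ℝ} (hA : -1 < A) (hB : 0 ≤ B) (M : ℕ) :
    jacobiTau A B (2 * M + 1) / jacobiNorm A B (2 * M + 2) / 2 *
        (jacobiTau A B (2 * M) * jacobiKernelFactor A B M)⁻¹ * Real.Gamma (A + 2 * M + 3) *
        (Real.Gamma (A + B + 2 * M + 3))⁻¹ =
      2 * (M + 1).factorial * Real.Gamma (A / 2 + M + 2) * Real.Gamma (B / 2 + M + 1) *
        Real.Gamma ((A + B) / 2 + M + 1) * (Real.Gamma (B + 2 * M + 2))⁻¹ *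
        (Real.Gamma (A + B + 2 * M + 2))⁻¹ := by
  have hM : (0 : ℝ) ≤ M := Nat.cast_nonneg M
  rw [jacobiTau, jacobiTau, jacobiKernelFactor, jacobiNorm,
    show 2 * M + 2 = 2 * M + 1 + 1 by ring, Nat.factorial_succ (2 * M + 1),
    Nat.factorial_succ (2 * M), Nat.factorial_succ M]
  push_cast
  rw [show A + (2 * (M : ℝ) + 1) + 2 = A + 2 * M + 2 + 1 by ring,
    show B + (2 * (M : ℝ) + 1) + 2 = B + 2 * M + 2 + 1 by ring,
    show A + (2 * (M : ℝ) + 1 + 1) + 1 = A + 2 * M + 2 + 1 by ring,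
    show B + (2 * (M : ℝ) + 1 + 1) + 1 = B + 2 * M + 2 + 1 by ring,
    show A + 2 * (M : ℝ) + 3 = A + 2 * M + 2 + 1 by ring,
    show A + B + (2 * (M : ℝ) + 1 + 1) + 1 = A + B + 2 * M + 2 + 1 by ring,
    show A + B + 2 * (M : ℝ) + 3 = A + B + 2 * M + 2 + 1 by ring,
    show A + B + (2 * (M : ℝ) + 1) + 1 = A + B + 2 * M + 2 by ring,
    show A / 2 + (M : ℝ) + 2 = A / 2 + 1 + M + 1 by ring,
    show B / 2 + (M : ℝ) + 1 = B / 2 + 1 + M by ring,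
    Real.Gamma_add_one (s := A + 2 * M + 2) (by linarith),
    Real.Gamma_add_one (s := B + 2 * M + 2) (by linarith),
    Real.Gamma_add_one (s := A + B + 2 * M + 2) (by linarith),
    Real.Gamma_add_one (s := A / 2 + 1 + M) (by linarith)]
  have h1 : Real.Gamma (A + B + 2 * M + 1) ≠ 0 := (Real.Gamma_pos_of_pos (by linarith)).ne'
  have h2 : Real.Gamma (A / 2 + 1 + M) ≠ 0 := (Real.Gamma_pos_of_pos (by linarith)).ne'
  have h3 : Real.Gamma (B / 2 + 1 + M) ≠ 0 := (Real.Gamma_pos_of_pos (by linarith)).ne'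
  have h4 : Real.Gamma ((A + B) / 2 + M + 1) ≠ 0 := (Real.Gamma_pos_of_pos (by linarith)).ne'
  have h5 : Real.Gamma (A + 2 * M + 2) ≠ 0 := (Real.Gamma_pos_of_pos (by linarith)).ne'
  have h8 : Real.Gamma (B + 2 * M + 2) ≠ 0 := (Real.Gamma_pos_of_pos (by linarith)).ne'
  have h9 : Real.Gamma (A + B + 2 * M + 2) ≠ 0 := (Real.Gamma_pos_of_pos (by linarith)).ne'
  have h6 : (M.factorial : ℝ) ≠ 0 := Nat.cast_ne_zero.mpr M.factorial_ne_zero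
  have h7 : ((2 * M).factorial : ℝ) ≠ 0 := Nat.cast_ne_zero.mpr (2 * M).factorial_ne_zero
  generalize Real.Gamma (A + B + 2 * M + 1) = G₁ at h1 ⊢
  generalize Real.Gamma (A / 2 + 1 + M) = G₂ at h2 ⊢
  generalize Real.Gamma (B / 2 + 1 + M) = G₃ at h3 ⊢
  generalize Real.Gamma ((A + B) / 2 + M + 1) = G₄ at h4 ⊢
  generalize Real.Gamma (A + 2 * M + 2) = G₅ at h5 ⊢
  generalize Real.Gamma (B + 2 * M + 2) = G₆ at h8 ⊢
  generalize Real.Gamma (A + B + 2 * M + 2) = G₇ at h9 ⊢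
  generalize ((2 * M).factorial : ℝ) = f at h7 ⊢
  generalize (M.factorial : ℝ) = f' at h6 ⊢
  have e1 : A / 2 + 1 + M ≠ 0 := by linarith
  have e2 : B + 2 * M + 2 ≠ 0 := by linarith
  have e4 : A + B + 2 * M + 2 ≠ 0 := by linarith
  have e6 : A + B + 2 * (2 * M) + 1 ≠ 0 := by linarith
  have e7 : A + B + 2 * (2 * M) + 3 ≠ 0 := by linarith
  have e8 : A + B + 2 * (2 * M) + 5 ≠ 0 := by linarith
  have e9 : 2 * (M : ℝ) + 1 ≠ 0 := by linarith
  have e10 : (M : ℝ) + 1 ≠ 0 := by linarith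
  rw [show A + B + 2 * (2 * (M : ℝ) + 1) + 3 = A + B + 2 * (2 * M) + 5 by ring,
    show A + B + 2 * (2 * (M : ℝ) + 1 + 1) + 1 = A + B + 2 * (2 * M) + 5 by ring,
    show A + B + 1 + 4 * (M : ℝ) = A + B + 2 * (2 * M) + 1 by ring,
    show A + B + 2 * (2 * (M : ℝ) + 1) + 1 = A + B + 2 * (2 * M) + 3 by ring,
    show A + 2 * (M : ℝ) + 2 = 2 * (A / 2 + 1 + M) by ring,
    show 2 * (M : ℝ) + 1 + 1 = 2 * (M + 1) by ring]
  generalize A / 2 + 1 + (M : ℝ) = x₁ at e1 ⊢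
  generalize B + 2 * (M : ℝ) + 2 = x₂ at e2 ⊢
  generalize A + B + 2 * (M : ℝ) + 2 = x₄ at e4 ⊢
  generalize A + B + 2 * (2 * (M : ℝ)) + 1 = x₅ at e6 ⊢
  generalize A + B + 2 * (2 * (M : ℝ)) + 3 = x₆ at e7 ⊢
  generalize A + B + 2 * (2 * (M : ℝ)) + 5 = x₇ at e8 ⊢
  field_simp

end JacobiCoefficients

/-! ### Identification of the double sum for transmission eigenvalues -/

section JacobiCorrection

/-- With δ = 2(A + 1), B = 2(m - n) and the index i = 2j - r, the Pochhammer symbols have positive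
arguments and become quotients of Γ values. Those independent of j and r are handled by
`jacobiTau_div_jacobiNorm`, the others match factor by factor. -/
theorem jacobiCoeff_eq {A B : ℝ} (hA : -1 < A) (hB : 0 ≤ B) (k d j r m : ℕ)
    (hm : (m : ℝ) = B / 2 + (j + d + 1)) (hr : r ≤ 2 * j) :
    jacobiCoeff (2 * (A + 1)) (2 * j - r) (d + 1) k m (j + d + 1) =
      -(jacobiTau A B (2 * (j + d) + 1) / jacobiNorm A B (2 * (j + d) + 2) / 2 *
        tridiagonalKernel (fun l => -jacobiTau A B l) (j + d + 1) j *
        jacobiProductCoeff A B k (2 * j) (2 * (j + d) + 2) r) := by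
  have hj0 : (0 : ℝ) ≤ j := Nat.cast_nonneg j
  have hd0 : (0 : ℝ) ≤ d := Nat.cast_nonneg d
  have hr0 : (0 : ℝ) ≤ r := Nat.cast_nonneg r
  have hk0 : (0 : ℝ) ≤ k := Nat.cast_nonneg k
  have hi : ((2 * j - r : ℕ) : ℝ) = 2 * j - r := by rw [Nat.cast_sub hr]; push_cast; rfl
  have hiZ : ((2 * j - r : ℕ) : ℤ) = 2 * j - r := by rw [Nat.cast_sub hr]; push_cast; rfl
  have hconst := jacobiTau_div_jacobiNorm hA hB (j + d)
  rw [tridiagonalKernel_jacobi hA hB, jacobiKernelFactor, jacobiProductCoeff]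
  set T := jacobiTau A B (2 * (j + d)) * jacobiKernelFactor A B (j + d) with hT
  have hG : ∀ x : ℝ, 0 < x → Real.Gamma x ≠ 0 := fun x hx => (Real.Gamma_pos_of_pos hx).ne'
  -- Here X = A + B + 4j + 1 is positive, so the removable singularity is not met.
  rw [jacobiCoeff, cancelledQuotient_eq _ (by rw [hm]; push_cast; linarith)]
  have p1 : pochZ (2 * (A + 1) / 2 + 2 * (j + d + 1 : ℕ) - (2 * j - r : ℕ) - 2 * (d + 1 : ℕ))
      (2 * j - r : ℕ) = Real.Gamma (A + (2 * j : ℕ) + 1) / Real.Gamma (A + r + 1) := by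
    rw [pochZ_eq_Gamma_div (by rw [hi]; push_cast; linarith)
      (by rw [hi, Int.cast_natCast, hi]; push_cast; linarith), hi, Int.cast_natCast, hi]
    push_cast
    congr 2 <;> ring
  have p2 : pochZ (2 * m) ((k : ℤ) - (2 * j - r : ℕ) - 2 * (d + 1 : ℕ) + 1) =
      Real.Gamma (B + k + r + 1) / Real.Gamma (B + 2 * (j + d : ℕ) + 2) := by
    rw [pochZ_eq_Gamma_div (by rw [hm]; linarith)
      (by rw [hm, hiZ]; push_cast; linarith), hm, hiZ]
    push_cast
    congr 2 <;> ring
  have p3 : pochZ (2 * (A + 1) / 2 + 2 * m - 1) ((k : ℤ) - (2 * j - r : ℕ) - 2 * (d + 1 : ℕ) + 1) =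
      Real.Gamma (A + B + k + r + 1) / Real.Gamma (A + B + 2 * (j + d : ℕ) + 2) := by
    rw [pochZ_eq_Gamma_div (by rw [hm]; linarith)
      (by rw [hm, hiZ]; push_cast; linarith), hm, hiZ]
    push_cast
    congr 2 <;> ring
  have p4 : pochZ (2 * (A + 1) / 4 + (j + d + 1 : ℕ) + 1 / 2) (-(d + 1 : ℕ)) =
      Real.Gamma (A / 2 + 1 + j) / Real.Gamma (A / 2 + (j + d : ℕ) + 2) := by
    rw [pochZ_eq_Gamma_div (by push_cast; linarith) (by push_cast; linarith)]
    push_cast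
    congr 2 <;> ring
  have p5 : pochZ m (1 - (d + 1 : ℕ)) =
      Real.Gamma (B / 2 + 1 + j) / Real.Gamma (B / 2 + (j + d : ℕ) + 1) := by
    rw [pochZ_eq_Gamma_div (by rw [hm]; linarith) (by rw [hm]; push_cast; linarith), hm]
    push_cast
    congr 2 <;> ring
  have p6 : pochZ (2 * (A + 1) / 4 + m - 1 / 2) (1 - (d + 1 : ℕ)) =
      Real.Gamma ((A + B) / 2 + j + 1) / Real.Gamma ((A + B) / 2 + (j + d : ℕ) + 1) := by
    rw [pochZ_eq_Gamma_div (by rw [hm]; linarith) (by rw [hm]; push_cast; linarith), hm]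
    push_cast
    congr 2 <;> ring
  have p7 : pochZ (2 * (j + d + 1 : ℕ) - 2 * (d + 1 : ℕ) + 1) (-(2 * j - r : ℕ)) =
      (r.factorial : ℝ) / (2 * j).factorial := by
    rw [pochZ_eq_Gamma_div (by push_cast; linarith) (by rw [hiZ]; push_cast; linarith), hiZ,
      ← Real.Gamma_nat_eq_factorial, ← Real.Gamma_nat_eq_factorial]
    push_cast
    congr 2 <;> ring
  have p8 : pochZ ((j + d + 1 : ℕ) + 1) (-(d + 1 : ℕ)) =
      (j.factorial : ℝ) / (j + d + 1).factorial := by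
    rw [pochZ_eq_Gamma_div (by push_cast; linarith) (by push_cast; linarith),
      ← Real.Gamma_nat_eq_factorial, ← Real.Gamma_nat_eq_factorial]
    push_cast
    congr 2; ring
  have p9 : pochZ (2 * (A + 1) / 2 + 2 * m + 2 * (j + d + 1 : ℕ) - 4 * (d + 1 : ℕ) -
      (2 * j - r : ℕ)) (1 + k) = Real.Gamma (A + B + k + (2 * j : ℕ) + r + 2) /
        Real.Gamma (A + B + (2 * j : ℕ) + r + 1) := by
    rw [pochZ_eq_Gamma_div (by rw [hm, hi]; push_cast; linarith)
      (by rw [hm, hi]; push_cast; linarith), hm, hi]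
    push_cast
    congr 2 <;> ring
  have p10 : pochZ (2 * (A + 1) / 2 + 2 * m + 2 * (j + d + 1 : ℕ) -
      (2 * j - r : ℕ) - 2 * (d + 1 : ℕ)) (1 + k) =
      Real.Gamma (A + B + k + (2 * (j + d) + 2 : ℕ) + r + 2) /
        Real.Gamma (A + B + (2 * (j + d) + 2 : ℕ) + r + 1) := by
    rw [pochZ_eq_Gamma_div (by rw [hm, hi]; push_cast; linarith)
      (by rw [hm, hi]; push_cast; linarith), hm, hi]
    push_cast
    congr 2 <;> ring
  rw [p1, p2, p3, p4, p5, p6, p7, p8, p9, p10, hi, hm,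
    show (2 : ℝ) ^ (4 * ((d + 1 : ℕ) : ℤ) - 3) = 2 * 16 ^ d by
      rw [show 4 * ((d + 1 : ℕ) : ℤ) - 3 = 1 + 4 * (d : ℤ) by push_cast; ring,
        zpow_add₀ two_ne_zero, zpow_mul, zpow_natCast]
      norm_num,
    show A + B + 1 + 4 * (j : ℝ) = 2 * (A + 1) / 2 + 2 * (B / 2 + (j + d + 1)) +
      2 * (j + d + 1 : ℕ) - 4 * (d + 1 : ℕ) by push_cast; ring,
    show 2 * (A + 1) / 2 + 2 * (B / 2 + ((j : ℝ) + d + 1)) + 2 * (j + d + 1 : ℕ) -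
      2 * (2 * j - r) - 4 * (d + 1 : ℕ) + k = A + B + k + 2 * r + 1 by push_cast; ring]
  have hz := hG (A + B + 2 * j + 1) (by linarith)
  have hff : ((j + d + 1).factorial : ℝ) ≠ 0 := Nat.cast_ne_zero.mpr (Nat.factorial_ne_zero _)
  rw [show A + ((2 * (j + d) + 2 : ℕ) : ℝ) + 1 = A + 2 * (j + d : ℕ) + 3 by push_cast; ring,
    show A + B + ((2 * (j + d) + 2 : ℕ) : ℝ) + 1 = A + B + 2 * (j + d : ℕ) + 3 by push_cast; ring,
    show A + B + ((2 * j : ℕ) : ℝ) + 1 = A + B + 2 * j + 1 by push_cast; ring]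
  generalize 2 * (A + 1) / 2 + 2 * (B / 2 + ((j : ℝ) + d + 1)) +
      2 * (j + d + 1 : ℕ) - 4 * (d + 1 : ℕ) = X₀
  generalize A + B + k + 2 * (r : ℝ) + 1 = Y₀
  generalize jacobiTau A B (2 * (j + d) + 1) / jacobiNorm A B (2 * (j + d) + 2) / 2 = g at hconst ⊢
  generalize (16 : ℝ) ^ d = u
  clear_value T
  have hzz := mul_inv_cancel₀ hz
  simp only [div_eq_mul_inv, mul_inv, inv_inv] at hconst ⊢
  generalize Real.Gamma (A + 2 * ((j + d : ℕ) : ℝ) + 3) = a₁ at hconst ⊢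
  generalize Real.Gamma (A + B + 2 * ((j + d : ℕ) : ℝ) + 3) = a₂ at hconst ⊢
  generalize Real.Gamma (A * 2⁻¹ + ((j + d : ℕ) : ℝ) + 2) = a₃ at hconst ⊢
  generalize Real.Gamma (B * 2⁻¹ + ((j + d : ℕ) : ℝ) + 1) = a₄ at hconst ⊢
  generalize Real.Gamma ((A + B) * 2⁻¹ + ((j + d : ℕ) : ℝ) + 1) = a₅ at hconst ⊢
  generalize Real.Gamma (B + 2 * ((j + d : ℕ) : ℝ) + 2) = a₆ at hconst ⊢
  generalize Real.Gamma (A + B + 2 * ((j + d : ℕ) : ℝ) + 2) = a₇ at hconst ⊢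
  generalize ((j + d + 1).factorial : ℝ) = a₈ at hconst ⊢
  generalize Real.Gamma (A + ((2 * j : ℕ) : ℝ) + 1) = b₁
  generalize Real.Gamma (A + (r : ℝ) + 1) = b₂
  generalize Real.Gamma (B + k + r + 1) = b₃
  generalize Real.Gamma (A + B + k + r + 1) = b₄
  generalize Real.Gamma (A * 2⁻¹ + 1 + (j : ℝ)) = b₅
  generalize Real.Gamma (B * 2⁻¹ + 1 + (j : ℝ)) = b₆
  generalize Real.Gamma ((A + B) * 2⁻¹ + (j : ℝ) + 1) = b₇
  generalize Real.Gamma (A + B + k + ((2 * j : ℕ) : ℝ) + r + 2) = c₁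
  generalize Real.Gamma (A + B + ((2 * j : ℕ) : ℝ) + r + 1) = c₂
  generalize Real.Gamma (A + B + k + ((2 * (j + d) + 2 : ℕ) : ℝ) + r + 2) = c₃
  generalize Real.Gamma (A + B + ((2 * (j + d) + 2 : ℕ) : ℝ) + r + 1) = c₄
  generalize Real.Gamma (A + B + 2 * j + 1) = z at hz hzz ⊢
  generalize (r.factorial : ℝ) = f₁
  generalize (j.factorial : ℝ) = f₂
  generalize ((2 * j).factorial : ℝ) = f₃
  -- `hzz` cancels Γ(A + B + 2j + 1), which occurs in the numerator of the kernel factor and in the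
  -- denominator of the product coefficient.
  linear_combination
    (-(u * b₁ * b₂⁻¹ * b₃ * b₄ * b₅⁻¹ * b₆⁻¹ * b₇⁻¹ * c₁⁻¹ * c₂ * c₃⁻¹ * c₄ * X₀ * Y₀ *
      f₁⁻¹ * f₂⁻¹ * f₃)) * (hconst + g * T⁻¹ * a₁ * a₂⁻¹ * hzz)

/-- The truncations of the sums by k are immaterial, because the binomial coefficient with lower
entry i + 2j > k vanishes; the sums are then reversed as in the Laguerre case. -/
theorem jacobiCorrection_eq_sum (δ : ℝ) (k m n : ℕ) :
    jacobiCorrection δ k m n = ∑ j ∈ Finset.range n, ∑ r ∈ Finset.range (2 * j + 1),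
      (k.choose (2 * j - r) : ℝ) * (k.choose (2 * n - r) : ℝ) *
        jacobiCoeff δ (2 * j - r) (n - j) k m n := by
  have h1 : jacobiCorrection δ k m n = ∑ j ∈ Finset.Icc 1 n, ∑ i ∈ Finset.Icc 0 (2 * n - 2 * j),
      (k.choose i : ℝ) * (k.choose (i + 2 * j) : ℝ) * jacobiCoeff δ i j k m n := by
    rw [jacobiCorrection]
    refine (Finset.sum_congr rfl fun j _ => ?_).trans (Finset.sum_subset
      (Finset.Icc_subset_Icc_right (min_le_left _ _)) fun j hj hj' => ?_)
    · refine Finset.sum_subset (Finset.Icc_subset_Icc_right (min_le_right _ _)) fun i hi hi' => ?_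
      rw [Finset.mem_Icc] at hi hi'
      rw [Nat.choose_eq_zero_of_lt (show k < i + 2 * j by omega)]
      simp
    · rw [Finset.mem_Icc] at hj hj'
      refine Finset.sum_eq_zero fun i _ => ?_
      rw [Nat.choose_eq_zero_of_lt (show k < i + 2 * j by omega)]
      simp
  rw [h1, sum_Icc_one_eq_sum_range_sub]
  refine Finset.sum_congr rfl fun j hj => ?_
  have hj' := Finset.mem_range.mp hj
  rw [show 2 * n - 2 * (n - j) = 2 * j by omega, ← Nat.range_succ_eq_Icc_zero,
    ← Finset.sum_flip]
  refine Finset.sum_congr rfl fun r hr => ?_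
  have hr' := Finset.mem_range.mp hr
  rw [show 2 * j - r + 2 * (n - j) = 2 * n - r by omega]

theorem jacobiCorrection_eq {A B : ℝ} (hA : -1 < A) (hB : 0 ≤ B) (k m n : ℕ)
    (hm : (m : ℝ) = B / 2 + n) :
    jacobiCorrection (2 * (A + 1)) k m n =
      -(jacobiTau A B (2 * n - 1) / jacobiNorm A B (2 * n) / 2 *
        ∑ j ∈ Finset.range n, tridiagonalKernel (fun l => -jacobiTau A B l) n j *
          betaFunctional A (B + k) (jacobiPoly (2 * j) A B * jacobiPoly (2 * n) A B)) := by
  rw [jacobiCorrection_eq_sum, Finset.mul_sum, ← Finset.sum_neg_distrib]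
  refine Finset.sum_congr rfl fun j hj => ?_
  obtain ⟨d, rfl⟩ := Nat.exists_eq_add_of_lt (Finset.mem_range.mp hj)
  rw [betaFunctional_mul_jacobiPoly hA hB k (by omega), ← mul_add, pow_mul, neg_one_sq, one_pow,
    one_mul, Finset.mul_sum, Finset.mul_sum, ← Finset.sum_neg_distrib]
  refine Finset.sum_congr rfl fun r hr => ?_
  have hr' : r ≤ 2 * j := by have := Finset.mem_range.mp hr; omega
  rw [show j + d + 1 - j = d + 1 by omega, jacobiCoeff_eq hA hB k d j r m
    (by rw [hm]; push_cast; ring) hr', show 2 * (j + d + 1) - 1 = 2 * (j + d) + 1 by omega,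
    show 2 * (j + d + 1) = 2 * (j + d) + 2 by omega]
  ring

/-- The unitary exponents are A = δ/2 - 1 and B = 2(m - n); the condition δ > 0 is the integrability
condition A > -1. -/
theorem transmissionMoment_four_eq {δ : ℝ} (hδ : 0 < δ) (k : ℕ) {n m : ℕ} (hn : 1 ≤ n)
    (hnm : n ≤ m) :
    transmissionMoment 4 δ k n m =
      1 / 2 * transmissionMoment 2 (δ - 2) k (2 * n) (2 * m) - jacobiCorrection δ k m n := by
  have hB : (0 : ℝ) ≤ 2 * ((m : ℝ) - n) := by
    have : (n : ℝ) ≤ m := by exact_mod_cast hnm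
    linarith
  have h := linearStatisticAverage_four_beta (A := δ / 2 - 1) (by linarith) hB k hn
  have hc := jacobiCorrection_eq (A := δ / 2 - 1) (by linarith) hB k m n (by ring)
  rw [sub_add_cancel] at h hc
  rw [show 2 * (δ / 2) = δ by ring] at hc
  rw [transmissionMoment_four_eq_average, transmissionMoment_two_eq_average, h, hc,
    show ((2 * m : ℕ) : ℝ) - (2 * n : ℕ) = 2 * ((m : ℝ) - n) by push_cast; ring,
    show (δ - 2) / 2 = δ / 2 - 1 by ring]
  ring

end JacobiCorrection

/-! ### Analytic continuation in δ -/

section TransmissionContinuation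

theorem analyticAt_realGamma {x : ℝ} (hx : 0 < x) : AnalyticAt ℝ Real.Gamma x := by
  have h1 : AnalyticAt ℝ Complex.Gamma (x : ℂ) :=
    (analyticAt_Gamma (by rw [Complex.ofReal_re]; linarith)
      (Complex.ofReal_ne_zero.mpr hx.ne')).restrictScalars
  have h2 : AnalyticAt ℝ (fun y : ℝ => Complex.Gamma (y : ℂ)) x :=
    AnalyticAt.comp (g := Complex.Gamma) (f := fun y : ℝ => (y : ℂ)) h1
      (Complex.ofRealCLM.analyticAt x)
  have h3 : AnalyticAt ℝ (fun y : ℝ => (Complex.Gamma (y : ℂ)).re) x :=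
    AnalyticAt.comp (g := Complex.re) (f := fun y : ℝ => Complex.Gamma (y : ℂ))
      (Complex.reCLM.analyticAt _) h2
  refine h3.congr (Eventually.of_forall fun y => ?_)
  simp only [Complex.Gamma_ofReal, Complex.ofReal_re]

theorem AnalyticAt.realGamma {f : ℝ → ℝ} {x : ℝ} (hf : AnalyticAt ℝ f x) (h : 0 < f x) :
    AnalyticAt ℝ (fun y => Real.Gamma (f y)) x :=
  AnalyticAt.comp (g := Real.Gamma) (analyticAt_realGamma h) hf

theorem analyticAt_betaFunctional {f : ℝ → ℝ} {x B : ℝ} (hf : AnalyticAt ℝ f x) (h : -1 < f x)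
    (hB : 0 ≤ B) (P : ℝ[X]) : AnalyticAt ℝ (fun y => betaFunctional (f y) B P) x := by
  refine analyticAt_momentFunctional (fun p => ?_) P
  have hp : (0 : ℝ) ≤ p := Nat.cast_nonneg p
  refine (analyticAt_const.mul ((hf.add analyticAt_const).realGamma ?_)).div
    ((((hf.add analyticAt_const).add analyticAt_const).add analyticAt_const).realGamma ?_) ?_
  · show 0 < f x + 1
    linarith
  · show 0 < f x + B + p + 2
    linarith
  · exact (Real.Gamma_pos_of_pos (by linarith)).ne'

/-- In monomials the moment is a quotient of Pfaffian sums of beta functions, analytic in δ, and the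
denominator is a nonzero multiple of the positive normalization. -/
theorem analyticAt_transmissionMoment_four {δ : ℝ} (hδ : -2 < δ) (k : ℕ) {n m : ℕ} (hnm : n ≤ m) :
    AnalyticAt ℝ (fun s => transmissionMoment 4 s k n m) δ := by
  have hB : (0 : ℝ) ≤ 2 * ((m : ℝ) - n) + 1 := by
    have : (n : ℝ) ≤ m := by exact_mod_cast hnm
    linarith
  set B := 2 * ((m : ℝ) - n) + 1 with hBdef
  have hk : (0 : ℝ) ≤ k := Nat.cast_nonneg k
  set T : ℝ → Matrix (Fin (n * 2)) (Fin (n * 2)) ℝ := fun s => Matrix.of fun p q =>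
    betaFunctional (s / 2) B (X ^ (p : ℕ) * derivative (X ^ (q : ℕ))) with hT
  set U : ℝ → Matrix (Fin (n * 2)) (Fin (n * 2)) ℝ := fun s => Matrix.of fun p q =>
    betaFunctional (s / 2) (B + k) (X ^ (p : ℕ) * derivative (X ^ (q : ℕ))) with hU
  have hmain : ∀ s : ℝ, -2 < s → transmissionMoment 4 s k n m =
      (∑ i₀, pfaffianSum (Function.update (fun _ : Fin n => T s) i₀ (U s))) /
        pfaffianSum (fun _ : Fin n => T s) ∧ pfaffianSum (fun _ : Fin n => T s) ≠ 0 := by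
    intro s hs
    obtain ⟨-, ⟨c, hc, hZ⟩, h⟩ := linearStatisticAverage_four
      (w := fun x : ℝ => x ^ B * (1 - x) ^ (s / 2)) (f := fun x : ℝ => x ^ k)
      (isMomentFunctional_beta_one (A := s / 2) (B := B) (by linarith) (by linarith))
      (isMomentFunctional_beta (A := s / 2) (B := B) (by linarith) (by linarith) k)
      (fun j => X ^ j) (fun j => natDegree_X_pow j) (fun j => pow_ne_zero j X_ne_zero) n
    refine ⟨by rw [transmissionMoment_four_eq_average, h], ?_⟩
    rw [hT]
    simp only
    rw [← hZ]
    exact mul_ne_zero hc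
      (integral_jointDensity_beta_ne_zero (A := s / 2) (B := B) (by linarith) (by linarith) n)
  have hev : ∀ᶠ s : ℝ in 𝓝 δ, -2 < s := lt_mem_nhds hδ
  have hTa : ∀ p q, AnalyticAt ℝ (fun s => T s p q) δ := fun p q =>
    analyticAt_betaFunctional (f := fun s => s / 2) (by fun_prop) (by linarith) hB _
  have hUa : ∀ p q, AnalyticAt ℝ (fun s => U s p q) δ := fun p q =>
    analyticAt_betaFunctional (f := fun s => s / 2) (by fun_prop) (by linarith) (by linarith) _
  have heq : (fun s => (∑ i₀, pfaffianSum (Function.update (fun _ : Fin n => T s) i₀ (U s))) /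
      pfaffianSum (fun _ : Fin n => T s)) =ᶠ[𝓝 δ] fun s => transmissionMoment 4 s k n m := by
    filter_upwards [hev] with s hs
    exact (hmain s hs).1.symm
  refine AnalyticAt.congr (AnalyticAt.div ?_ ?_ (hmain δ hδ).2) heq
  · refine Finset.analyticAt_fun_sum _ fun i₀ _ => analyticAt_pfaffianSum fun i p q => ?_
    by_cases hi : i = i₀
    · subst hi
      simp only [Function.update_self]
      exact hUa p q
    · simp only [Function.update_of_ne hi]
      exact hTa p q
  · exact analyticAt_pfaffianSum fun i p q => hTa p q

theorem AnalyticAt.fun_pochZ_natCast {f : ℝ → ℝ} {x : ℝ} (hf : AnalyticAt ℝ f x) (s : ℕ) :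
    AnalyticAt ℝ (fun y => pochZ (f y) s) x :=
  Finset.analyticAt_fun_prod _ fun _ _ => hf.add analyticAt_const

theorem pochZ_ne_zero {x : ℝ} {s : ℤ} (h : 0 < x) (hs : 0 < x + s) : pochZ x s ≠ 0 := by
  rw [pochZ_eq_Gamma_div h hs]
  exact (div_pos (Real.Gamma_pos_of_pos hs) (Real.Gamma_pos_of_pos h)).ne'

theorem AnalyticAt.fun_pochZ {f : ℝ → ℝ} {x : ℝ} {s : ℤ} (hf : AnalyticAt ℝ f x) (h : 0 < f x)
    (hs : 0 < f x + s) : AnalyticAt ℝ (fun y => pochZ (f y) s) x := by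
  have hfs : AnalyticAt ℝ (fun y => f y + s) x := hf.add analyticAt_const
  have heq : (fun y => Real.Gamma (f y + s) / Real.Gamma (f y)) =ᶠ[𝓝 x]
      fun y => pochZ (f y) s := by
    filter_upwards [hf.continuousAt.eventually (lt_mem_nhds h),
      hfs.continuousAt.eventually (lt_mem_nhds hs)] with y h1 h2
    exact (pochZ_eq_Gamma_div h1 h2).symm
  exact ((hfs.realGamma hs).div (hf.realGamma h) (Real.Gamma_pos_of_pos h).ne').congr heq

/-- For δ > -2 and the indices of the truncated sum, the remaining denominators stay away from zero
once the quotient at i = 0 has been cancelled. -/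
theorem analyticAt_jacobiCoeff {δ : ℝ} (hδ : -2 < δ) {i j k m n : ℕ} (hnm : n ≤ m) (hj : 1 ≤ j)
    (hjn : j ≤ n) (hik : i + 2 * j ≤ k) (hin : i + 2 * j ≤ 2 * n) :
    AnalyticAt ℝ (fun s => jacobiCoeff s i j k m n) δ := by
  have c1 : (n : ℝ) ≤ m := by exact_mod_cast hnm
  have c2 : (1 : ℝ) ≤ j := by exact_mod_cast hj
  have c3 : (j : ℝ) ≤ n := by exact_mod_cast hjn
  have c4 : (i : ℝ) + 2 * j ≤ k := by exact_mod_cast hik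
  have c5 : (i : ℝ) + 2 * j ≤ 2 * n := by exact_mod_cast hin
  have c6 : (0 : ℝ) ≤ i := Nat.cast_nonneg i
  have c7 : (0 : ℝ) ≤ k := Nat.cast_nonneg k
  unfold jacobiCoeff
  refine AnalyticAt.mul (AnalyticAt.div (analyticAt_const.mul (AnalyticAt.mul
    (AnalyticAt.mul ?_ analyticAt_const) ?_)) ?_ ?_)
    (AnalyticAt.div (AnalyticAt.mul ?_ (by fun_prop)) ?_ ?_)
  -- The argument δ/2 + 2n - i - 2j may be negative or zero, so the polynomial form is used instead
  -- of a quotient of Γ values.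
  · exact AnalyticAt.fun_pochZ_natCast (by fun_prop) i
  · exact AnalyticAt.fun_pochZ (by fun_prop) (by linarith) (by push_cast; linarith)
  · refine AnalyticAt.mul (AnalyticAt.mul (AnalyticAt.mul (AnalyticAt.mul ?_ analyticAt_const) ?_)
      analyticAt_const) analyticAt_const
    · exact AnalyticAt.fun_pochZ (by fun_prop) (by linarith) (by push_cast; linarith)
    · exact AnalyticAt.fun_pochZ (by fun_prop) (by linarith) (by push_cast; linarith)
  · refine mul_ne_zero (mul_ne_zero (mul_ne_zero (mul_ne_zero ?_ ?_) ?_) ?_) ?_ <;>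
      exact pochZ_ne_zero (by linarith) (by push_cast; linarith)
  · unfold cancelledQuotient
    -- For i = 0 the number X = δ/2 + 2m + 2n - 4j exceeds -1 but can vanish, and only (X + 1)_(k)
    -- is left in the denominator. For i > 0 one has j < n, which makes X - i positive.
    rcases Nat.eq_zero_or_pos i with rfl | hi
    · simp only [if_true]
      refine AnalyticAt.inv (AnalyticAt.fun_pochZ_natCast (by fun_prop) k) ?_
      exact pochZ_ne_zero (by linarith) (by push_cast; linarith)
    · have c8 : (j : ℝ) + 1 ≤ n := by exact_mod_cast (by omega : j + 1 ≤ n)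
      simp only [hi.ne', if_false]
      refine AnalyticAt.div (by fun_prop) (AnalyticAt.fun_pochZ (by fun_prop) (by linarith)
        (by push_cast; linarith)) ?_
      exact pochZ_ne_zero (by linarith) (by push_cast; linarith)
  · exact AnalyticAt.fun_pochZ (by fun_prop) (by linarith) (by push_cast; linarith)
  · exact pochZ_ne_zero (by linarith) (by push_cast; linarith)

theorem analyticAt_jacobiCorrection {δ : ℝ} (hδ : -2 < δ) (k : ℕ) {m n : ℕ} (hnm : n ≤ m) :
    AnalyticAt ℝ (fun s => jacobiCorrection s k m n) δ := by
  unfold jacobiCorrection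
  refine Finset.analyticAt_fun_sum _ fun j hj => Finset.analyticAt_fun_sum _ fun i hi => ?_
  rw [Finset.mem_Icc] at hi hj
  exact analyticAt_const.mul
    (analyticAt_jacobiCoeff hδ hnm hj.1 (by omega) (by omega) (by omega))

/-- F is the identity solved for the unitary moment, with δ + 2 in place of δ. It is analytic on
(-4, ∞) since both ingredients are analytic beyond -2, and it agrees with the unitary moment for δ >
-2 because δ + 2 > 0 is the range of `transmissionMoment_four_eq`. -/
theorem exists_transmissionContinuation (k : ℕ) {n m : ℕ} (hn : 1 ≤ n) (hnm : n ≤ m) :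
    ∃ F : ℝ → ℝ, AnalyticOnNhd ℝ F (Set.Ioi (-4)) ∧
      (∀ δ : ℝ, -2 < δ → F δ = transmissionMoment 2 δ k (2 * n) (2 * m)) ∧
      (∀ δ : ℝ, -2 < δ →
        transmissionMoment 4 δ k n m = 1 / 2 * F (δ - 2) - jacobiCorrection δ k m n) := by
  refine ⟨fun δ => 2 * (transmissionMoment 4 (δ + 2) k n m + jacobiCorrection (δ + 2) k m n),
    fun δ hδ => ?_, fun δ hδ => ?_, fun δ _ => ?_⟩
  · have hδ' : -2 < δ + 2 := by
      have : -4 < δ := hδ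
      linarith
    have hs : AnalyticAt ℝ (fun s : ℝ => s + 2) δ := by fun_prop
    exact analyticAt_const.mul
      ((AnalyticAt.comp (g := fun s => transmissionMoment 4 s k n m)
        (f := fun s : ℝ => s + 2)
        (analyticAt_transmissionMoment_four hδ' k hnm) hs).add
      (AnalyticAt.comp (g := fun s => jacobiCorrection s k m n)
        (f := fun s : ℝ => s + 2)
        (analyticAt_jacobiCorrection hδ' k hnm) hs))
  · simp only [transmissionMoment_four_eq (δ := δ + 2) (by linarith) k hn hnm, add_sub_cancel_right]
    ring
  · simp only [sub_add_cancel]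
    ring

end TransmissionContinuation
end

/-! ### The theorem -/

theorem theorem2p2 :
    -- transmission eigenvalues
    (∀ n m k : ℕ, 1 ≤ n → n ≤ m → 1 ≤ k →
      -- both sides given by convergent integrals
      (∀ δ : ℝ, 0 < δ →
        transmissionMoment 4 δ k n m =
          1 / 2 * transmissionMoment 2 (δ - 2) k (2 * n) (2 * m) - jacobiCorrection δ k m n) ∧
      -- the whole range of convergence of the left-hand side, the unitary moment on the right
      -- being continued analytically in its parameter
      (∃ F : ℝ → ℝ, AnalyticOnNhd ℝ F (Set.Ioi (-4)) ∧
        (∀ δ : ℝ, -2 < δ → F δ = transmissionMoment 2 δ k (2 * n) (2 * m)) ∧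
        (∀ δ : ℝ, -2 < δ →
          transmissionMoment 4 δ k n m = 1 / 2 * F (δ - 2) - jacobiCorrection δ k m n))) ∧
    -- Laguerre symplectic ensemble
    (∀ n : ℕ, 1 ≤ n →
      -- both sides given by convergent integrals
      (∀ (b : ℝ) (k : ℂ), -1 < 2 * b → -1 < 2 * b + k.re →
        laguerreMoment 4 b k n =
          (2 : ℂ) ^ (-k - 1) * laguerreMoment 2 (2 * b) k (2 * n) - laguerreCorrection b k n) ∧
      -- the whole range of convergence of the left-hand side, the unitary moment on the right
      -- being continued analytically in its parameter and its order
      (∃ F : ℂ × ℂ → ℂ,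
        AnalyticOnNhd ℂ F {p | -2 < p.1.re ∧ -2 < p.1.re + p.2.re ∧ p.1 + p.2 ≠ -1} ∧
        (∀ (b : ℝ) (k : ℂ), -1 < b → -1 < b + k.re →
          F ((b : ℂ), k) = laguerreMoment 2 b k (2 * n)) ∧
        (∀ (b : ℝ) (k : ℂ), -1 < b → -2 < 2 * b + k.re → 2 * (b : ℂ) + k ≠ -1 →
          laguerreMoment 4 b k n =
            (2 : ℂ) ^ (-k - 1) * F (2 * (b : ℂ), k) - laguerreCorrection b k n) ∧
        (∀ (b : ℝ) (k : ℂ), -1 < b → 2 * (b : ℂ) + k = -1 →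
          Tendsto
            (fun s : ℂ => (2 : ℂ) ^ (-s - 1) * F (2 * (b : ℂ), s) - laguerreCorrection b s n)
            (𝓝[≠] k) (𝓝 (laguerreMoment 4 b k n))))) ∧
    -- proper delay times
    (∀ n k : ℕ, 1 ≤ n → 1 ≤ k → k < 2 * n + 1 →
      (delayMoment 4 k n : ℂ) =
        (n : ℂ) ^ ((k : ℤ) - 1) * laguerreMoment 4 ((n : ℝ) - 1 / 2) (-(k : ℂ)) n) := by
  refine ⟨fun n m k hn hnm _ => ⟨fun δ hδ => transmissionMoment_four_eq hδ k hn hnm,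
    exists_transmissionContinuation k hn hnm⟩, fun n hn => ⟨fun b k hb hk => ?_,
    laguerreContinuation (2 * n), analyticOnNhd_laguerreContinuation (2 * n),
    fun b k hb hk => (laguerreMoment_two_eq hb hk (2 * n)).symm,
    fun b k hb hk hbk => laguerreMoment_four_eq hb hk hbk hn,
    fun b k hb hk => tendsto_laguerre_right_side hb hk hn⟩,
    fun n k hn _ _ => delayMoment_four_eq hn⟩
  have hbk : 2 * (b : ℂ) + k ≠ -1 := fun h => by
    have := congrArg Complex.re h
    simp at this
    linarith
  rw [laguerreMoment_two_eq hb hk, laguerreMoment_four_eq (by linarith) (by linarith) hbk hn]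
  push_cast
  rfl
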